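/- Let $\Lambda>0$, $m>0$, $3m\sqrt\Lambda<1$. Let $0<r_{\mathcal H}<r_{\mathcal C}$ be the positive roots of $r-2m-\frac{\Lambda}{3}r^3$, put $\bar r=r_{\mathcal H}+r_{\mathcal C}$ (so $-\bar r$ is the negative root), $\kappa=\frac{\Lambda}{6}\frac{(r_{\mathcal C}-r_{\mathcal H})(r_{\mathcal C}+\bar r)}{r_{\mathcal C}}$, $\alpha=\frac{r_{\mathcal H}}{r_{\mathcal C}}\frac{r_{\mathcal C}+\bar r}{r_{\mathcal H}+\bar r}$, $\beta=\frac{\bar r}{r_{\mathcal C}}\frac{r_{\mathcal C}-r_{\mathcal H}}{\bar r+r_{\mathcal H}}$. Consider the part $\mathcal M=\{(u,v)\in\mathbb R^2:uv<1\}\times\mathbb S^2$ of Schwarzschild–de Sitter spacetime with metric $g=-\Omega^2\,du\,dv+r^2\gamma$, where $\gamma$ is the round metric of the unit sphere, $r=r(u,v)>r_{\mathcal H}$ is defined by $$uv=\frac{r-r_{\mathcal C}}{(r-r_{\mathcal H})^{\alpha}(r+\bar r)^{\beta}},\qquad \Omega^2=\frac{12}{\Lambda r}\,\frac{r_{\mathcal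 C}^2\,(r-r_{\mathcal H})^{1+\alpha}(r+\bar r)^{1+\beta}}{(r_{\mathcal C}-r_{\mathcal H})^2(r_{\mathcal C}+\bar r)^2},$$ and $u,v$ increase to the future. Let $\mathcal R^+=\{u,v>0\}$ be the expanding region, $\Sigma_\rho=\mathcal R^+\cap\{r=\rho\}$ for $\rho>r_{\mathcal C}$, $\mathcal C^+=\{v=0,u\ge0\}$ and $\bar{\mathcal C}^+=\{u=0,v\ge0\}$ the cosmological horizons, $T=\kappa(u\partial_u-v\partial_v)$ the stationary Killing field with flow $\varphi_t$. On $\mathcal R^+$ let $\phi=(\frac{\Lambda r^2}{3}+\frac{2m}{r}-1)^{-1/2}$, $t=\frac1{2\kappa}\log\frac uv$, and use the coordinates $(t,r)$, in which $\partial_t=T$ and $\partial_r=\phi^2\kappa(u\partial_u+v\partial_v)$. For a function $\psi$ let $T_{\mu\nu}[\psi]=\partial_\mu\psi\,\partial_\nu\psi-\frac12g_{\mu\nu}\partial^\alpha\psi\,\partial_\alpha\psi$ and $J^N_\mu[\psi]=T_{\mu\nu}[\psi]N^\nu$; ${}^*J$ is the dual of the 1-form $J$ with respect to the volume form of $g$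 (on $\mathcal C^+$ oriented so that ${}^*J^N\ge0$ for future-directed timelike $N$), $|\nabla\!\!\!\!/\,\psi|$ is the norm of the derivative of $\psi$ along the spheres of radius $r$, and $\bar g_{r_1}$ is the induced metric of $\Sigma_{r_1}$. There is a function $C:(r_{\mathcal C},\infty)\to[0,\infty)$ depending only on $\Lambda,m$ such that the following holds. Let $\Sigma\subset\overline{\mathcal R^+}$ be a smooth spacelike hypersurface crossing both horizons to the future of $\mathcal C^+\cap\bar{\mathcal C}^+$, i.e. a spacelike graph $v=h(u,\omega)$, $0\le u\le u_0(\omega)$, $\omega\in\mathbb S^2$, where $h$ is smooth, $u_0(\omega)>0$, $h(u,\omega)>0$ for $0\le u<u_0(\omega)$, $h(u_0(\omega),\omega)=0$; let $n$ be its future unit normal, $\bar g$ its first fundamental form, and $\mathcal C_0^+=\mathcal C^+\cap J^+(\Sigma)$. Then there are constants $r_{\mathcal H}<r_0^-<r_{\mathcal C}<r_0^+$ and a smooth future-directed timelike vector field $N$ on (a neighbourhood of) $\{u>0,\ r_0^-\le r\le r_0^+\}$, invariant under the flow $\varphi_t$ of $T$, such that $J^+(\Sigma)\cap\{r\le r_0^+\}$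 does not meet $\{u=v\}$, and for every $C^2$ solution $\psi$ of $\Box_g\psi=0$ on an open neighbourhood of $J^+(\Sigma)$ and every $r_{\mathcal C}<r_1<r_0^+$, $$\int_{\Sigma_{r_1}\cap J^+(\Sigma)\cap\{u>v\}}\Bigl\{\tfrac1{\phi^2}(\partial_r\psi)^2+\phi^2(\partial_t\psi)^2+|\nabla\!\!\!\!/\,\psi|^2\Bigr\}\phi\,d\mu_{\bar g_{r_1}}\le C(r_1)\int_{\mathcal C_0^+}{}^*J^N[\psi]+C(r_1)\int_{\Sigma'\cap\{u>v\}}J^N[\psi]\cdot n\,d\mu_{\bar g},$$ where $\Sigma'=\Sigma\cap J^-(\Sigma_{r_1})$ and the integrals of these nonnegative densities may be infinite. (Thus $\{u>v\}$ selects the end of $\Sigma_{r_1}\cap J^+(\Sigma)$ adjacent to $\mathcal C_0^+$; the isometry $(u,v)\mapsto(v,u)$ gives the same statement for the other horizon.) -/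

import Mathlib

open Set MeasureTheory
open scoped ContDiff ENNReal NNReal

noncomputable section

namespace SdS

/-! ### The parameters of the Schwarzschild-de Sitter family -/

/-- The positive roots of `r - 2m - Λ r³ / 3`, i.e. the area radii of the horizons. -/
def horizonRadii (Λ m : ℝ) : Set ℝ := {r | 0 < r ∧ r - 2 * m - Λ * r ^ 3 / 3 = 0}

/-- Radius of the event horizon: the smaller positive root. -/
def rH (Λ m : ℝ) : ℝ := sInf (horizonRadii Λ m)

/-- Radius of the cosmological horizon: the larger positive root. -/
def rC (Λ m : ℝ) : ℝ := sSup (horizonRadii Λ m)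

/-- Absolute value of the negative root (the cubic has no quadratic term, so its three roots
add up to zero). -/
def rB (Λ m : ℝ) : ℝ := rH Λ m + rC Λ m

/-- Surface gravity of the cosmological horizon. -/
def kappa (Λ m : ℝ) : ℝ :=
  1 / 2 * (Λ / 3) * ((rC Λ m - rH Λ m) * (rC Λ m + rB Λ m) / rC Λ m)

def expH (Λ m : ℝ) : ℝ := rH Λ m / rC Λ m * ((rC Λ m + rB Λ m) / (rH Λ m + rB Λ m))

def expB (Λ m : ℝ) : ℝ := rB Λ m / rC Λ m * ((rC Λ m - rH Λ m) / (rB Λ m + rH Λ m))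

/-- The strictly increasing function `(rH, ∞) → (-∞, 1)` with `u v = uvOfRadius r`. -/
def uvOfRadius (Λ m r : ℝ) : ℝ :=
  (r - rC Λ m) / ((r - rH Λ m) ^ expH Λ m * (r + rB Λ m) ^ expB Λ m)

/-- The conformal factor `Ω²` as a function of the area radius. -/
def omegaSqOfRadius (Λ m r : ℝ) : ℝ :=
  4 / r * (3 / Λ) * (rC Λ m ^ 2 / ((rC Λ m - rH Λ m) ^ 2 * (rC Λ m + rB Λ m) ^ 2)) *
    (r - rH Λ m) ^ (1 + expH Λ m) * (r + rB Λ m) ^ (1 + expB Λ m)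

/-- The lapse function `φ` of the foliation of the expanding region by the level sets of `r`. -/
def lapse (Λ m r : ℝ) : ℝ := 1 / √(Λ * r ^ 2 / 3 + 2 * m / r - 1)

/-! ### The spacetime

The double null chart `(u, v)` covering the cosmological region and the adjacent static regions.
Points are triples `(u, v, x)` with `x` on the unit sphere of `ℝ³`. A tangent vector at `(u, v, x)`
is a triple `(a, b, w)` with `w` orthogonal to `x`. A function on the spacetime is represented by a
function on the ambient space; only derivatives along the spacetime are ever used. -/

abbrev E3 := EuclideanSpace ℝ (Fin 3)

abbrev Pt := ℝ × ℝ × E3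

/-- The chart `{u v < 1} × S²`. -/
def spacetime : Set Pt := {p | p.1 * p.2.1 < 1 ∧ ‖p.2.2‖ = 1}

/-- The area radius: the solution `r > rH` of `uvOfRadius r = u v`. -/
def radius (Λ m : ℝ) (p : Pt) : ℝ :=
  Function.invFunOn (uvOfRadius Λ m) (Ioi (rH Λ m)) (p.1 * p.2.1)

def omegaSq (Λ m : ℝ) (p : Pt) : ℝ := omegaSqOfRadius Λ m (radius Λ m p)

/-- The metric `g = -Ω² du dv + r² γ`, with `γ` the round metric of the unit sphere. -/
def metric (Λ m : ℝ) (p X Y : Pt) : ℝ :=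
  -(omegaSq Λ m p / 2) * (X.1 * Y.2.1 + X.2.1 * Y.1) + radius Λ m p ^ 2 * inner ℝ X.2.2 Y.2.2

/-- The tangent vectors of the spacetime at `p`. -/
def Tangent (p X : Pt) : Prop := inner ℝ X.2.2 p.2.2 = 0

/-- Future directed timelike vectors; `u` and `v` increase towards the future. -/
def FutureTimelike (Λ m : ℝ) (p X : Pt) : Prop :=
  Tangent p X ∧ metric Λ m p X X < 0 ∧ 0 < X.1 ∧ 0 < X.2.1

/-- Future directed causal vectors, and the zero vector. -/
def FutureCausal (Λ m : ℝ) (p X : Pt) : Prop :=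
  Tangent p X ∧ metric Λ m p X X ≤ 0 ∧ 0 ≤ X.1 ∧ 0 ≤ X.2.1

/-- `q` is reached from `p` along a future directed causal curve. (Since the velocity may vanish,
continuously differentiable curves include, up to parametrization, the piecewise ones, and the
constant ones.) -/
def CausallyPrecedes (Λ m : ℝ) (p q : Pt) : Prop :=
  ∃ γ γ' : ℝ → Pt, γ 0 = p ∧ γ 1 = q ∧ ContinuousOn γ' (Icc 0 1) ∧
    ∀ s ∈ Icc (0 : ℝ) 1, HasDerivWithinAt γ (γ' s) (Icc 0 1) s ∧ γ s ∈ spacetime ∧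
      FutureCausal Λ m (γ s) (γ' s)

/-- The causal future `J⁺(A)`. -/
def causalFuture (Λ m : ℝ) (A : Set Pt) : Set Pt := {q | ∃ p ∈ A, CausallyPrecedes Λ m p q}

/-- The causal past `J⁻(A)`. -/
def causalPast (Λ m : ℝ) (A : Set Pt) : Set Pt := {p | ∃ q ∈ A, CausallyPrecedes Λ m p q}

/-- The level set `Σ_r` of the area radius in the expanding region `0 < u v < 1`, `u, v > 0`. -/
def levelSet (Λ m r : ℝ) : Set Pt := {p ∈ spacetime | 0 < p.1 ∧ 0 < p.2.1 ∧ radius Λ m p = r}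

/-- The cosmological horizon `C⁺ = {v = 0, u ≥ 0}`. -/
def horizon : Set Pt := {p ∈ spacetime | 0 ≤ p.1 ∧ p.2.1 = 0}

/-- The half `{u > v}` of the spacetime; in the expanding region this is `{t > 0}`, the end
containing `C⁺` without the bifurcation sphere in its closure. -/
def horizonSide : Set Pt := {p | p.2.1 < p.1}

/-- The Killing field `T = κ (u ∂_u - v ∂_v)`. -/
def killing (Λ m : ℝ) (p : Pt) : Pt := (kappa Λ m * p.1, -(kappa Λ m * p.2.1), 0)

/-- The isometry `φ_t` of the flow of `T`. It is linear in the ambient coordinates, so it is also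
its own differential. -/
def flow (Λ m t : ℝ) (p : Pt) : Pt :=
  (Real.exp (kappa Λ m * t) * p.1, Real.exp (-(kappa Λ m * t)) * p.2.1, p.2.2)

/-- The coordinate field `∂_r = φ² V` of the `(t, r)` coordinates in the expanding region, where
`V = - grad r = κ (u ∂_u + v ∂_v)`. -/
def radialField (Λ m : ℝ) (p : Pt) : Pt :=
  (lapse Λ m (radius Λ m p) ^ 2 * (kappa Λ m * p.1),
    lapse Λ m (radius Λ m p) ^ 2 * (kappa Λ m * p.2.1), 0)

/-! ### Derivatives, wave equation, energy momentum tensor -/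

/-- The generator `x ↦ e_i × x` of the rotations about the `i`-th axis. -/
def rotVec (i : Fin 3) (x : E3) : E3 :=
  WithLp.toLp 2 (crossProduct (Pi.single i 1 : Fin 3 → ℝ) (WithLp.ofLp x))

def du (f : Pt → ℝ) (p : Pt) : ℝ := fderiv ℝ f p (1, 0, 0)

def dv (f : Pt → ℝ) (p : Pt) : ℝ := fderiv ℝ f p (0, 1, 0)

/-- The derivative along the `i`-th rotation field. -/
def rot (i : Fin 3) (f : Pt → ℝ) (p : Pt) : ℝ := fderiv ℝ f p (0, 0, rotVec i p.2.2)

/-- The wave operator `|g|^(-1/2) ∂_μ (|g|^(1/2) g^{μν} ∂_ν ψ)`, where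
`|g|^(1/2) = (Ω²/2) r² |γ|^(1/2)` and `g^{uv} = -2/Ω²`. The Laplacian of the unit sphere is the
sum of the squares of the three rotation fields. -/
def box (Λ m : ℝ) (ψ : Pt → ℝ) (p : Pt) : ℝ :=
  2 / (omegaSq Λ m p * radius Λ m p ^ 2) *
      (du (fun q => -(radius Λ m q ^ 2 * dv ψ q)) p +
        dv (fun q => -(radius Λ m q ^ 2 * du ψ q)) p) +
    1 / radius Λ m p ^ 2 * ∑ i, rot i (rot i ψ) p

/-- `ψ` is a (classical) solution of the wave equation on the open set `W`. -/
def IsWaveSolution (Λ m : ℝ) (W : Set Pt) (ψ : Pt → ℝ) : Prop :=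
  ContDiffOn ℝ 2 ψ W ∧ ∀ p ∈ W ∩ spacetime, box Λ m ψ p = 0

/-- `|∇̸ ψ|²`, the squared norm of the angular derivatives on the sphere of radius `r`. -/
def angularSq (Λ m : ℝ) (ψ : Pt → ℝ) (p : Pt) : ℝ :=
  1 / radius Λ m p ^ 2 * ∑ i, rot i ψ p ^ 2

/-- `∂^α ψ ∂_α ψ`. -/
def gradSq (Λ m : ℝ) (ψ : Pt → ℝ) (p : Pt) : ℝ :=
  -(4 / omegaSq Λ m p) * (du ψ p * dv ψ p) + angularSq Λ m ψ p

/-- The energy momentum tensor `T(X, Y)` at `p`; thus `J^X[ψ] · Y = T(X, Y)`. -/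
def emTensor (Λ m : ℝ) (ψ : Pt → ℝ) (p X Y : Pt) : ℝ :=
  fderiv ℝ ψ p X * fderiv ℝ ψ p Y - 1 / 2 * metric Λ m p X Y * gradSq Λ m ψ p

/-! ### Integrals over hypersurfaces -/

abbrev Sph := Metric.sphere (0 : E3) 1

/-- The product of Lebesgue measure on `ℝ` and the surface measure of the unit sphere. -/
def cylMeasure : Measure (ℝ × Sph) := (volume : Measure ℝ).prod (volume : Measure E3).toSphere

/-- The point of `Σ_r` with coordinates `(t, x)`: `u v = uvOfRadius r` and `u / v = exp (2 κ t)`. -/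
def levelPt (Λ m r : ℝ) (y : ℝ × Sph) : Pt :=
  (√(uvOfRadius Λ m r) * Real.exp (kappa Λ m * y.1),
    √(uvOfRadius Λ m r) * Real.exp (-(kappa Λ m * y.1)), (y.2 : E3))

/-- `∫_{Σ_r ∩ A} {φ⁻² (∂_r ψ)² + φ² (∂_t ψ)² + |∇̸ ψ|²} φ dμ`. The induced metric is
`φ⁻² dt² + r² γ`, with volume form `dμ = φ⁻¹ r² dt dγ`. -/
def levelEnergy (Λ m : ℝ) (ψ : Pt → ℝ) (r : ℝ) (A : Set Pt) : ℝ≥0∞ :=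
  ∫⁻ y in {y | levelPt Λ m r y ∈ levelSet Λ m r ∩ A},
    ENNReal.ofReal
      ((1 / lapse Λ m r ^ 2 *
            fderiv ℝ ψ (levelPt Λ m r y) (radialField Λ m (levelPt Λ m r y)) ^ 2 +
          lapse Λ m r ^ 2 * fderiv ℝ ψ (levelPt Λ m r y) (killing Λ m (levelPt Λ m r y)) ^ 2 +
          angularSq Λ m ψ (levelPt Λ m r y)) *
        lapse Λ m r * ((lapse Λ m r)⁻¹ * r ^ 2)) ∂cylMeasure

/-- `∫_{C⁺ ∩ A} *J^N[ψ]`. The contraction of `(Ω²/2) r² du dv dγ` with the vector `J` restricts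
on `{v = 0}` to `(Ω²/2) r² J^v du dγ` up to orientation, and `J^v = -(2/Ω²) J_u`; with the
orientation that makes it nonnegative for future directed timelike `N`, it is `r² J_u du dγ`. -/
def horizonFlux (Λ m : ℝ) (ψ : Pt → ℝ) (N : Pt → Pt) (A : Set Pt) : ℝ≥0∞ :=
  ∫⁻ y in {y : ℝ × Sph | ((y.1, 0, (y.2 : E3)) : Pt) ∈ horizon ∩ A},
    ENNReal.ofReal
      (radius Λ m (y.1, 0, (y.2 : E3)) ^ 2 *
        emTensor Λ m ψ (y.1, 0, (y.2 : E3)) (N (y.1, 0, (y.2 : E3))) (1, 0, 0)) ∂cylMeasure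

/-- A smooth spacelike hypersurface `Σ` in the closure `{u ≥ 0, v ≥ 0, u v < 1}` of the expanding
region, crossing both cosmological horizons to the future of the bifurcation sphere
`{u = v = 0}`. As `∂_v` is null, hence transversal to `Σ`, it is written as a graph
`v = height (u, x)`, `0 ≤ u ≤ cross x`; it meets `{u = 0}` at `v = height (0, x) > 0` and
`{v = 0}` at `u = cross x > 0`. -/
structure Hypersurface (Λ m : ℝ) where
  height : ℝ × E3 → ℝ
  cross : E3 → ℝ
  smooth : ContDiff ℝ ∞ height
  cross_pos : ∀ x : E3, ‖x‖ = 1 → 0 < cross x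
  height_cross : ∀ x : E3, ‖x‖ = 1 → height (cross x, x) = 0
  height_pos : ∀ x : E3, ‖x‖ = 1 → ∀ u, 0 ≤ u → u < cross x → 0 < height (u, x)
  in_chart : ∀ x : E3, ‖x‖ = 1 → ∀ u, 0 ≤ u → u ≤ cross x → u * height (u, x) < 1
  spacelike : ∀ x : E3, ‖x‖ = 1 → ∀ u, 0 ≤ u → u ≤ cross x →
    ∀ (a : ℝ) (w : E3), inner ℝ w x = 0 → (a, w) ≠ (0, 0) →
      0 < metric Λ m (u, height (u, x), x) (a, fderiv ℝ height (u, x) (a, w), w)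
        (a, fderiv ℝ height (u, x) (a, w), w)

namespace Hypersurface

variable {Λ m : ℝ}

/-- The parametrization of the graph. -/
def pt (S : Hypersurface Λ m) (y : ℝ × Sph) : Pt := (y.1, S.height (y.1, (y.2 : E3)), (y.2 : E3))

/-- The points of the hypersurface. -/
def carrier (S : Hypersurface Λ m) : Set Pt :=
  {p | ‖p.2.2‖ = 1 ∧ 0 ≤ p.1 ∧ p.1 ≤ S.cross p.2.2 ∧ p.2.1 = S.height (p.1, p.2.2)}

/-- `∂_u` of the height function. -/
def heightU (S : Hypersurface Λ m) (y : ℝ × Sph) : ℝ :=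
  fderiv ℝ S.height (y.1, (y.2 : E3)) (1, 0)

/-- Derivatives of the height function along the rotation fields. -/
def heightRot (S : Hypersurface Λ m) (i : Fin 3) (y : ℝ × Sph) : ℝ :=
  fderiv ℝ S.height (y.1, (y.2 : E3)) (0, rotVec i y.2)

/-- Minus the gradient (with respect to `g`) of the function `v - height (u, x)`: a future
directed normal. -/
def conormal (S : Hypersurface Λ m) (y : ℝ × Sph) : Pt :=
  (2 / omegaSq Λ m (S.pt y), -(2 / omegaSq Λ m (S.pt y)) * S.heightU y,
    (1 / radius Λ m (S.pt y) ^ 2) • ∑ i, S.heightRot i y • rotVec i y.2)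

/-- The future directed unit normal `n`. -/
def normal (S : Hypersurface Λ m) (y : ℝ × Sph) : Pt :=
  (1 / √(-metric Λ m (S.pt y) (S.conormal y) (S.conormal y))) • S.conormal y

/-- The volume density of the first fundamental form with respect to `du dγ`: the square root of
the determinant of the induced metric, whose components in the parametrization are
`-Ω² ∂_u h`, `-(Ω²/2) ∂_A h` and `r² γ_{AB}`. -/
def volDensity (S : Hypersurface Λ m) (y : ℝ × Sph) : ℝ :=
  radius Λ m (S.pt y) ^ 2 *
    √(-(omegaSq Λ m (S.pt y) * S.heightU y) -
      omegaSq Λ m (S.pt y) ^ 2 / (4 * radius Λ m (S.pt y) ^ 2) * ∑ i, S.heightRot i y ^ 2)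

/-- `∫_{Σ ∩ A} J^N[ψ] · n dμ`. -/
def flux (S : Hypersurface Λ m) (ψ : Pt → ℝ) (N : Pt → Pt) (A : Set Pt) : ℝ≥0∞ :=
  ∫⁻ y in {y | S.pt y ∈ S.carrier ∩ A},
    ENNReal.ofReal (emTensor Λ m ψ (S.pt y) (N (S.pt y)) (S.normal y) * S.volDensity y) ∂cylMeasure

end Hypersurface

/-- The neighbourhood `{r₋ ≤ r ≤ r₊}` of `C⁺` without its bifurcation sphere; it is invariant under
the flow of `T`. -/
def nearHorizon (Λ m rminus rplus : ℝ) : Set Pt :=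
  {p ∈ spacetime | 0 < p.1 ∧ rminus ≤ radius Λ m p ∧ radius Λ m p ≤ rplus}

end SdS

end

noncomputable section

namespace SdS

/-! ### The horizon radii and the area radius as a function of `u v` -/

/-! The estimate is an energy inequality for the redshift multiplier `N = (1 - K u v)(u ∂_u + u⁻¹
∂_v)` (`redshiftField`), written in the coordinates `(u, s, x)` with `s = u v`. There the flow of
`T` only scales `u`, the horizon is `s = 0`, every `Σ_r` is a level `s = c`, and `r` and `Ω²` are
functions of `s` alone. As `N` commutes with the flow, bounds on functions of `s` over a compact
interval `[0, ε]` control the whole noncompact neighbourhood of the horizon.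

Once the wave equation has removed the second derivatives, the divergence of the current is a
quadratic form in `U = u ∂_u ψ`, `W = u⁻¹ ∂_v ψ` and the rotation derivatives. The powers of `u` in
the multiplier produce `-(1 - K s) r² W²`: this is the redshift. Differentiating `1 - K s` produces
`-K` times squares of `U` and of the rotation derivatives. For large `K` these absorb every other
term, so the bulk has a sign (`bulk_quadratic_nonpos`, `bulk_nonpos`).

The divergence theorem is applied in the part `u₀ ≤ u ≤ u₁`, `0 ≤ s ≤ c` of `J⁺(Σ)`. The flux
through `u = u₁` is nonnegative and is dropped. The side `u = u₀` lies below `Σ`, because `Σ` stays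
away from the bifurcation sphere (`exists_lt_height`). What remains are the fluxes through `Σ_r`,
`C⁺` and `Σ` (`energy_inequality`). The flux density on `Σ_r` dominates the energy density with a
factor depending on `r` only (`levelDensity_le`), and `u₁ → ∞` by monotone convergence
(`levelEnergy_le`).

Two facts support this. First, `J⁺(Σ)` is the set above the graph (`causalFuture_eq_region`), since
causal curves can cross a spacelike graph only upwards. Secondly, the lower boundary `s = thresh` of
the domain has a kink where `Σ` meets the horizon; `leibniz_moving_threshold` integrates above such
a threshold by means of smooth cutoffs. The angular part of the divergence theorem needs no charts
on the sphere: it follows by averaging over one-parameter groups of rotations. -/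

theorem exists_horizonRadii_eq {Λ m : ℝ} (hΛ : 0 < Λ) (hm : 0 < m) (hsub : 3 * m * √Λ < 1) :
    ∃ a b : ℝ, 0 < a ∧ a < b ∧ horizonRadii Λ m = {a, b} := by
  set q := √Λ with hq
  have hq0 : 0 < q := Real.sqrt_pos.2 hΛ
  have hqq : Λ = q ^ 2 := (Real.sq_sqrt hΛ.le).symm
  set p : ℝ → ℝ := fun r => r - 2 * m - Λ * r ^ 3 / 3 with hp
  have hpc : Continuous p := by fun_prop
  -- The cubic has its local maximum at `1 / √Λ`, where subextremality makes it positive. It is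
  -- negative at `0` and at `2 / √Λ`, so there is a root on each side.
  have hmid : 0 < p (1 / q) := by
    have : p (1 / q) = (2 / 3) / q * (1 - 3 * m * q) := by
      simp only [hp, hqq]; field_simp; ring
    rw [this]
    have : 0 < 1 - 3 * m * q := by linarith
    positivity
  have h0 : p 0 < 0 := by simp [hp]; linarith
  have h2 : p (2 / q) < 0 := by
    have : p (2 / q) = -(2 / 3) / q - 2 * m := by
      simp only [hp, hqq]; field_simp; ring
    rw [this]
    have : 0 < (2 / 3) / q := by positivity
    have h3 : -(2 / 3) / q = -((2 / 3) / q) := by ring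
    rw [h3]; linarith
  have hlt : (0 : ℝ) < 1 / q := by positivity
  obtain ⟨a, ha, hpa⟩ := intermediate_value_Ioo hlt.le hpc.continuousOn
    (show (0 : ℝ) ∈ Ioo (p 0) (p (1 / q)) from ⟨h0, hmid⟩)
  have hlt2 : 1 / q ≤ 2 / q := by gcongr; norm_num
  obtain ⟨b, hb, hpb⟩ := intermediate_value_Ioo' hlt2 hpc.continuousOn
    (show (0 : ℝ) ∈ Ioo (p (2 / q)) (p (1 / q)) from ⟨h2, hmid⟩)
  have ha0 : 0 < a := ha.1
  have hab : a < b := ha.2.trans hb.1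
  have hb0 : 0 < b := ha0.trans hab
  refine ⟨a, b, ha0, hab, ?_⟩
  -- Obtained by dividing the difference of the two root equations by `a - b`. It identifies the
  -- third root as `-(a + b)`, which is negative.
  have key : Λ * (a ^ 2 + a * b + b ^ 2) = 3 := by
    have h : (a - b) * (Λ * (a ^ 2 + a * b + b ^ 2) - 3) = 0 := by
      simp only [hp] at hpa hpb
      linear_combination 3 * hpb - 3 * hpa
    rcases mul_eq_zero.1 h with h | h <;> linarith
  ext r
  simp only [horizonRadii, mem_ofPred_eq, mem_insert_iff, mem_singleton_iff]
  constructor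
  · rintro ⟨hr, hpr⟩
    have h : Λ * ((r - a) * (r - b) * (r + a + b)) = 0 := by
      simp only [hp] at hpa
      linear_combination 3 * hpa - 3 * hpr + (a - r) * key
    have h3 : r + a + b ≠ 0 := by positivity
    simp only [mul_eq_zero, hΛ.ne', h3, or_false, false_or, sub_eq_zero] at h
    exact h
  · rintro (rfl | rfl)
    · exact ⟨ha0, hpa⟩
    · exact ⟨hb0, hpb⟩

theorem rH_pos_and_lt {Λ m : ℝ} (hΛ : 0 < Λ) (hm : 0 < m) (hsub : 3 * m * √Λ < 1) :
    0 < rH Λ m ∧ rH Λ m < rC Λ m := by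
  obtain ⟨a, b, ha, hab, h⟩ := exists_horizonRadii_eq hΛ hm hsub
  have h1 : rH Λ m = a := by rw [rH, h, csInf_pair, min_eq_left hab.le]
  have h2 : rC Λ m = b := by rw [rC, h, csSup_pair, max_eq_right hab.le]
  rw [h1, h2]; exact ⟨ha, hab⟩

/-- The parameters have the horizon structure of a subextremal Schwarzschild-de Sitter family. -/
structure Subextremal (Λ m : ℝ) : Prop where
  pos : 0 < Λ
  rH_pos : 0 < rH Λ m
  rH_lt : rH Λ m < rC Λ m

variable {Λ m : ℝ}

namespace Subextremal

theorem rC_pos (h : Subextremal Λ m) : 0 < rC Λ m := h.rH_pos.trans h.rH_lt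

theorem rB_pos (h : Subextremal Λ m) : 0 < rB Λ m := add_pos h.rH_pos h.rC_pos

theorem kappa_pos (h : Subextremal Λ m) : 0 < kappa Λ m := by
  have := h.pos; have := h.rC_pos; have := h.rB_pos; have := sub_pos.2 h.rH_lt
  unfold kappa; positivity

theorem expH_pos (h : Subextremal Λ m) : 0 < expH Λ m := by
  have := h.rH_pos; have := h.rC_pos; have := h.rB_pos
  unfold expH; positivity

theorem expB_pos (h : Subextremal Λ m) : 0 < expB Λ m := by
  have := h.rH_pos; have := h.rC_pos; have := h.rB_pos; have := sub_pos.2 h.rH_lt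
  unfold expB; positivity

/-- This normalisation makes the denominator of `uvOfRadius` grow like `r`, so that the limit at
infinity is `1`; it also permits the weighted mean inequality with these exponents as weights. -/
theorem expH_add_expB (h : Subextremal Λ m) : expH Λ m + expB Λ m = 1 := by
  have := h.rH_pos; have := h.rC_pos
  unfold expH expB rB
  field_simp
  ring

/-- The derivative of `uvOfRadius`. -/
def uvDeriv (Λ m r : ℝ) : ℝ :=
  (rC Λ m - rH Λ m) * (rC Λ m + rB Λ m) / rC Λ m * r /
    ((r - rH Λ m) ^ (1 + expH Λ m) * (r + rB Λ m) ^ (1 + expB Λ m))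

theorem uvDeriv_pos (h : Subextremal Λ m) {r : ℝ} (hr : rH Λ m < r) : 0 < uvDeriv Λ m r := by
  have := h.rH_pos; have := h.rC_pos; have := h.rB_pos; have := sub_pos.2 h.rH_lt
  have := sub_pos.2 hr
  have : 0 < r := h.rH_pos.trans hr
  unfold uvDeriv; positivity

/-- Up to sign, the exponents are the ratios to the residue at `rC` of the other residues of `r /
((r - rC)(r - rH)(r + rB))`. Hence the logarithmic derivative of `uvOfRadius` is a constant multiple
of this fraction. -/
theorem hasDerivAt_uvOfRadius (h : Subextremal Λ m) {r : ℝ} (hr : rH Λ m < r) :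
    HasDerivAt (uvOfRadius Λ m) (uvDeriv Λ m r) r := by
  have h1 := h.rH_pos; have h2 := h.rC_pos; have h3 := h.rB_pos; have h4 := sub_pos.2 h.rH_lt
  have h5 := sub_pos.2 hr
  have h6 : 0 < r := h.rH_pos.trans hr
  have h7 : 0 < r + rB Λ m := by positivity
  have d1 : HasDerivAt (fun r => (r - rH Λ m) ^ expH Λ m)
      (1 * expH Λ m * (r - rH Λ m) ^ (expH Λ m - 1)) r :=
    ((hasDerivAt_id r).sub_const _).rpow_const (Or.inl h5.ne')
  have d2 : HasDerivAt (fun r => (r + rB Λ m) ^ expB Λ m)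
      (1 * expB Λ m * (r + rB Λ m) ^ (expB Λ m - 1)) r :=
    ((hasDerivAt_id r).add_const _).rpow_const (Or.inl h7.ne')
  have d := ((hasDerivAt_id r).sub_const (rC Λ m)).div (d1.mul d2)
    (mul_pos (Real.rpow_pos_of_pos h5 _) (Real.rpow_pos_of_pos h7 _)).ne'
  refine d.congr_deriv ?_
  have e1 := (Real.rpow_pos_of_pos h5 (expH Λ m))
  have e2 := (Real.rpow_pos_of_pos h7 (expB Λ m))
  simp only [id, Pi.mul_apply, uvDeriv]
  rw [Real.rpow_sub_one h5.ne', Real.rpow_sub_one h7.ne', Real.rpow_one_add' h5.le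
    (by have := h.expH_pos; positivity), Real.rpow_one_add' h7.le
    (by have := h.expB_pos; positivity)]
  generalize (r - rH Λ m) ^ expH Λ m = X at *
  generalize (r + rB Λ m) ^ expB Λ m = Y at *
  rw [div_eq_div_iff (by positivity) (by positivity)]
  have hα : expH Λ m * (rC Λ m * (rH Λ m + rB Λ m)) = rH Λ m * (rC Λ m + rB Λ m) := by
    unfold expH; field_simp
  have hβ : expB Λ m * (rC Λ m * (rH Λ m + rB Λ m)) = rB Λ m * (rC Λ m - rH Λ m) := by
    unfold expB; field_simp; ring
  have hne : rC Λ m * (rH Λ m + rB Λ m) ≠ 0 := by positivity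
  have hα' := eq_div_of_mul_eq hne hα
  have hβ' := eq_div_of_mul_eq hne hβ
  rw [hα', hβ']
  unfold rB
  have : (r + (rH Λ m + rC Λ m)) ≠ 0 := by positivity
  have : (rH Λ m + (rH Λ m + rC Λ m)) ≠ 0 := by positivity
  have := h5.ne'
  field_simp
  ring

theorem continuousOn_uvOfRadius (h : Subextremal Λ m) :
    ContinuousOn (uvOfRadius Λ m) (Ioi (rH Λ m)) :=
  fun _ hr => (h.hasDerivAt_uvOfRadius hr).continuousAt.continuousWithinAt

theorem strictMonoOn_uvOfRadius (h : Subextremal Λ m) :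
    StrictMonoOn (uvOfRadius Λ m) (Ioi (rH Λ m)) := by
  refine strictMonoOn_of_deriv_pos (convex_Ioi _) h.continuousOn_uvOfRadius fun r hr => ?_
  rw [interior_Ioi] at hr
  rw [(h.hasDerivAt_uvOfRadius hr).deriv]
  exact h.uvDeriv_pos hr

theorem uvOfRadius_rC : uvOfRadius Λ m (rC Λ m) = 0 := by simp [uvOfRadius]

/-- The weighted arithmetic-geometric mean inequality bounds the denominator by `r + k`, and `(r -
rC) / (r + k)` tends to `1`. -/
theorem exists_lt_uvOfRadius (h : Subextremal Λ m) {s : ℝ} (hs : s < 1) :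
    ∃ r, rH Λ m < r ∧ s < uvOfRadius Λ m r := by
  set k := expB Λ m * rB Λ m - expH Λ m * rH Λ m with hk
  have hlim : Filter.Tendsto (fun r : ℝ => (r - rC Λ m) / (r + k)) Filter.atTop (nhds 1) := by
    have h1 : Filter.Tendsto (fun r : ℝ => r + k) Filter.atTop Filter.atTop :=
      Filter.tendsto_atTop_add_const_right _ _ Filter.tendsto_id
    have h2 : Filter.Tendsto (fun r : ℝ => 1 - (rC Λ m + k) * (r + k)⁻¹) Filter.atTop
        (nhds (1 - (rC Λ m + k) * 0)) :=
      tendsto_const_nhds.sub (tendsto_const_nhds.mul (tendsto_inv_atTop_zero.comp h1))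
    simp only [mul_zero, sub_zero] at h2
    refine h2.congr' ?_
    filter_upwards [h1.eventually_gt_atTop 0] with r hr
    field_simp
    ring
  obtain ⟨r, hr, hr2⟩ := ((hlim.eventually_const_lt hs).and
    (Filter.eventually_gt_atTop (rC Λ m))).exists
  have hrH := h.rH_lt.trans hr2
  have h5 := sub_pos.2 hrH
  have h6 := sub_pos.2 hr2
  have h7 : 0 < r + rB Λ m := add_pos (h.rC_pos.trans hr2) h.rB_pos
  refine ⟨r, hrH, hr.trans_le ?_⟩
  unfold uvOfRadius
  have hD : 0 < (r - rH Λ m) ^ expH Λ m * (r + rB Λ m) ^ expB Λ m := by positivity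
  gcongr
  refine (Real.geom_mean_le_arith_mean2_weighted h.expH_pos.le h.expB_pos.le h5.le h7.le
    h.expH_add_expB).trans (le_of_eq ?_)
  have := h.expH_add_expB
  linear_combination r * this

/-- As `r` decreases to `rH` the denominator tends to `0` from above, while the numerator tends to
`rH - rC < 0`. -/
theorem exists_uvOfRadius_lt (h : Subextremal Λ m) (s : ℝ) :
    ∃ r, rH Λ m < r ∧ uvOfRadius Λ m r < s := by
  have hα := h.expH_pos
  have hlim : Filter.Tendsto (uvOfRadius Λ m) (nhdsWithin (rH Λ m) (Ioi (rH Λ m)))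
      Filter.atBot := by
    have hn : Filter.Tendsto (fun r => r - rC Λ m) (nhdsWithin (rH Λ m) (Ioi (rH Λ m)))
        (nhds (rH Λ m - rC Λ m)) :=
      ((continuous_id.sub continuous_const).tendsto (rH Λ m)).mono_left nhdsWithin_le_nhds
    have hd : Filter.Tendsto (fun r => (r - rH Λ m) ^ expH Λ m * (r + rB Λ m) ^ expB Λ m)
        (nhdsWithin (rH Λ m) (Ioi (rH Λ m))) (nhdsWithin 0 (Ioi 0)) := by
      refine tendsto_nhdsWithin_iff.2 ⟨?_, ?_⟩
      · have hc : Continuous fun r => (r - rH Λ m) ^ expH Λ m * (r + rB Λ m) ^ expB Λ m :=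
          ((continuous_id.sub continuous_const).rpow_const fun _ => Or.inr hα.le).mul
            ((continuous_id.add continuous_const).rpow_const fun _ => Or.inr h.expB_pos.le)
        have := (hc.tendsto (rH Λ m)).mono_left
          (nhdsWithin_le_nhds (s := Ioi (rH Λ m)))
        simpa [Real.zero_rpow hα.ne'] using this
      · filter_upwards [self_mem_nhdsWithin] with r hr
        have h5 : 0 < r - rH Λ m := sub_pos.2 hr
        have h7 : 0 < r + rB Λ m := add_pos (h.rH_pos.trans hr) h.rB_pos
        exact mem_Ioi.2 (by positivity)
    exact hn.neg_mul_atTop (sub_neg.2 h.rH_lt) hd.inv_tendsto_nhdsGT_zero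
  obtain ⟨r, hr, hr2⟩ := ((hlim.eventually_lt_atBot s).and self_mem_nhdsWithin).exists
  exact ⟨r, hr2, hr⟩

theorem surjOn_uvOfRadius (h : Subextremal Λ m) :
    SurjOn (uvOfRadius Λ m) (Ioi (rH Λ m)) (Iio 1) := by
  intro s hs
  obtain ⟨r1, h1, h1'⟩ := h.exists_uvOfRadius_lt s
  obtain ⟨r2, h2, h2'⟩ := h.exists_lt_uvOfRadius hs
  exact (convex_Ioi (rH Λ m)).isPreconnected.intermediate_value h1 h2
    h.continuousOn_uvOfRadius ⟨h1'.le, h2'.le⟩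

end Subextremal

/-- The area radius as a function of `s = u v`. -/
def rad (Λ m s : ℝ) : ℝ := Function.invFunOn (uvOfRadius Λ m) (Ioi (rH Λ m)) s

/-- The conformal factor as a function of `s = u v`. -/
def omg (Λ m s : ℝ) : ℝ := omegaSqOfRadius Λ m (rad Λ m s)

theorem radius_eq_rad (p : Pt) : radius Λ m p = rad Λ m (p.1 * p.2.1) := rfl

theorem omegaSq_eq_omg (p : Pt) : omegaSq Λ m p = omg Λ m (p.1 * p.2.1) := rfl

namespace Subextremal

theorem rH_lt_rad (h : Subextremal Λ m) {s : ℝ} (hs : s < 1) : rH Λ m < rad Λ m s :=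
  Function.invFunOn_mem (h.surjOn_uvOfRadius hs)

theorem rad_pos (h : Subextremal Λ m) {s : ℝ} (hs : s < 1) : 0 < rad Λ m s :=
  h.rH_pos.trans (h.rH_lt_rad hs)

theorem uvOfRadius_rad (h : Subextremal Λ m) {s : ℝ} (hs : s < 1) :
    uvOfRadius Λ m (rad Λ m s) = s :=
  Function.invFunOn_eq (h.surjOn_uvOfRadius hs)

theorem rad_uvOfRadius (h : Subextremal Λ m) {r : ℝ} (hr : rH Λ m < r) :
    rad Λ m (uvOfRadius Λ m r) = r :=
  h.strictMonoOn_uvOfRadius.injOn.leftInvOn_invFunOn hr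

theorem rad_strictMonoOn (h : Subextremal Λ m) : StrictMonoOn (rad Λ m) (Iio 1) := by
  intro s hs t ht hst
  refine (h.strictMonoOn_uvOfRadius.lt_iff_lt (h.rH_lt_rad hs) (h.rH_lt_rad ht)).1 ?_
  rwa [h.uvOfRadius_rad hs, h.uvOfRadius_rad ht]

theorem continuousAt_rad (h : Subextremal Λ m) {s : ℝ} (hs : s < 1) :
    ContinuousAt (rad Λ m) s := by
  have hr := h.rH_lt_rad hs
  refine h.rad_strictMonoOn.continuousAt_of_exists_between (Iio_mem_nhds hs) ?_ ?_
  · intro b hb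
    have h1 : rH Λ m < max b ((rH Λ m + rad Λ m s) / 2) := lt_max_of_lt_right (by linarith)
    have h2 : max b ((rH Λ m + rad Λ m s) / 2) < rad Λ m s := max_lt hb (by linarith)
    have h3 := h.strictMonoOn_uvOfRadius h1 hr h2
    rw [h.uvOfRadius_rad hs] at h3
    exact ⟨_, h3.trans hs, by rw [h.rad_uvOfRadius h1]; exact ⟨le_max_left _ _, h2⟩⟩
  · intro b hb
    have hc := (h.hasDerivAt_uvOfRadius hr).continuousAt
    have he : ∀ᶠ r in nhds (rad Λ m s), uvOfRadius Λ m r < 1 :=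
      hc.eventually_lt continuousAt_const (by rwa [h.uvOfRadius_rad hs])
    obtain ⟨r, ⟨h1, h2⟩, h3⟩ := (((he.filter_mono nhdsWithin_le_nhds).and
      (Ioo_mem_nhdsGT hb : Ioo (rad Λ m s) b ∈ nhdsWithin _ (Ioi (rad Λ m s)))).and
      self_mem_nhdsWithin).exists
    exact ⟨_, h1, by rw [h.rad_uvOfRadius (hr.trans h3)]; exact ⟨h2.1, h2.2.le⟩⟩

theorem hasDerivAt_rad (h : Subextremal Λ m) {s : ℝ} (hs : s < 1) :
    HasDerivAt (rad Λ m) (uvDeriv Λ m (rad Λ m s))⁻¹ s := by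
  refine (h.hasDerivAt_uvOfRadius (h.rH_lt_rad hs)).of_local_left_inverse
    (h.continuousAt_rad hs) (h.uvDeriv_pos (h.rH_lt_rad hs)).ne' ?_
  filter_upwards [Iio_mem_nhds hs] with t ht using h.uvOfRadius_rad ht

theorem omg_pos (h : Subextremal Λ m) {s : ℝ} (hs : s < 1) : 0 < omg Λ m s := by
  have := h.rH_lt_rad hs
  have := h.rad_pos hs
  have h1 := h.rH_pos; have h2 := h.rC_pos; have h3 := h.rB_pos; have h4 := sub_pos.2 h.rH_lt
  have h5 := sub_pos.2 (h.rH_lt_rad hs)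
  have := h.pos
  unfold omg omegaSqOfRadius
  positivity

/-- The derivative of the area radius with respect to `s = u v`. -/
def radDeriv (Λ m s : ℝ) : ℝ := (uvDeriv Λ m (rad Λ m s))⁻¹

theorem exists_hasDerivAt_omegaSqOfRadius (h : Subextremal Λ m) :
    ∃ w : ℝ → ℝ, ContinuousOn w (Ioi (rH Λ m)) ∧
      ∀ r, rH Λ m < r → HasDerivAt (omegaSqOfRadius Λ m) (w r) r := by
  have hcd : ContDiffOn ℝ 2 (omegaSqOfRadius Λ m) (Ioi (rH Λ m)) := by
    intro r hr
    have h5 : r - rH Λ m ≠ 0 := (sub_pos.2 hr).ne'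
    have h6 : r ≠ 0 := (h.rH_pos.trans hr).ne'
    have h7 : r + rB Λ m ≠ 0 := (add_pos (h.rH_pos.trans hr) h.rB_pos).ne'
    unfold omegaSqOfRadius
    refine ContDiffAt.contDiffWithinAt ?_
    exact ((((contDiffAt_const.div contDiffAt_id h6).mul contDiffAt_const).mul
      contDiffAt_const).mul ((contDiffAt_id.sub contDiffAt_const).rpow_const_of_ne h5)).mul
      ((contDiffAt_id.add contDiffAt_const).rpow_const_of_ne h7)
  refine ⟨deriv (omegaSqOfRadius Λ m), hcd.continuousOn_deriv_of_isOpen isOpen_Ioi (by norm_num),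
    fun r hr => ?_⟩
  exact ((hcd.differentiableOn (by norm_num)).differentiableAt (Ioi_mem_nhds hr)).hasDerivAt

theorem continuousOn_uvDeriv (h : Subextremal Λ m) :
    ContinuousOn (uvDeriv Λ m) (Ioi (rH Λ m)) := by
  intro r hr
  have h5 : r - rH Λ m ≠ 0 := (sub_pos.2 hr).ne'
  have h7 : r + rB Λ m ≠ 0 := (add_pos (h.rH_pos.trans hr) h.rB_pos).ne'
  have h5' : 0 < r - rH Λ m := (sub_pos.2 hr)
  have h7' : 0 < r + rB Λ m := (add_pos (h.rH_pos.trans hr) h.rB_pos)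
  refine ContinuousAt.continuousWithinAt ?_
  unfold uvDeriv
  refine (continuousAt_const.mul continuousAt_id).div
    (((continuousAt_id.sub continuousAt_const).rpow_const (Or.inl h5)).mul
      ((continuousAt_id.add continuousAt_const).rpow_const (Or.inl h7))) ?_
  positivity

theorem continuousOn_rad (h : Subextremal Λ m) : ContinuousOn (rad Λ m) (Iio 1) :=
  fun _ hs => (h.continuousAt_rad hs).continuousWithinAt

theorem continuousOn_radDeriv (h : Subextremal Λ m) :
    ContinuousOn (radDeriv Λ m) (Iio 1) :=
  (h.continuousOn_uvDeriv.comp h.continuousOn_rad fun _ hs => h.rH_lt_rad hs).inv₀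
    fun _ hs => (h.uvDeriv_pos (h.rH_lt_rad hs)).ne'

theorem exists_hasDerivAt_omg (h : Subextremal Λ m) :
    ∃ w : ℝ → ℝ, ContinuousOn w (Iio 1) ∧ ∀ s < 1, HasDerivAt (omg Λ m) (w s) s := by
  obtain ⟨w, hw, hd⟩ := h.exists_hasDerivAt_omegaSqOfRadius
  refine ⟨fun s => w (rad Λ m s) * radDeriv Λ m s,
    (hw.comp h.continuousOn_rad fun _ hs => h.rH_lt_rad hs).mul h.continuousOn_radDeriv,
    fun s hs => ?_⟩
  exact (hd _ (h.rH_lt_rad hs)).comp s (h.hasDerivAt_rad hs)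

end Subextremal

/-! ### Rotations of the unit sphere -/

theorem rotVec_apply (i j : Fin 3) (x : E3) :
    rotVec i x j = crossProduct (Pi.single i 1 : Fin 3 → ℝ) (WithLp.ofLp x) j := rfl

theorem inner_eq_sum (x y : E3) : inner ℝ x y = x 0 * y 0 + x 1 * y 1 + x 2 * y 2 := by
  rw [PiLp.inner_apply, Fin.sum_univ_three]
  simp [mul_comm]

theorem norm_sq_eq_sum (x : E3) : ‖x‖ ^ 2 = x 0 ^ 2 + x 1 ^ 2 + x 2 ^ 2 := by
  rw [EuclideanSpace.real_norm_sq_eq, Fin.sum_univ_three]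

/-- `rotVec i` as a linear map. -/
def rotLin (i : Fin 3) : E3 →L[ℝ] E3 :=
  LinearMap.toContinuousLinearMap
    { toFun := rotVec i
      map_add' := fun x y => by simp [rotVec]
      map_smul' := fun c x => by simp [rotVec] }

theorem continuous_rotVec (i : Fin 3) : Continuous (rotVec i) := (rotLin i).continuous

theorem inner_rotVec_self (i : Fin 3) (x : E3) : inner ℝ (rotVec i x) x = 0 := by
  rw [inner_eq_sum]
  fin_cases i <;> simp [rotVec_apply, cross_apply] <;> ring

/-- The rotation by the angle `t` about the `i`-th axis, in Rodrigues' form. -/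
def rotMap (i : Fin 3) (t : ℝ) (x : E3) : E3 :=
  x + Real.sin t • rotVec i x + (1 - Real.cos t) • rotVec i (rotVec i x)

theorem norm_rotMap (i : Fin 3) (t : ℝ) (x : E3) : ‖rotMap i t x‖ = ‖x‖ := by
  rw [← sq_eq_sq₀ (norm_nonneg _) (norm_nonneg _), norm_sq_eq_sum, norm_sq_eq_sum]
  have h := Real.sin_sq_add_cos_sq t
  fin_cases i <;> simp [rotMap, rotVec_apply, cross_apply]
  · linear_combination (x 1 ^ 2 + x 2 ^ 2) * h
  · linear_combination (x 0 ^ 2 + x 2 ^ 2) * h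
  · linear_combination (x 0 ^ 2 + x 1 ^ 2) * h

/-- The rotation as a linear isometric isomorphism. -/
def rotIso (i : Fin 3) (t : ℝ) : E3 ≃ₗᵢ[ℝ] E3 :=
  LinearIsometry.toLinearIsometryEquiv
    { toLinearMap := (ContinuousLinearMap.id ℝ E3 + Real.sin t • rotLin i +
        (1 - Real.cos t) • (rotLin i).comp (rotLin i) : E3 →L[ℝ] E3)
      norm_map' := fun x => norm_rotMap i t x } rfl

theorem hasDerivAt_rotMap (i : Fin 3) (t : ℝ) (x : E3) :
    HasDerivAt (fun t => rotMap i t x) (rotVec i (rotMap i t x)) t := by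
  have h : HasDerivAt (fun t => rotMap i t x)
      (0 + Real.cos t • rotVec i x + (0 - -Real.sin t) • rotVec i (rotVec i x)) t :=
    ((hasDerivAt_const t x).add ((Real.hasDerivAt_sin t).smul_const _)).add
      (((hasDerivAt_const t (1 : ℝ)).sub (Real.hasDerivAt_cos t)).smul_const _)
  refine h.congr_deriv ?_
  ext j
  fin_cases i <;> fin_cases j <;> simp [rotMap, rotVec_apply, cross_apply] <;> ring

theorem continuous_rotMap (i : Fin 3) : Continuous fun p : ℝ × E3 => rotMap i p.1 p.2 := by
  have h1 := continuous_rotVec i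
  unfold rotMap
  fun_prop

/-- The action of a linear isometry on the unit sphere. -/
def sphIso (R : E3 ≃ₗᵢ[ℝ] E3) (x : Sph) : Sph :=
  ⟨R x, by simp⟩

/-- The rotation of the unit sphere by the angle `t` about the `i`-th axis. -/
def sphRot (i : Fin 3) (t : ℝ) (x : Sph) : Sph := sphIso (rotIso i t) x

theorem sphRot_zero (i : Fin 3) (x : Sph) : sphRot i 0 x = x := by
  ext1
  change rotMap i 0 x = x
  simp [rotMap]

theorem continuous_sphRot (i : Fin 3) : Continuous fun p : ℝ × Sph => sphRot i p.1 p.2 :=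
  Continuous.subtype_mk ((continuous_rotMap i).comp
    (continuous_fst.prodMk (continuous_subtype_val.comp continuous_snd))) _

/-- The surface measure of the unit sphere. -/
abbrev sphMeasure : Measure Sph := (volume : Measure E3).toSphere

open Pointwise in
-- The surface measure of a set is a multiple of the volume of the cone over it; a linear isometry
-- maps cones to cones and preserves volume.
theorem measurePreserving_sphIso (R : E3 ≃ₗᵢ[ℝ] E3) :
    MeasurePreserving (sphIso R) sphMeasure sphMeasure := by
  have hc : Continuous (sphIso R) :=
    Continuous.subtype_mk (R.continuous.comp continuous_subtype_val) _
  refine ⟨hc.measurable, ?_⟩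
  ext s hs
  rw [Measure.map_apply hc.measurable hs, Measure.toSphere_apply' _ hs,
    Measure.toSphere_apply' _ (hc.measurable hs)]
  have : (Ioo (0 : ℝ) 1 • ((fun x : Sph => (x : E3)) '' (sphIso R ⁻¹' s))) =
      R ⁻¹' (Ioo (0 : ℝ) 1 • ((fun x : Sph => (x : E3)) '' s)) := by
    ext y
    simp only [mem_smul, mem_image, mem_preimage]
    constructor
    · rintro ⟨c, hc, _, ⟨x, hx, rfl⟩, rfl⟩
      exact ⟨c, hc, _, ⟨_, hx, rfl⟩, by simp [sphIso]⟩
    · rintro ⟨c, hc, _, ⟨x, hx, rfl⟩, he⟩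
      refine ⟨c, hc, _, ⟨⟨R.symm x, by simp⟩, ?_, rfl⟩, ?_⟩
      · convert hx using 1; ext1; simp [sphIso]
      · apply R.injective; simpa using he
  rw [this, R.measurePreserving.measure_preimage_emb R.toHomeomorph.measurableEmbedding]

theorem integral_sphRot (i : Fin 3) (t : ℝ) (f : Sph → ℝ) :
    ∫ x, f (sphRot i t x) ∂sphMeasure = ∫ x, f x ∂sphMeasure := by
  have hc : Continuous (sphIso (rotIso i t).symm) :=
    Continuous.subtype_mk ((rotIso i t).symm.continuous.comp continuous_subtype_val) _
  have hc' : Continuous (sphRot i t) :=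
    Continuous.subtype_mk ((rotIso i t).continuous.comp continuous_subtype_val) _
  let e : Sph ≃ₜ Sph :=
    { toFun := sphRot i t
      invFun := sphIso (rotIso i t).symm
      left_inv := fun x => by ext1; simp [sphRot, sphIso]
      right_inv := fun x => by ext1; simp [sphRot, sphIso]
      continuous_toFun := hc'
      continuous_invFun := hc }
  exact (measurePreserving_sphIso (rotIso i t)).integral_comp e.measurableEmbedding f

/-! ### Linear functionals and the rotation fields -/

/-- The three rotation fields, though linearly dependent, form a Parseval frame of every tangent
plane of the unit sphere. This is why sums over the three fields compute norms of angular
derivatives. -/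
theorem eq_sum_rotVec {x w : E3} (hx : ‖x‖ = 1) (hw : inner ℝ w x = 0) :
    w = ∑ i, (inner ℝ (rotVec i x) w : ℝ) • rotVec i x := by
  have h1 : x 0 ^ 2 + x 1 ^ 2 + x 2 ^ 2 = 1 := by rw [← norm_sq_eq_sum, hx]; norm_num
  rw [inner_eq_sum] at hw
  ext j
  fin_cases j <;> simp [Fin.sum_univ_three, inner_eq_sum, rotVec_apply, cross_apply]
  · linear_combination x 0 * hw - w 0 * h1
  · linear_combination x 1 * hw - w 1 * h1
  · linear_combination x 2 * hw - w 2 * h1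

theorem sum_inner_rotVec_sq {x w : E3} (hx : ‖x‖ = 1) (hw : inner ℝ w x = 0) :
    ∑ i, (inner ℝ (rotVec i x) w : ℝ) ^ 2 = ‖w‖ ^ 2 := by
  have h1 : x 0 ^ 2 + x 1 ^ 2 + x 2 ^ 2 = 1 := by rw [← norm_sq_eq_sum, hx]; norm_num
  rw [inner_eq_sum] at hw
  rw [norm_sq_eq_sum]
  simp only [Fin.sum_univ_three, inner_eq_sum]
  simp [rotVec_apply, cross_apply]
  linear_combination (w 0 ^ 2 + w 1 ^ 2 + w 2 ^ 2) * h1 -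
    (w 0 * x 0 + w 1 * x 1 + w 2 * x 2) * hw

theorem sq_le_norm_sq_mul_sum_rotVec {x w : E3} (L : E3 →ₗ[ℝ] ℝ) (hx : ‖x‖ = 1)
    (hw : inner ℝ w x = 0) : L w ^ 2 ≤ ‖w‖ ^ 2 * ∑ i, L (rotVec i x) ^ 2 := by
  have h : L w = ∑ i, (inner ℝ (rotVec i x) w : ℝ) * L (rotVec i x) := by
    conv_lhs => rw [eq_sum_rotVec hx hw]
    simp
  rw [h, ← sum_inner_rotVec_sq hx hw]
  exact Finset.sum_mul_sq_le_sq_mul_sq _ _ _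

/-- This is `x × x = 0`, the linear dependence among the rotation fields. -/
theorem sum_mul_rotVec_self (x : E3) : ∑ i, x i • rotVec i x = 0 := by
  ext j
  fin_cases j <;> simp [Fin.sum_univ_three, rotVec_apply, cross_apply] <;> ring

/-- The vector on the left is the gradient of `L` along the sphere. It occurs both as the angular
part of the conormal of `Σ` and in the vector on which spacelikeness is tested. -/
theorem norm_sq_sum_smul_rotVec {x : E3} (L : E3 →ₗ[ℝ] ℝ) (hx : ‖x‖ = 1) :
    ‖∑ i, L (rotVec i x) • rotVec i x‖ ^ 2 = ∑ i, L (rotVec i x) ^ 2 := by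
  have h1 : x 0 ^ 2 + x 1 ^ 2 + x 2 ^ 2 = 1 := by rw [← norm_sq_eq_sum, hx]; norm_num
  have h2 := congrArg L (sum_mul_rotVec_self x)
  simp only [Fin.sum_univ_three, map_add, map_smul, map_zero, smul_eq_mul] at h2
  simp only [Fin.sum_univ_three]
  generalize L (rotVec 0 x) = a at *
  generalize L (rotVec 1 x) = b at *
  generalize L (rotVec 2 x) = c at *
  rw [norm_sq_eq_sum]
  simp [rotVec_apply, cross_apply]
  linear_combination (a ^ 2 + b ^ 2 + c ^ 2) * h1 - (x 0 * a + x 1 * b + x 2 * c) * h2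

theorem inner_sum_smul_rotVec (x : E3) (c : Fin 3 → ℝ) :
    inner ℝ (∑ i, c i • rotVec i x) x = 0 := by
  simp [sum_inner, inner_smul_left, inner_rotVec_self]

/-! ### The Leibniz rule for a moving lower limit with kinks -/

open Filter Topology Real in
theorem deriv_smoothTransition_eq_zero {y : ℝ} (hy : 1 ≤ y) : deriv smoothTransition y = 0 := by
  apply IsLocalMax.deriv_eq_zero
  filter_upwards with z
  rw [smoothTransition.one_of_one_le hy]
  exact smoothTransition.le_one z

open Real in
theorem hasDerivAt_smoothTransition (y : ℝ) :
    HasDerivAt smoothTransition (deriv smoothTransition y) y :=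
  ((smoothTransition.contDiff (n := 1)).differentiable (by norm_num) y).hasDerivAt

open Real in
theorem continuous_deriv_smoothTransition : Continuous (deriv smoothTransition) :=
  (smoothTransition.contDiff (n := 1)).continuous_deriv (by norm_num)

/-- The cutoff with parameter `n`: it is `1` for `H ≤ s` and vanishes for `s ≤ H - 1 / (n + 1)`. -/
def cutoff (n : ℕ) (w : ℝ) : ℝ := Real.smoothTransition (1 + (n + 1) * w)

def cutoffDeriv (n : ℕ) (w : ℝ) : ℝ := (n + 1) * deriv Real.smoothTransition (1 + (n + 1) * w)

theorem continuous_cutoff (n : ℕ) : Continuous (cutoff n) :=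
  Real.smoothTransition.continuous.comp (by fun_prop)

theorem continuous_cutoffDeriv (n : ℕ) : Continuous (cutoffDeriv n) :=
  continuous_const.mul (continuous_deriv_smoothTransition.comp (by fun_prop))

theorem hasDerivAt_cutoff (n : ℕ) (w : ℝ) : HasDerivAt (cutoff n) (cutoffDeriv n w) w := by
  have h : HasDerivAt (fun w : ℝ => 1 + ((n : ℝ) + 1) * w) (((n : ℝ) + 1) * 1) w :=
    ((hasDerivAt_id w).const_mul _).const_add 1
  exact ((hasDerivAt_smoothTransition _).comp w h).congr_deriv (by rw [cutoffDeriv]; ring)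

theorem cutoff_of_nonneg (n : ℕ) {w : ℝ} (hw : 0 ≤ w) : cutoff n w = 1 :=
  Real.smoothTransition.one_of_one_le (by
    have : 0 ≤ ((n : ℝ) + 1) * w := by positivity
    linarith)

theorem cutoffDeriv_of_nonneg (n : ℕ) {w : ℝ} (hw : 0 ≤ w) : cutoffDeriv n w = 0 := by
  rw [cutoffDeriv, deriv_smoothTransition_eq_zero, mul_zero]
  have : 0 ≤ ((n : ℝ) + 1) * w := by positivity
  linarith

theorem abs_cutoff_le (n : ℕ) (w : ℝ) : |cutoff n w| ≤ 1 := by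
  rw [cutoff, abs_of_nonneg (Real.smoothTransition.nonneg _)]
  exact Real.smoothTransition.le_one _

open Filter Topology in
theorem tendsto_cutoff (w : ℝ) :
    Tendsto (fun n => cutoff n w) atTop (𝓝 (if 0 ≤ w then 1 else 0)) := by
  split_ifs with h
  · simp only [cutoff_of_nonneg _ h]; exact tendsto_const_nhds
  · push Not at h
    refine tendsto_const_nhds.congr' ?_
    have : Tendsto (fun n : ℕ => ((n : ℝ) + 1) * w) atTop atBot :=
      (tendsto_atTop_add_const_right _ _ tendsto_natCast_atTop_atTop).atTop_mul_const_of_neg h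
    filter_upwards [this.eventually_le_atBot (-1)] with n hn
    exact (Real.smoothTransition.zero_of_nonpos (by linarith)).symm

/-- Along a curve, the cutoff of `s - H` is differentiable wherever `s > 0` if the nonnegative
continuous function `H` is differentiable where it is positive. -/
theorem hasDerivAt_cutoff_sub {H : ℝ → ℝ} {d t s : ℝ} (n : ℕ) (hs : 0 < s)
    (hc : ContinuousAt H t) (hd : 0 < H t → HasDerivAt H d t) :
    HasDerivAt (fun t => cutoff n (s - H t)) (cutoffDeriv n (s - H t) * (-d)) t := by
  -- Either the cutoff is locally the constant `1`, so that a kink of `H` is not seen, or `H t ≥ s >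
  -- 0` and `H` is differentiable there.
  by_cases h : H t < s
  · have h0 : cutoffDeriv n (s - H t) = 0 := cutoffDeriv_of_nonneg n (by linarith)
    rw [h0, zero_mul]
    refine (hasDerivAt_const t (1 : ℝ)).congr_of_eventuallyEq ?_
    filter_upwards [hc.eventually_lt continuousAt_const h] with t' ht'
    exact cutoff_of_nonneg n (by linarith)
  · exact (hasDerivAt_cutoff n _).comp t ((hd (by linarith)).const_sub s)

theorem measurable_ite_le {X : Type*} [MeasurableSpace X] {f g k : X → ℝ} (hf : Measurable f)
    (hg : Measurable g) (hk : Measurable k) : Measurable fun x => if f x ≤ g x then k x else 0 :=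
  Measurable.ite (measurableSet_le hf hg) hk measurable_const

/-- The fundamental theorem of calculus above a threshold. -/
theorem integral_ite_le_eq {G G' : ℝ → ℝ} {c h : ℝ} (hc : 0 ≤ c) (h0 : 0 ≤ h)
    (hG : Continuous G) (hG' : Continuous G') (hd : ∀ s ∈ Ioo 0 c, HasDerivAt G (G' s) s) :
    ∫ s in (0 : ℝ)..c, (if h ≤ s then G' s else 0) = if h ≤ c then G c - G h else 0 := by
  split_ifs with hle
  · have h1 : IntervalIntegrable (fun s => if h ≤ s then G' s else 0) volume 0 h := by
      refine IntervalIntegrable.congr_ae (f := fun _ => (0 : ℝ)) (by simp) ?_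
      rw [uIoc_of_le h0, ← restrict_Ioo_eq_restrict_Ioc]
      filter_upwards [ae_restrict_mem measurableSet_Ioo] with s hs
      rw [if_neg (not_le.2 hs.2)]
    have h2 : IntervalIntegrable (fun s => if h ≤ s then G' s else 0) volume h c := by
      refine IntervalIntegrable.congr_ae (hG'.intervalIntegrable h c) ?_
      rw [uIoc_of_le hle]
      filter_upwards [ae_restrict_mem measurableSet_Ioc] with s hs
      rw [if_pos hs.1.le]
    rw [← intervalIntegral.integral_add_adjacent_intervals h1 h2]
    have e1 : ∫ s in (0 : ℝ)..h, (if h ≤ s then G' s else 0) = 0 := by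
      rw [intervalIntegral.integral_of_le h0, integral_Ioc_eq_integral_Ioo]
      refine setIntegral_eq_zero_of_forall_eq_zero fun s hs => ?_
      rw [if_neg (not_le.2 hs.2)]
    have e2 : ∫ s in h..c, (if h ≤ s then G' s else 0) = ∫ s in h..c, G' s := by
      refine intervalIntegral.integral_congr fun s hs => ?_
      rw [uIcc_of_le hle] at hs
      simp only [if_pos hs.1]
    rw [e1, e2, zero_add]
    exact intervalIntegral.integral_eq_sub_of_hasDerivAt_of_le hle hG.continuousOn
      (fun s hs => hd s ⟨h0.trans_lt hs.1, hs.2⟩) (hG'.intervalIntegrable _ _)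
  · rw [intervalIntegral.integral_of_le hc]
    refine setIntegral_eq_zero_of_forall_eq_zero fun s hs => ?_
    rw [if_neg (not_le.2 (hs.2.trans_lt (not_le.1 hle)))]

open Filter Topology in
theorem tendsto_integral_cutoff {G : ℝ → ℝ} (hG : Continuous G) (h a b : ℝ) :
    Tendsto (fun n => ∫ s in a..b, cutoff n (s - h) * G s) atTop
      (𝓝 (∫ s in a..b, if h ≤ s then G s else 0)) := by
  refine intervalIntegral.tendsto_integral_filter_of_dominated_convergence (fun s => |G s|)
    (.of_forall fun n => ?_) (.of_forall fun n => .of_forall fun s _ => ?_)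
    (hG.abs.intervalIntegrable _ _) (.of_forall fun s _ => ?_)
  · exact (((continuous_cutoff n).comp (continuous_id.sub continuous_const)).mul
      hG).aestronglyMeasurable
  · rw [norm_mul]
    exact mul_le_of_le_one_left (abs_nonneg _) (abs_cutoff_le n _)
  · have := (tendsto_cutoff (s - h)).mul_const (G s)
    simpa only [ite_mul, one_mul, zero_mul, sub_nonneg] using this

open intervalIntegral in
theorem abs_integral_cutoff_le {G : ℝ → ℝ} (hG : Continuous G) (n : ℕ) (h : ℝ) {c : ℝ}
    (hc : 0 ≤ c) : |∫ s in (0 : ℝ)..c, cutoff n (s - h) * G s| ≤ ∫ s in (0 : ℝ)..c, |G s| := by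
  refine (abs_integral_le_integral_abs hc).trans (integral_mono_on hc ?_
    (hG.abs.intervalIntegrable _ _) fun s _ => ?_)
  · exact (((continuous_cutoff n).comp (continuous_id.sub continuous_const)).mul
      hG).abs.intervalIntegrable _ _
  · rw [abs_mul]
    exact mul_le_of_le_one_left (abs_nonneg _) (abs_cutoff_le n _)

section Leibniz

variable {F Ft Fs : ℝ → ℝ → ℝ} {H d : ℝ → ℝ} {t₀ t₁ c : ℝ}

/-- The derivative of the cutoff concentrates at `s = h` and is not bounded in `n`. Integration by
parts leaves an expression that is bounded uniformly in `n` and has an evident limit, as dominated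
convergence requires. -/
theorem integral_cutoffDeriv {G G' : ℝ → ℝ} (n : ℕ) (h : ℝ) (hc : 0 ≤ c) (hG : Continuous G)
    (hG' : Continuous G') (hd : ∀ s ∈ Ioo 0 c, HasDerivAt G (G' s) s) :
    ∫ s in (0 : ℝ)..c, cutoffDeriv n (s - h) * G s =
      cutoff n (c - h) * G c - cutoff n (0 - h) * G 0 -
        ∫ s in (0 : ℝ)..c, cutoff n (s - h) * G' s := by
  have c1 : Continuous fun s : ℝ => cutoff n (s - h) :=
    (continuous_cutoff n).comp (continuous_id.sub continuous_const)
  have c2 : Continuous fun s : ℝ => cutoffDeriv n (s - h) :=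
    (continuous_cutoffDeriv n).comp (continuous_id.sub continuous_const)
  have e1 : Continuous fun s : ℝ => cutoffDeriv n (s - h) * G s := c2.mul hG
  have e2 : Continuous fun s : ℝ => cutoff n (s - h) * G' s := c1.mul hG'
  rw [eq_sub_iff_add_eq, ← intervalIntegral.integral_add (e1.intervalIntegrable _ _)
    (e2.intervalIntegrable _ _)]
  refine intervalIntegral.integral_eq_sub_of_hasDerivAt_of_le
    (f := fun s => cutoff n (s - h) * G s) hc (c1.mul hG).continuousOn (fun s hs => ?_)
    ((e1.add e2).intervalIntegrable _ _)
  refine (((hasDerivAt_cutoff n (s - h)).comp s ((hasDerivAt_id s).sub_const h)).mul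
    (hd s hs)).congr_deriv ?_
  simp

/-- The Leibniz rule at a fixed smoothing level: the fundamental theorem of calculus in `t` for each
`s`, followed by Fubini. Restricting to `s > 0` is what makes the cutoff differentiable in `t`. -/
theorem integral_integral_cutoff (n : ℕ) (ht : t₀ ≤ t₁) (hc : 0 ≤ c)
    (hF : Continuous (Function.uncurry F)) (hFt : Continuous (Function.uncurry Ft))
    (hH : Continuous H) (hd : Continuous d)
    (hdt : ∀ t ∈ Ioo t₀ t₁, ∀ s ∈ Ioo 0 c, HasDerivAt (fun t => F t s) (Ft t s) t)
    (hdH : ∀ t ∈ Ioo t₀ t₁, 0 < H t → HasDerivAt H (d t) t) :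
    (∫ t in t₀..t₁, ∫ s in (0 : ℝ)..c, cutoff n (s - H t) * Ft t s) -
        ∫ t in t₀..t₁, d t * ∫ s in (0 : ℝ)..c, cutoffDeriv n (s - H t) * F t s =
      (∫ s in (0 : ℝ)..c, cutoff n (s - H t₁) * F t₁ s) -
        ∫ s in (0 : ℝ)..c, cutoff n (s - H t₀) * F t₀ s := by
  have cw : Continuous fun p : ℝ × ℝ => p.2 - H p.1 :=
    continuous_snd.sub (hH.comp continuous_fst)
  have c1 : Continuous fun p : ℝ × ℝ => cutoff n (p.2 - H p.1) := (continuous_cutoff n).comp cw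
  have c2 : Continuous fun p : ℝ × ℝ => cutoffDeriv n (p.2 - H p.1) :=
    (continuous_cutoffDeriv n).comp cw
  have e1 : Continuous fun p : ℝ × ℝ => cutoff n (p.2 - H p.1) * Ft p.1 p.2 := c1.mul hFt
  have e2 : Continuous fun p : ℝ × ℝ => cutoffDeriv n (p.2 - H p.1) * F p.1 p.2 := c2.mul hF
  have e3 : Continuous fun p : ℝ × ℝ => d p.1 * (cutoffDeriv n (p.2 - H p.1) * F p.1 p.2) :=
    (hd.comp continuous_fst).mul e2
  have e4 : Continuous fun p : ℝ × ℝ => cutoff n (p.2 - H p.1) * F p.1 p.2 := c1.mul hF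
  have slice : ∀ {f : ℝ × ℝ → ℝ}, Continuous f → ∀ t, Continuous fun s => f (t, s) :=
    fun hf t => hf.comp (by fun_prop)
  have slice' : ∀ {f : ℝ × ℝ → ℝ}, Continuous f → ∀ s, Continuous fun t => f (t, s) :=
    fun hf t => hf.comp (by fun_prop)
  have ftc : ∀ s ∈ Ioo 0 c, ∫ t in t₀..t₁, (cutoff n (s - H t) * Ft t s -
      d t * (cutoffDeriv n (s - H t) * F t s)) =
      cutoff n (s - H t₁) * F t₁ s - cutoff n (s - H t₀) * F t₀ s := by
    intro s hs
    refine intervalIntegral.integral_eq_sub_of_hasDerivAt_of_le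
      (f := fun t => cutoff n (s - H t) * F t s) ht (slice' e4 s).continuousOn (fun t h => ?_)
      ((slice' (e1.sub e3) s).intervalIntegrable _ _)
    refine ((hasDerivAt_cutoff_sub n hs.1 hH.continuousAt (hdH t h)).mul
      (hdt t h s hs)).congr_deriv ?_
    ring
  have swap : ∫ t in t₀..t₁, ∫ s in (0 : ℝ)..c, (cutoff n (s - H t) * Ft t s -
      d t * (cutoffDeriv n (s - H t) * F t s)) = ∫ s in (0 : ℝ)..c, ∫ t in t₀..t₁,
      (cutoff n (s - H t) * Ft t s - d t * (cutoffDeriv n (s - H t) * F t s)) := by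
    simp only [intervalIntegral.integral_of_le ht, intervalIntegral.integral_of_le hc]
    refine integral_integral_swap (f := fun t s => cutoff n (s - H t) * Ft t s -
      d t * (cutoffDeriv n (s - H t) * F t s)) ?_
    rw [Measure.prod_restrict]
    exact ((e1.sub e3).continuousOn.integrableOn_compact
      (isCompact_Icc.prod isCompact_Icc)).mono_set (prod_mono Ioc_subset_Icc_self
        Ioc_subset_Icc_self)
  have rhs : ∫ s in (0 : ℝ)..c, ∫ t in t₀..t₁,
      (cutoff n (s - H t) * Ft t s - d t * (cutoffDeriv n (s - H t) * F t s)) =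
      ∫ s in (0 : ℝ)..c, (cutoff n (s - H t₁) * F t₁ s - cutoff n (s - H t₀) * F t₀ s) := by
    simp only [intervalIntegral.integral_of_le hc, integral_Ioc_eq_integral_Ioo]
    exact setIntegral_congr_fun measurableSet_Ioo ftc
  rw [← intervalIntegral.integral_sub ((slice e4 t₁).intervalIntegrable _ _)
    ((slice e4 t₀).intervalIntegrable _ _), ← rhs, ← swap,
    ← intervalIntegral.integral_sub]
  · refine intervalIntegral.integral_congr fun t _ => ?_
    rw [intervalIntegral.integral_sub ((slice e1 t).intervalIntegrable _ _)
      ((slice e3 t).intervalIntegrable _ _)]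
    simp only [intervalIntegral.integral_const_mul]
  · exact (intervalIntegral.continuous_parametric_intervalIntegral_of_continuous'
      (f := fun t s => cutoff n (s - H t) * Ft t s) e1 0 c).intervalIntegrable _ _
  · exact (hd.mul (intervalIntegral.continuous_parametric_intervalIntegral_of_continuous'
      (f := fun t s => cutoffDeriv n (s - H t) * F t s) e2 0 c)).intervalIntegrable _ _

open Filter Topology in
/-- The Leibniz rule over the region `H t ≤ s ≤ c` for a continuous nonnegative function `H` that
is differentiable where it is positive. -/
theorem leibniz_moving_threshold (ht : t₀ ≤ t₁) (hc : 0 ≤ c)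
    (hF : Continuous (Function.uncurry F)) (hFt : Continuous (Function.uncurry Ft))
    (hFs : Continuous (Function.uncurry Fs)) (hH : Continuous H) (hd : Continuous d)
    (hH0 : ∀ t ∈ Icc t₀ t₁, 0 ≤ H t)
    (hdt : ∀ t ∈ Ioo t₀ t₁, ∀ s ∈ Ioo 0 c, HasDerivAt (fun t => F t s) (Ft t s) t)
    (hds : ∀ t ∈ Icc t₀ t₁, ∀ s ∈ Ioo 0 c, HasDerivAt (F t) (Fs t s) s)
    (hdH : ∀ t ∈ Ioo t₀ t₁, 0 < H t → HasDerivAt H (d t) t) :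
    (∫ t in t₀..t₁, ∫ s in (0 : ℝ)..c, if H t ≤ s then Ft t s else 0) =
      (∫ s in (0 : ℝ)..c, if H t₁ ≤ s then F t₁ s else 0) -
        (∫ s in (0 : ℝ)..c, if H t₀ ≤ s then F t₀ s else 0) +
        ∫ t in t₀..t₁, if 0 < H t ∧ H t ≤ c then d t * F t (H t) else 0 := by
  have slice : ∀ {f : ℝ → ℝ → ℝ}, Continuous (Function.uncurry f) → ∀ t, Continuous (f t) :=
    fun hf t => hf.comp (f := fun s => (t, s)) (by fun_prop)
  have cw : Continuous fun p : ℝ × ℝ => p.2 - H p.1 :=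
    continuous_snd.sub (hH.comp continuous_fst)
  have l1 : Tendsto (fun n => ∫ t in t₀..t₁, ∫ s in (0 : ℝ)..c, cutoff n (s - H t) * Ft t s)
      atTop (𝓝 (∫ t in t₀..t₁, ∫ s in (0 : ℝ)..c, if H t ≤ s then Ft t s else 0)) := by
    refine intervalIntegral.tendsto_integral_filter_of_dominated_convergence
      (fun t => ∫ s in (0 : ℝ)..c, |Ft t s|)
      (.of_forall fun n => ?_) (.of_forall fun n => .of_forall fun t _ => ?_) ?_
      (.of_forall fun t _ => tendsto_integral_cutoff (slice hFt t) _ _ _)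
    · exact (intervalIntegral.continuous_parametric_intervalIntegral_of_continuous'
        (f := fun t s => cutoff n (s - H t) * Ft t s)
        (((continuous_cutoff n).comp cw).mul hFt) 0 c).aestronglyMeasurable
    · exact abs_integral_cutoff_le (slice hFt t) _ _ hc
    · exact (intervalIntegral.continuous_parametric_intervalIntegral_of_continuous'
        (f := fun t s => |Ft t s|) hFt.abs 0 c).intervalIntegrable _ _
  have l2 : Tendsto (fun n => ∫ t in t₀..t₁,
      d t * ∫ s in (0 : ℝ)..c, cutoffDeriv n (s - H t) * F t s) atTop
      (𝓝 (∫ t in t₀..t₁, if 0 < H t ∧ H t ≤ c then d t * F t (H t) else 0)) := by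
    have cF : ∀ s, Continuous fun t => F t s := fun s =>
      hF.comp (f := fun t => (t, s)) (by fun_prop)
    refine intervalIntegral.tendsto_integral_filter_of_dominated_convergence
      (fun t => |d t| * (|F t c| + |F t 0| + ∫ s in (0 : ℝ)..c, |Fs t s|))
      (.of_forall fun n => ?_) (.of_forall fun n => .of_forall fun t ht' => ?_) ?_
      (.of_forall fun t ht' => ?_)
    · exact (hd.mul (intervalIntegral.continuous_parametric_intervalIntegral_of_continuous'
        (f := fun t s => cutoffDeriv n (s - H t) * F t s)
        (((continuous_cutoffDeriv n).comp cw).mul hF) 0 c)).aestronglyMeasurable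
    · rw [uIoc_of_le ht] at ht'
      have hm := Ioc_subset_Icc_self ht'
      rw [integral_cutoffDeriv n _ hc (slice hF t) (slice hFs t) (hds t hm), norm_mul]
      refine mul_le_mul_of_nonneg_left ?_ (norm_nonneg _)
      refine (norm_sub_le _ _).trans (add_le_add ((norm_sub_le _ _).trans (add_le_add ?_ ?_))
        (abs_integral_cutoff_le (slice hFs t) _ _ hc))
      · rw [norm_mul]; exact mul_le_of_le_one_left (abs_nonneg _) (abs_cutoff_le n _)
      · rw [norm_mul]; exact mul_le_of_le_one_left (abs_nonneg _) (abs_cutoff_le n _)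
    · exact (hd.abs.mul (((cF c).abs.add (cF 0).abs).add
        (intervalIntegral.continuous_parametric_intervalIntegral_of_continuous'
        (f := fun t s => |Fs t s|) hFs.abs 0 c))).intervalIntegrable _ _
    · rw [uIoc_of_le ht] at ht'
      have hm := Ioc_subset_Icc_self ht'
      have h0 := hH0 t hm
      -- The limit of the right side of `integral_cutoffDeriv`. If `H t = 0` the end terms cancel
      -- the integral, so the flat part of the boundary contributes nothing; if `0 < H t ≤ c` only
      -- `F t (H t)` survives.
      have key : (if 0 < H t ∧ H t ≤ c then d t * F t (H t) else 0) = d t *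
          ((if 0 ≤ c - H t then 1 else 0) * F t c - (if 0 ≤ 0 - H t then 1 else 0) * F t 0 -
            ∫ s in (0 : ℝ)..c, if H t ≤ s then Fs t s else 0) := by
        rw [integral_ite_le_eq hc h0 (slice hF t) (slice hFs t) (hds t hm)]
        rcases h0.eq_or_lt with h | h
        · simp [← h, hc]
        · by_cases h' : H t ≤ c
          · simp [h, h', not_le.2 h]
          · simp [h', not_le.2 h]
      rw [key]
      simp only [fun n => integral_cutoffDeriv n (H t) hc (slice hF t) (slice hFs t) (hds t hm)]
      exact ((((tendsto_cutoff _).mul_const _).sub ((tendsto_cutoff _).mul_const _)).sub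
        (tendsto_integral_cutoff (slice hFs t) _ _ _)).const_mul _
  have l3 := tendsto_integral_cutoff (slice hF t₁) (H t₁) 0 c
  have l4 := tendsto_integral_cutoff (slice hF t₀) (H t₀) 0 c
  have := tendsto_nhds_unique ((l1.sub l2).congr fun n =>
    integral_integral_cutoff n ht hc hF hFt hH hd hdt hdH) (l3.sub l4)
  linarith

end Leibniz

/-! ### The divergence theorem above a threshold on the cylinder -/

/-- The measure on the part `u₀ ≤ u ≤ u₁` of the cylinder. -/
abbrev cylIcc (u₀ u₁ : ℝ) : Measure (ℝ × Sph) := cylMeasure.restrict (Icc u₀ u₁ ×ˢ univ)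

theorem cylIcc_eq_prod (u₀ u₁ : ℝ) :
    cylIcc u₀ u₁ = ((volume : Measure ℝ).restrict (Icc u₀ u₁)).prod sphMeasure := by
  rw [cylIcc, cylMeasure, ← Measure.prod_restrict, Measure.restrict_univ]

instance (u₀ u₁ : ℝ) : IsFiniteMeasure (cylIcc u₀ u₁) := by
  rw [cylIcc_eq_prod]; infer_instance

theorem ae_cylIcc_mem (u₀ u₁ : ℝ) : ∀ᵐ y ∂cylIcc u₀ u₁, y.1 ∈ Icc u₀ u₁ := by
  filter_upwards [ae_restrict_mem (measurableSet_Icc.prod MeasurableSet.univ)] with y hy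
  exact hy.1

theorem integrable_cylIcc {f : ℝ × Sph → ℝ} (hf : Continuous f) (u₀ u₁ : ℝ) :
    Integrable f (cylIcc u₀ u₁) := by
  obtain ⟨C, hC⟩ := (isCompact_Icc.prod isCompact_univ).exists_bound_of_continuousOn
    (s := Icc u₀ u₁ ×ˢ (univ : Set Sph)) hf.continuousOn
  refine Integrable.of_bound hf.aestronglyMeasurable C ?_
  filter_upwards [ae_cylIcc_mem u₀ u₁] with y hy using hC y ⟨hy, mem_univ _⟩

theorem integral_cylIcc_eq {f : ℝ × Sph → ℝ} {u₀ u₁ : ℝ} (h : u₀ ≤ u₁)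
    (hf : Integrable f (cylIcc u₀ u₁)) :
    ∫ y, f y ∂cylIcc u₀ u₁ = ∫ x, (∫ u in u₀..u₁, f (u, x)) ∂sphMeasure := by
  rw [cylIcc_eq_prod] at hf ⊢
  rw [integral_prod_symm _ hf]
  simp only [intervalIntegral.integral_of_le h, integral_Icc_eq_integral_Ioc]

theorem integral_cylIcc_eq' {f : ℝ × Sph → ℝ} {u₀ u₁ : ℝ}
    (hf : Integrable f (cylIcc u₀ u₁)) :
    ∫ y, f y ∂cylIcc u₀ u₁ = ∫ u in Icc u₀ u₁, ∫ x, f (u, x) ∂sphMeasure := by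
  rw [cylIcc_eq_prod] at hf ⊢
  rw [integral_prod _ hf]

/-- Averaging over a one-parameter group of rotations does not change the integral. -/
theorem integral_integral_sphRot (i : Fin 3) {f : Sph → ℝ} (hf : Measurable f) {C : ℝ}
    (hC : ∀ x, |f x| ≤ C) :
    ∫ x, (∫ t in (0 : ℝ)..1, f (sphRot i t x)) ∂sphMeasure = ∫ x, f x ∂sphMeasure := by
  simp only [intervalIntegral.integral_of_le (zero_le_one' ℝ)]
  rw [integral_integral_swap (f := fun x t => f (sphRot i t x))]
  · simp [integral_sphRot]
  · refine Integrable.of_bound (C := C) ?_ (.of_forall fun p => hC _)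
    exact (hf.comp ((continuous_sphRot i).comp
      continuous_swap).measurable).aestronglyMeasurable

section Slab

variable {H : ℝ → Sph → ℝ} {K : ℝ → ℝ → Sph → ℝ} {u₀ u₁ c : ℝ}

theorem continuous_slice {K : ℝ → ℝ → Sph → ℝ}
    (hK : Continuous fun p : ℝ × ℝ × Sph => K p.1 p.2.1 p.2.2) (u : ℝ) (x : Sph) :
    Continuous fun s => K u s x :=
  hK.comp (f := fun s => (u, s, x)) (by fun_prop)

/-- The integral of `K` over the part `H ≤ s ≤ c` of a fibre. -/
def fibreIntegral (H : ℝ → Sph → ℝ) (c : ℝ) (K : ℝ → ℝ → Sph → ℝ) (y : ℝ × Sph) : ℝ :=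
  ∫ s in (0 : ℝ)..c, if H y.1 y.2 ≤ s then K y.1 s y.2 else 0

theorem measurable_fibreIntegral (hH : Continuous fun y : ℝ × Sph => H y.1 y.2)
    (hK : Continuous fun p : ℝ × ℝ × Sph => K p.1 p.2.1 p.2.2) :
    Measurable (fibreIntegral H c K) := by
  refine measurable_of_tendsto_metrizable (f := fun n (y : ℝ × Sph) =>
    ∫ s in (0 : ℝ)..c, cutoff n (s - H y.1 y.2) * K y.1 s y.2) (fun n => ?_) ?_
  · refine (intervalIntegral.continuous_parametric_intervalIntegral_of_continuous'
      (f := fun (y : ℝ × Sph) s => cutoff n (s - H y.1 y.2) * K y.1 s y.2) ?_ 0 c).measurable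
    exact ((continuous_cutoff n).comp (continuous_snd.sub (hH.comp continuous_fst))).mul
      (hK.comp (f := fun p : (ℝ × Sph) × ℝ => (p.1.1, p.2, p.1.2)) (by fun_prop))
  · refine tendsto_pi_nhds.2 fun y => tendsto_integral_cutoff ?_ _ _ _
    exact hK.comp (f := fun s => (y.1, s, y.2)) (by fun_prop)

theorem abs_fibreIntegral_le (hc : 0 ≤ c)
    (hK : Continuous fun p : ℝ × ℝ × Sph => K p.1 p.2.1 p.2.2) (y : ℝ × Sph) :
    |fibreIntegral H c K y| ≤ ∫ s in (0 : ℝ)..c, |K y.1 s y.2| := by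
  have hKs : Continuous fun s => K y.1 s y.2 :=
    hK.comp (f := fun s => (y.1, s, y.2)) (by fun_prop)
  exact le_of_tendsto (tendsto_integral_cutoff hKs (H y.1 y.2) 0 c).abs
    (.of_forall fun n => abs_integral_cutoff_le hKs n _ hc)

theorem continuous_fibreIntegral_abs
    (hK : Continuous fun p : ℝ × ℝ × Sph => K p.1 p.2.1 p.2.2) :
    Continuous fun y : ℝ × Sph => ∫ s in (0 : ℝ)..c, |K y.1 s y.2| :=
  intervalIntegral.continuous_parametric_intervalIntegral_of_continuous'
    (f := fun (y : ℝ × Sph) s => |K y.1 s y.2|)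
    (hK.abs.comp (f := fun p : (ℝ × Sph) × ℝ => (p.1.1, p.2, p.1.2)) (by fun_prop)) 0 c

theorem integrable_fibreIntegral (hc : 0 ≤ c) (hH : Continuous fun y : ℝ × Sph => H y.1 y.2)
    (hK : Continuous fun p : ℝ × ℝ × Sph => K p.1 p.2.1 p.2.2) :
    Integrable (fibreIntegral H c K) (cylIcc u₀ u₁) :=
  (integrable_cylIcc (continuous_fibreIntegral_abs hK) _ _).mono'
    (measurable_fibreIntegral hH hK).aestronglyMeasurable
    (.of_forall fun y => abs_fibreIntegral_le hc hK y)

theorem intervalIntegrable_ite_le {G : ℝ → ℝ} (hG : Continuous G) (h a b : ℝ) :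
    IntervalIntegrable (fun s => if h ≤ s then G s else 0) volume a b := by
  refine (hG.intervalIntegrable a b).mono_fun
    (measurable_ite_le measurable_const measurable_id hG.measurable).aestronglyMeasurable
    (.of_forall fun s => ?_)
  simp only
  split_ifs <;> simp

theorem fibreIntegral_add {K' : ℝ → ℝ → Sph → ℝ}
    (hK : Continuous fun p : ℝ × ℝ × Sph => K p.1 p.2.1 p.2.2)
    (hK' : Continuous fun p : ℝ × ℝ × Sph => K' p.1 p.2.1 p.2.2) (y : ℝ × Sph) :
    fibreIntegral H c (fun u s x => K u s x + K' u s x) y =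
      fibreIntegral H c K y + fibreIntegral H c K' y := by
  unfold fibreIntegral
  rw [← intervalIntegral.integral_add
    (intervalIntegrable_ite_le (continuous_slice hK y.1 y.2) _ _ _)
    (intervalIntegrable_ite_le (continuous_slice hK' y.1 y.2) _ _ _)]
  refine intervalIntegral.integral_congr fun s _ => ?_
  simp only
  split_ifs <;> simp

theorem fibreIntegral_neg (y : ℝ × Sph) :
    fibreIntegral H c (fun u s x => -K u s x) y = -fibreIntegral H c K y := by
  unfold fibreIntegral
  rw [← intervalIntegral.integral_neg]
  refine intervalIntegral.integral_congr fun s _ => ?_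
  simp only
  split_ifs <;> simp

theorem integrable_ite_cylIcc {f : ℝ × Sph → ℝ} {P : ℝ × Sph → Prop} [DecidablePred P]
    (hP : MeasurableSet {y | P y}) (hf : Continuous f) :
    Integrable (fun y => if P y then f y else 0) (cylIcc u₀ u₁) := by
  refine (integrable_cylIcc hf u₀ u₁).mono
    (Measurable.ite hP hf.measurable measurable_const).aestronglyMeasurable
    (.of_forall fun y => ?_)
  split_ifs <;> simp

theorem measurableSet_pos_le (hH : Continuous fun y : ℝ × Sph => H y.1 y.2) :
    MeasurableSet {y : ℝ × Sph | 0 < H y.1 y.2 ∧ H y.1 y.2 ≤ c} :=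
  (measurableSet_lt measurable_const hH.measurable).inter
    (measurableSet_le hH.measurable measurable_const)

/-- The `u`-part of the divergence theorem, for a nonnegative flux through `u = u₁`. -/
theorem le_integral_fibreIntegral_deriv {A Au As : ℝ → ℝ → Sph → ℝ} {d : ℝ → Sph → ℝ}
    (hu : u₀ ≤ u₁) (hc : 0 ≤ c) (hH : Continuous fun y : ℝ × Sph => H y.1 y.2)
    (hA : Continuous fun p : ℝ × ℝ × Sph => A p.1 p.2.1 p.2.2)
    (hAu : Continuous fun p : ℝ × ℝ × Sph => Au p.1 p.2.1 p.2.2)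
    (hAs : Continuous fun p : ℝ × ℝ × Sph => As p.1 p.2.1 p.2.2)
    (hd : Continuous fun y : ℝ × Sph => d y.1 y.2)
    (hH0 : ∀ u ∈ Icc u₀ u₁, ∀ x, 0 ≤ H u x) (hHc : ∀ x, c < H u₀ x)
    (hdH : ∀ u ∈ Ioo u₀ u₁, ∀ x, 0 < H u x → HasDerivAt (fun u => H u x) (d u x) u)
    (hdu : ∀ u ∈ Ioo u₀ u₁, ∀ s ∈ Ioo 0 c, ∀ x, HasDerivAt (fun u => A u s x) (Au u s x) u)
    (hds : ∀ u ∈ Icc u₀ u₁, ∀ s ∈ Ioo 0 c, ∀ x, HasDerivAt (fun s => A u s x) (As u s x) s)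
    (hpos : ∀ s ∈ Icc 0 c, ∀ x, 0 ≤ A u₁ s x) :
    ∫ y, (if 0 < H y.1 y.2 ∧ H y.1 y.2 ≤ c then d y.1 y.2 * A y.1 (H y.1 y.2) y.2 else 0)
        ∂cylIcc u₀ u₁ ≤ ∫ y, fibreIntegral H c Au y ∂cylIcc u₀ u₁ := by
  have i1 : Integrable (fun y : ℝ × Sph => if 0 < H y.1 y.2 ∧ H y.1 y.2 ≤ c then
      d y.1 y.2 * A y.1 (H y.1 y.2) y.2 else 0) (cylIcc u₀ u₁) :=
    integrable_ite_cylIcc (measurableSet_pos_le hH) (hd.mul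
      (hA.comp (f := fun y : ℝ × Sph => (y.1, H y.1 y.2, y.2)) (by fun_prop)))
  have i2 := integrable_fibreIntegral (u₀ := u₀) (u₁ := u₁) hc hH hAu
  rw [integral_cylIcc_eq hu i1, integral_cylIcc_eq hu i2]
  rw [cylIcc_eq_prod] at i1 i2
  have j1 := i1.integral_prod_right
  have j2 := i2.integral_prod_right
  simp only [integral_Icc_eq_integral_Ioc, ← intervalIntegral.integral_of_le hu] at j1 j2
  refine integral_mono j1 j2 fun x => ?_
  have sec : ∀ {F : ℝ → ℝ → Sph → ℝ}, Continuous (fun p : ℝ × ℝ × Sph => F p.1 p.2.1 p.2.2) →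
      Continuous (Function.uncurry fun u s => F u s x) := fun hF =>
    hF.comp (f := fun p : ℝ × ℝ => (p.1, p.2, x)) (by fun_prop)
  have sec' : ∀ {F : ℝ → Sph → ℝ}, Continuous (fun y : ℝ × Sph => F y.1 y.2) →
      Continuous fun u => F u x := fun hF =>
    hF.comp (f := fun u : ℝ => (u, x)) (by fun_prop)
  have key := leibniz_moving_threshold (F := fun u s => A u s x) (Ft := fun u s => Au u s x)
    (Fs := fun u s => As u s x) (H := fun u => H u x) (d := fun u => d u x) hu hc
    (sec hA) (sec hAu) (sec hAs) (sec' hH) (sec' hd) (fun u h => hH0 u h x)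
    (fun u h s hs => hdu u h s hs x) (fun u h s hs => hds u h s hs x) (fun u h => hdH u h x)
  simp only [fibreIntegral]
  rw [key]
  -- The fibre over `u₀` is empty, since the threshold exceeds `c` there; the one over `u₁`
  -- contributes a nonnegative term, which may be discarded.
  have z : ∫ s in (0 : ℝ)..c, (if H u₀ x ≤ s then A u₀ s x else 0) = 0 := by
    rw [intervalIntegral.integral_of_le hc]
    refine setIntegral_eq_zero_of_forall_eq_zero fun s hs => ?_
    rw [if_neg (not_le.2 (hs.2.trans_lt (hHc x)))]
  have p : 0 ≤ ∫ s in (0 : ℝ)..c, (if H u₁ x ≤ s then A u₁ s x else 0) := by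
    refine intervalIntegral.integral_nonneg hc fun s hs => ?_
    split_ifs
    exacts [hpos s hs x, le_rfl]
  rw [z]
  linarith

/-- The angular part of the divergence theorem. -/
theorem integral_fibreIntegral_rot (i : Fin 3) {Q Qr Qs : ℝ → ℝ → Sph → ℝ} {d : ℝ → Sph → ℝ}
    (hc : 0 ≤ c) (hH : Continuous fun y : ℝ × Sph => H y.1 y.2)
    (hQ : Continuous fun p : ℝ × ℝ × Sph => Q p.1 p.2.1 p.2.2)
    (hQr : Continuous fun p : ℝ × ℝ × Sph => Qr p.1 p.2.1 p.2.2)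
    (hQs : Continuous fun p : ℝ × ℝ × Sph => Qs p.1 p.2.1 p.2.2)
    (hd : Continuous fun y : ℝ × Sph => d y.1 y.2)
    (hH0 : ∀ u ∈ Icc u₀ u₁, ∀ x, 0 ≤ H u x)
    (hdH : ∀ u ∈ Icc u₀ u₁, ∀ x t, 0 < H u (sphRot i t x) →
      HasDerivAt (fun t => H u (sphRot i t x)) (d u (sphRot i t x)) t)
    (hdr : ∀ u ∈ Icc u₀ u₁, ∀ s ∈ Ioo 0 c, ∀ x t,
      HasDerivAt (fun t => Q u s (sphRot i t x)) (Qr u s (sphRot i t x)) t)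
    (hds : ∀ u ∈ Icc u₀ u₁, ∀ s ∈ Ioo 0 c, ∀ x, HasDerivAt (fun s => Q u s x) (Qs u s x) s) :
    ∫ y, fibreIntegral H c Qr y ∂cylIcc u₀ u₁ =
      ∫ y, (if 0 < H y.1 y.2 ∧ H y.1 y.2 ≤ c then d y.1 y.2 * Q y.1 (H y.1 y.2) y.2 else 0)
        ∂cylIcc u₀ u₁ := by
  have hcont : Continuous fun y : ℝ × Sph => d y.1 y.2 * Q y.1 (H y.1 y.2) y.2 :=
    hd.mul (hQ.comp (f := fun y : ℝ × Sph => (y.1, H y.1 y.2, y.2)) (by fun_prop))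
  have i1 := integrable_ite_cylIcc (u₀ := u₀) (u₁ := u₁) (measurableSet_pos_le (c := c) hH) hcont
  have i2 := integrable_fibreIntegral (u₀ := u₀) (u₁ := u₁) hc hH hQr
  rw [integral_cylIcc_eq' i1, integral_cylIcc_eq' i2]
  refine setIntegral_congr_fun measurableSet_Icc fun u hu => ?_
  simp only
  have bound : ∀ {f : Sph → ℝ}, Continuous f → ∃ C, ∀ x, |f x| ≤ C := fun hf => by
    obtain ⟨C, hC⟩ := isCompact_univ.exists_bound_of_continuousOn hf.continuousOn
    exact ⟨C, fun x => hC x (mem_univ _)⟩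
  have slice : ∀ {f : ℝ × Sph → ℝ}, Continuous f → Continuous fun x => f (u, x) := fun hf =>
    hf.comp (f := fun x => (u, x)) (by fun_prop)
  have meas : Measurable fun x : Sph => (u, x) := by fun_prop
  obtain ⟨C1, hC1⟩ := bound (slice (continuous_fibreIntegral_abs (c := c) hQr))
  obtain ⟨C2, hC2⟩ := bound (slice (continuous_fibreIntegral_abs (c := c) hQ))
  obtain ⟨C3, hC3⟩ := bound (slice hcont)
  have m2 : Measurable fun x => fibreIntegral H c Q (u, x) :=
    (measurable_fibreIntegral hH hQ).comp meas
  have b2 : ∀ x, |fibreIntegral H c Q (u, x)| ≤ C2 := fun x =>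
    (abs_fibreIntegral_le hc hQ _).trans ((le_abs_self _).trans (hC2 x))
  have m3 : Measurable fun x => if 0 < H u x ∧ H u x ≤ c then d u x * Q u (H u x) x else 0 :=
    (Measurable.ite (measurableSet_pos_le hH) hcont.measurable measurable_const).comp meas
  have m1 : Measurable fun x => fibreIntegral H c Qr (u, x) :=
    (measurable_fibreIntegral hH hQr).comp meas
  -- Both sides are averaged over the rotations by angles in `[0, 1]`. Along each orbit the Leibniz
  -- rule applies, and its two end terms have equal integrals over the sphere by rotation
  -- invariance.
  rw [← integral_integral_sphRot i m1
      (fun x => (abs_fibreIntegral_le hc hQr _).trans ((le_abs_self _).trans (hC1 x))),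
    ← integral_integral_sphRot i m3 (C := C3) (fun x => by
      split_ifs
      · exact hC3 x
      · rw [abs_zero]; exact (abs_nonneg _).trans (hC3 x))]
  have key : ∀ x, ∫ t in (0 : ℝ)..1, fibreIntegral H c Qr (u, sphRot i t x) =
      fibreIntegral H c Q (u, sphRot i 1 x) - fibreIntegral H c Q (u, x) +
      ∫ t in (0 : ℝ)..1, if 0 < H u (sphRot i t x) ∧ H u (sphRot i t x) ≤ c then
        d u (sphRot i t x) * Q u (H u (sphRot i t x)) (sphRot i t x) else 0 := by
    intro x
    have crot : Continuous fun t => sphRot i t x :=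
      (continuous_sphRot i).comp (f := fun t => (t, x)) (by fun_prop)
    have sec : ∀ {F : ℝ → ℝ → Sph → ℝ},
        Continuous (fun p : ℝ × ℝ × Sph => F p.1 p.2.1 p.2.2) →
        Continuous (Function.uncurry fun t s => F u s (sphRot i t x)) := fun hF =>
      hF.comp (f := fun p : ℝ × ℝ => (u, p.2, sphRot i p.1 x)) (by fun_prop)
    have sec' : ∀ {F : ℝ → Sph → ℝ}, Continuous (fun y : ℝ × Sph => F y.1 y.2) →
        Continuous fun t => F u (sphRot i t x) := fun hF =>
      hF.comp (f := fun t : ℝ => (u, sphRot i t x)) (by fun_prop)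
    have := leibniz_moving_threshold (F := fun t s => Q u s (sphRot i t x))
      (Ft := fun t s => Qr u s (sphRot i t x)) (Fs := fun t s => Qs u s (sphRot i t x))
      (H := fun t => H u (sphRot i t x)) (d := fun t => d u (sphRot i t x))
      zero_le_one hc (sec hQ) (sec hQr) (sec hQs) (sec' hH) (sec' hd)
      (fun t _ => hH0 u hu _) (fun t _ s hs => hdr u hu s hs x t)
      (fun t _ s hs => hds u hu s hs _) (fun t _ => hdH u hu x t)
    simpa only [fibreIntegral, sphRot_zero] using this
  simp only [key]
  have int2 : Integrable (fun x => fibreIntegral H c Q (u, x)) sphMeasure :=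
    Integrable.of_bound m2.aestronglyMeasurable C2 (.of_forall b2)
  have m2' : Measurable fun x => fibreIntegral H c Q (u, sphRot i 1 x) :=
    m2.comp ((continuous_sphRot i).comp (f := fun x => (1, x)) (by fun_prop)).measurable
  have int1 : Integrable (fun x => fibreIntegral H c Q (u, sphRot i 1 x)) sphMeasure :=
    Integrable.of_bound m2'.aestronglyMeasurable C2 (.of_forall fun x => b2 _)
  have int3 : Integrable (fun x => ∫ t in (0 : ℝ)..1,
      if 0 < H u (sphRot i t x) ∧ H u (sphRot i t x) ≤ c then
        d u (sphRot i t x) * Q u (H u (sphRot i t x)) (sphRot i t x) else 0) sphMeasure := by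
    simp only [intervalIntegral.integral_of_le (zero_le_one' ℝ)]
    refine Integrable.integral_prod_left (f := fun p : Sph × ℝ =>
      if 0 < H u (sphRot i p.2 p.1) ∧ H u (sphRot i p.2 p.1) ≤ c then
        d u (sphRot i p.2 p.1) * Q u (H u (sphRot i p.2 p.1)) (sphRot i p.2 p.1) else 0) ?_
    refine Integrable.of_bound (C := C3) ?_ (.of_forall fun p => ?_)
    · exact (m3.comp ((continuous_sphRot i).comp
        continuous_swap).measurable).aestronglyMeasurable
    · split_ifs
      · exact hC3 _
      · rw [norm_zero]; exact (abs_nonneg _).trans (hC3 p.1)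
  rw [integral_add (f := fun x => fibreIntegral H c Q (u, sphRot i 1 x) -
      fibreIntegral H c Q (u, x)) (int1.sub int2) int3, integral_sub int1 int2,
    integral_sphRot i 1 (fun x => fibreIntegral H c Q (u, x)), sub_self, zero_add]

/-- The flux inequality for a current with nonpositive divergence in the region `H ≤ s ≤ c`,
`u₀ ≤ u ≤ u₁`, where `H` exceeds `c` at `u = u₀`. -/
theorem flux_inequality_of_continuous {A Au As B Bs : ℝ → ℝ → Sph → ℝ}
    {Q Qr Qs : Fin 3 → ℝ → ℝ → Sph → ℝ} {d : ℝ → Sph → ℝ} {e : Fin 3 → ℝ → Sph → ℝ}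
    (hu : u₀ ≤ u₁) (hc : 0 ≤ c) (hH : Continuous fun y : ℝ × Sph => H y.1 y.2)
    (hA : Continuous fun p : ℝ × ℝ × Sph => A p.1 p.2.1 p.2.2)
    (hAu : Continuous fun p : ℝ × ℝ × Sph => Au p.1 p.2.1 p.2.2)
    (hAs : Continuous fun p : ℝ × ℝ × Sph => As p.1 p.2.1 p.2.2)
    (hB : Continuous fun p : ℝ × ℝ × Sph => B p.1 p.2.1 p.2.2)
    (hBs : Continuous fun p : ℝ × ℝ × Sph => Bs p.1 p.2.1 p.2.2)
    (hQ : ∀ i, Continuous fun p : ℝ × ℝ × Sph => Q i p.1 p.2.1 p.2.2)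
    (hQr : ∀ i, Continuous fun p : ℝ × ℝ × Sph => Qr i p.1 p.2.1 p.2.2)
    (hQs : ∀ i, Continuous fun p : ℝ × ℝ × Sph => Qs i p.1 p.2.1 p.2.2)
    (hd : Continuous fun y : ℝ × Sph => d y.1 y.2)
    (he : ∀ i, Continuous fun y : ℝ × Sph => e i y.1 y.2)
    (hH0 : ∀ u ∈ Icc u₀ u₁, ∀ x, 0 ≤ H u x) (hHc : ∀ x, c < H u₀ x)
    (hdH : ∀ u ∈ Ioo u₀ u₁, ∀ x, 0 < H u x → HasDerivAt (fun u => H u x) (d u x) u)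
    (hrH : ∀ i, ∀ u ∈ Icc u₀ u₁, ∀ x t, 0 < H u (sphRot i t x) →
      HasDerivAt (fun t => H u (sphRot i t x)) (e i u (sphRot i t x)) t)
    (hdu : ∀ u ∈ Ioo u₀ u₁, ∀ s ∈ Ioo 0 c, ∀ x, HasDerivAt (fun u => A u s x) (Au u s x) u)
    (hAds : ∀ u ∈ Icc u₀ u₁, ∀ s ∈ Ioo 0 c, ∀ x, HasDerivAt (fun s => A u s x) (As u s x) s)
    (hBds : ∀ u ∈ Icc u₀ u₁, ∀ s ∈ Ioo 0 c, ∀ x, HasDerivAt (fun s => B u s x) (Bs u s x) s)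
    (hQdr : ∀ i, ∀ u ∈ Icc u₀ u₁, ∀ s ∈ Ioo 0 c, ∀ x t,
      HasDerivAt (fun t => Q i u s (sphRot i t x)) (Qr i u s (sphRot i t x)) t)
    (hQds : ∀ i, ∀ u ∈ Icc u₀ u₁, ∀ s ∈ Ioo 0 c, ∀ x,
      HasDerivAt (fun s => Q i u s x) (Qs i u s x) s)
    (hpos : ∀ s ∈ Icc 0 c, ∀ x, 0 ≤ A u₁ s x)
    (hbulk : ∀ u ∈ Icc u₀ u₁, ∀ s ∈ Icc 0 c, ∀ x, H u x ≤ s →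
      Au u s x + Bs u s x - ∑ i, Qr i u s x ≤ 0) :
    ∫ y, (if H y.1 y.2 ≤ c then B y.1 c y.2 else 0) ∂cylIcc u₀ u₁ ≤
      ∫ y, (if H y.1 y.2 ≤ 0 then B y.1 0 y.2 else 0) ∂cylIcc u₀ u₁ +
      ∫ y, (if 0 < H y.1 y.2 ∧ H y.1 y.2 ≤ c then B y.1 (H y.1 y.2) y.2 -
        d y.1 y.2 * A y.1 (H y.1 y.2) y.2 + ∑ i, e i y.1 y.2 * Q i y.1 (H y.1 y.2) y.2 else 0)
        ∂cylIcc u₀ u₁ := by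
  have l1 := le_integral_fibreIntegral_deriv hu hc hH hA hAu hAs hd hH0 hHc hdH hdu hAds hpos
  have l2 := fun i => integral_fibreIntegral_rot i hc hH (hQ i) (hQr i) (hQs i) (he i) hH0
    (hrH i) (hQdr i) (hQds i)
  have atH : ∀ {F : ℝ → ℝ → Sph → ℝ}, Continuous (fun p : ℝ × ℝ × Sph => F p.1 p.2.1 p.2.2) →
      Continuous fun y : ℝ × Sph => F y.1 (H y.1 y.2) y.2 := fun hF =>
    hF.comp (f := fun y : ℝ × Sph => (y.1, H y.1 y.2, y.2)) (by fun_prop)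
  have atc : ∀ {F : ℝ → ℝ → Sph → ℝ} (c : ℝ),
      Continuous (fun p : ℝ × ℝ × Sph => F p.1 p.2.1 p.2.2) →
      Continuous fun y : ℝ × Sph => F y.1 c y.2 := fun c hF =>
    hF.comp (f := fun y : ℝ × Sph => (y.1, c, y.2)) (by fun_prop)
  have mle : ∀ c : ℝ, MeasurableSet {y : ℝ × Sph | H y.1 y.2 ≤ c} := fun c =>
    measurableSet_le hH.measurable measurable_const
  have mpl := measurableSet_pos_le (c := c) hH
  have iAu := integrable_fibreIntegral (u₀ := u₀) (u₁ := u₁) hc hH hAu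
  have iBs := integrable_fibreIntegral (u₀ := u₀) (u₁ := u₁) hc hH hBs
  have iQr := fun i => integrable_fibreIntegral (u₀ := u₀) (u₁ := u₁) hc hH (hQr i)
  have i1 := integrable_ite_cylIcc (u₀ := u₀) (u₁ := u₁) (mle c) (atc c hB)
  have i2 := integrable_ite_cylIcc (u₀ := u₀) (u₁ := u₁) (mle 0) (atc 0 hB)
  have i3 := integrable_ite_cylIcc (u₀ := u₀) (u₁ := u₁) mpl (atH hB)
  have i4 := integrable_ite_cylIcc (u₀ := u₀) (u₁ := u₁) mpl
    (f := fun y => d y.1 y.2 * A y.1 (H y.1 y.2) y.2) (hd.mul (atH hA))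
  have i5 := fun i => integrable_ite_cylIcc (u₀ := u₀) (u₁ := u₁) mpl
    (f := fun y => e i y.1 y.2 * Q i y.1 (H y.1 y.2) y.2) ((he i).mul (atH (hQ i)))
  have iAB : Integrable (fun y => fibreIntegral H c Au y + fibreIntegral H c Bs y)
    (cylIcc u₀ u₁) := iAu.add iBs
  -- The lower end of a fibre lies on `s = 0` where `H = 0` and on the graph where `H > 0`; the two
  -- cases become the horizon term and the hypersurface term.
  have hB' : ∀ᵐ y ∂cylIcc u₀ u₁, fibreIntegral H c Bs y =
      (if H y.1 y.2 ≤ c then B y.1 c y.2 else 0) - (if H y.1 y.2 ≤ 0 then B y.1 0 y.2 else 0) -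
      (if 0 < H y.1 y.2 ∧ H y.1 y.2 ≤ c then B y.1 (H y.1 y.2) y.2 else 0) := by
    filter_upwards [ae_cylIcc_mem u₀ u₁] with y hy
    have h0 := hH0 y.1 hy y.2
    rw [fibreIntegral, integral_ite_le_eq hc h0 (G := fun s => B y.1 s y.2)
      (continuous_slice hB y.1 y.2) (continuous_slice hBs y.1 y.2) fun s hs => hBds y.1 hy s hs y.2]
    rcases h0.eq_or_lt with h | h
    · simp [← h, hc]
    · by_cases h' : H y.1 y.2 ≤ c
      · simp [h, h', not_le.2 h]
      · simp [h', not_le.2 h]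
  have bulk : ∫ y, (fibreIntegral H c Au y + fibreIntegral H c Bs y -
      ∑ i, fibreIntegral H c (Qr i) y) ∂cylIcc u₀ u₁ ≤ 0 := by
    refine integral_nonpos_of_ae ?_
    filter_upwards [ae_cylIcc_mem u₀ u₁] with y hy
    have cQ : Continuous fun p : ℝ × ℝ × Sph => ∑ i, Qr i p.1 p.2.1 p.2.2 :=
      continuous_finsetSum _ fun i _ => hQr i
    have sec : ∀ {F : ℝ → ℝ → Sph → ℝ},
        Continuous (fun p : ℝ × ℝ × Sph => F p.1 p.2.1 p.2.2) →
        IntervalIntegrable (fun s => if H y.1 y.2 ≤ s then F y.1 s y.2 else 0) volume 0 c :=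
      fun hF => intervalIntegrable_ite_le (hF.comp (f := fun s => (y.1, s, y.2))
        (by fun_prop)) _ _ _
    have e1 : ∑ i, fibreIntegral H c (Qr i) y =
        fibreIntegral H c (fun u s x => ∑ i, Qr i u s x) y := by
      unfold fibreIntegral
      rw [← intervalIntegral.integral_finsetSum fun i _ => sec (hQr i)]
      refine intervalIntegral.integral_congr fun s _ => ?_
      simp only
      split_ifs <;> simp
    rw [e1, sub_eq_add_neg, ← fibreIntegral_neg, ← fibreIntegral_add hAu hBs,
      ← fibreIntegral_add (hAu.add hBs) cQ.neg]
    refine neg_nonneg.1 ?_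
    rw [fibreIntegral, ← intervalIntegral.integral_neg]
    refine intervalIntegral.integral_nonneg hc fun s hs => ?_
    split_ifs with h
    · have := hbulk y.1 hy s hs y.2 h
      linarith
    · simp
  rw [integral_sub iAB (integrable_finsetSum _ fun i _ => iQr i),
    integral_add iAu iBs, integral_finsetSum _ fun i _ => iQr i,
    Finset.sum_congr rfl fun i _ => l2 i, integral_congr_ae hB',
    integral_sub (f := fun y : ℝ × Sph => (if H y.1 y.2 ≤ c then B y.1 c y.2 else 0) -
      (if H y.1 y.2 ≤ 0 then B y.1 0 y.2 else 0)) (i1.sub i2) i3, integral_sub i1 i2] at bulk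
  have e2 : ∫ y, (if 0 < H y.1 y.2 ∧ H y.1 y.2 ≤ c then B y.1 (H y.1 y.2) y.2 -
        d y.1 y.2 * A y.1 (H y.1 y.2) y.2 + ∑ i, e i y.1 y.2 * Q i y.1 (H y.1 y.2) y.2 else 0)
        ∂cylIcc u₀ u₁ =
      ∫ y, (if 0 < H y.1 y.2 ∧ H y.1 y.2 ≤ c then B y.1 (H y.1 y.2) y.2 else 0) ∂cylIcc u₀ u₁ -
      ∫ y, (if 0 < H y.1 y.2 ∧ H y.1 y.2 ≤ c then d y.1 y.2 * A y.1 (H y.1 y.2) y.2 else 0)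
        ∂cylIcc u₀ u₁ + ∑ i, ∫ y, (if 0 < H y.1 y.2 ∧ H y.1 y.2 ≤ c then
          e i y.1 y.2 * Q i y.1 (H y.1 y.2) y.2 else 0) ∂cylIcc u₀ u₁ := by
    rw [← integral_sub i3 i4, ← integral_finsetSum _ fun i _ => i5 i,
      ← integral_add (f := fun y : ℝ × Sph => (if 0 < H y.1 y.2 ∧ H y.1 y.2 ≤ c then
        B y.1 (H y.1 y.2) y.2 else 0) - (if 0 < H y.1 y.2 ∧ H y.1 y.2 ≤ c then
        d y.1 y.2 * A y.1 (H y.1 y.2) y.2 else 0)) (i3.sub i4)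
        (integrable_finsetSum _ fun i _ => i5 i)]
    refine integral_congr_ae (.of_forall fun y => ?_)
    simp only
    split_ifs <;> simp
  rw [e2]
  linarith

/-- The box `u₀ ≤ u ≤ u₁`, `0 ≤ s ≤ c` times the sphere. -/
abbrev box3 (u₀ u₁ c : ℝ) : Set (ℝ × ℝ × Sph) := Icc u₀ u₁ ×ˢ Icc 0 c ×ˢ univ

/-- `K` with its first two arguments clamped to `box3`. -/
def clampTo (hu : u₀ ≤ u₁) (hc : 0 ≤ c) (K : ℝ → ℝ → Sph → ℝ) (u s : ℝ) (x : Sph) : ℝ :=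
  K (projIcc u₀ u₁ hu u) (projIcc 0 c hc s) x

theorem clampTo_eq (hu : u₀ ≤ u₁) (hc : 0 ≤ c) {u s : ℝ} (h : u ∈ Icc u₀ u₁) (hs : s ∈ Icc 0 c)
    (x : Sph) : clampTo hu hc K u s x = K u s x := by
  rw [clampTo, projIcc_of_mem hu h, projIcc_of_mem hc hs]

theorem continuous_clampTo (hu : u₀ ≤ u₁) (hc : 0 ≤ c)
    (hK : ContinuousOn (fun p : ℝ × ℝ × Sph => K p.1 p.2.1 p.2.2) (box3 u₀ u₁ c)) :
    Continuous fun p : ℝ × ℝ × Sph => clampTo hu hc K p.1 p.2.1 p.2.2 :=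
  hK.comp_continuous (f := fun p : ℝ × ℝ × Sph =>
    ((projIcc u₀ u₁ hu p.1 : ℝ), (projIcc 0 c hc p.2.1 : ℝ), p.2.2))
    (by fun_prop) fun p => ⟨Subtype.coe_prop _, Subtype.coe_prop _, mem_univ _⟩

theorem hasDerivAt_clampTo_snd {K' : ℝ → ℝ → Sph → ℝ} (hu : u₀ ≤ u₁) (hc : 0 ≤ c) {u s : ℝ}
    (h : u ∈ Icc u₀ u₁) (hs : s ∈ Ioo 0 c) {x : Sph}
    (hd : HasDerivAt (fun s => K u s x) (K' u s x) s) :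
    HasDerivAt (fun s => clampTo hu hc K u s x) (clampTo hu hc K' u s x) s := by
  rw [clampTo_eq hu hc h (Ioo_subset_Icc_self hs)]
  refine hd.congr_of_eventuallyEq ?_
  filter_upwards [Ioo_mem_nhds hs.1 hs.2] with s' hs'
  exact clampTo_eq hu hc h (Ioo_subset_Icc_self hs') x

/-- The flux inequality for a current with nonpositive divergence in the region `H ≤ s ≤ c`,
`u₀ ≤ u ≤ u₁`, where `H` exceeds `c` at `u = u₀`. -/
theorem flux_inequality {A Au As B Bs : ℝ → ℝ → Sph → ℝ}
    {Q Qr Qs : Fin 3 → ℝ → ℝ → Sph → ℝ} {d : ℝ → Sph → ℝ} {e : Fin 3 → ℝ → Sph → ℝ}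
    (hu : u₀ ≤ u₁) (hc : 0 ≤ c) (hH : Continuous fun y : ℝ × Sph => H y.1 y.2)
    (hA : ContinuousOn (fun p : ℝ × ℝ × Sph => A p.1 p.2.1 p.2.2) (box3 u₀ u₁ c))
    (hAu : ContinuousOn (fun p : ℝ × ℝ × Sph => Au p.1 p.2.1 p.2.2) (box3 u₀ u₁ c))
    (hAs : ContinuousOn (fun p : ℝ × ℝ × Sph => As p.1 p.2.1 p.2.2) (box3 u₀ u₁ c))
    (hB : ContinuousOn (fun p : ℝ × ℝ × Sph => B p.1 p.2.1 p.2.2) (box3 u₀ u₁ c))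
    (hBs : ContinuousOn (fun p : ℝ × ℝ × Sph => Bs p.1 p.2.1 p.2.2) (box3 u₀ u₁ c))
    (hQ : ∀ i, ContinuousOn (fun p : ℝ × ℝ × Sph => Q i p.1 p.2.1 p.2.2) (box3 u₀ u₁ c))
    (hQr : ∀ i, ContinuousOn (fun p : ℝ × ℝ × Sph => Qr i p.1 p.2.1 p.2.2) (box3 u₀ u₁ c))
    (hQs : ∀ i, ContinuousOn (fun p : ℝ × ℝ × Sph => Qs i p.1 p.2.1 p.2.2) (box3 u₀ u₁ c))
    (hd : Continuous fun y : ℝ × Sph => d y.1 y.2)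
    (he : ∀ i, Continuous fun y : ℝ × Sph => e i y.1 y.2)
    (hH0 : ∀ u ∈ Icc u₀ u₁, ∀ x, 0 ≤ H u x) (hHc : ∀ x, c < H u₀ x)
    (hdH : ∀ u ∈ Ioo u₀ u₁, ∀ x, 0 < H u x → HasDerivAt (fun u => H u x) (d u x) u)
    (hrH : ∀ i, ∀ u ∈ Icc u₀ u₁, ∀ x t, 0 < H u (sphRot i t x) →
      HasDerivAt (fun t => H u (sphRot i t x)) (e i u (sphRot i t x)) t)
    (hdu : ∀ u ∈ Ioo u₀ u₁, ∀ s ∈ Ioo 0 c, ∀ x, HasDerivAt (fun u => A u s x) (Au u s x) u)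
    (hAds : ∀ u ∈ Icc u₀ u₁, ∀ s ∈ Ioo 0 c, ∀ x, HasDerivAt (fun s => A u s x) (As u s x) s)
    (hBds : ∀ u ∈ Icc u₀ u₁, ∀ s ∈ Ioo 0 c, ∀ x, HasDerivAt (fun s => B u s x) (Bs u s x) s)
    (hQdr : ∀ i, ∀ u ∈ Icc u₀ u₁, ∀ s ∈ Ioo 0 c, ∀ x t,
      HasDerivAt (fun t => Q i u s (sphRot i t x)) (Qr i u s (sphRot i t x)) t)
    (hQds : ∀ i, ∀ u ∈ Icc u₀ u₁, ∀ s ∈ Ioo 0 c, ∀ x,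
      HasDerivAt (fun s => Q i u s x) (Qs i u s x) s)
    (hpos : ∀ s ∈ Icc 0 c, ∀ x, 0 ≤ A u₁ s x)
    (hbulk : ∀ u ∈ Icc u₀ u₁, ∀ s ∈ Icc 0 c, ∀ x, H u x ≤ s →
      Au u s x + Bs u s x - ∑ i, Qr i u s x ≤ 0) :
    ∫ y, (if H y.1 y.2 ≤ c then B y.1 c y.2 else 0) ∂cylIcc u₀ u₁ ≤
      ∫ y, (if H y.1 y.2 ≤ 0 then B y.1 0 y.2 else 0) ∂cylIcc u₀ u₁ +
      ∫ y, (if 0 < H y.1 y.2 ∧ H y.1 y.2 ≤ c then B y.1 (H y.1 y.2) y.2 -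
        d y.1 y.2 * A y.1 (H y.1 y.2) y.2 + ∑ i, e i y.1 y.2 * Q i y.1 (H y.1 y.2) y.2 else 0)
        ∂cylIcc u₀ u₁ := by
  -- The fields are controlled on the box only: `s / u` is singular at `u = 0`, and the coefficients
  -- are regular for `s < 1`. Clamping makes them continuous everywhere and changes nothing inside
  -- the box.
  have key := flux_inequality_of_continuous (A := clampTo hu hc A) (Au := clampTo hu hc Au)
    (As := clampTo hu hc As) (B := clampTo hu hc B) (Bs := clampTo hu hc Bs)
    (Q := fun i => clampTo hu hc (Q i)) (Qr := fun i => clampTo hu hc (Qr i))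
    (Qs := fun i => clampTo hu hc (Qs i)) hu hc hH
    (continuous_clampTo hu hc hA) (continuous_clampTo hu hc hAu) (continuous_clampTo hu hc hAs)
    (continuous_clampTo hu hc hB) (continuous_clampTo hu hc hBs)
    (fun i => continuous_clampTo hu hc (hQ i)) (fun i => continuous_clampTo hu hc (hQr i))
    (fun i => continuous_clampTo hu hc (hQs i)) hd he hH0 hHc hdH hrH
    (fun u h s hs x => by
      rw [clampTo_eq hu hc (Ioo_subset_Icc_self h) (Ioo_subset_Icc_self hs)]
      refine (hdu u h s hs x).congr_of_eventuallyEq ?_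
      filter_upwards [Ioo_mem_nhds h.1 h.2] with u' hu'
      exact clampTo_eq hu hc (Ioo_subset_Icc_self hu') (Ioo_subset_Icc_self hs) x)
    (fun u h s hs x => hasDerivAt_clampTo_snd hu hc h hs (hAds u h s hs x))
    (fun u h s hs x => hasDerivAt_clampTo_snd hu hc h hs (hBds u h s hs x))
    (fun i u h s hs x t => by
      simp only [clampTo_eq hu hc h (Ioo_subset_Icc_self hs)]
      exact hQdr i u h s hs x t)
    (fun i u h s hs x => hasDerivAt_clampTo_snd hu hc h hs (hQds i u h s hs x))
    (fun s hs x => by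
      rw [clampTo_eq hu hc (right_mem_Icc.2 hu) hs]; exact hpos s hs x)
    (fun u h s hs x hle => by
      simp only [clampTo_eq hu hc h hs]
      exact hbulk u h s hs x hle)
  have congr : ∀ {f g : ℝ × Sph → ℝ}, (∀ y : ℝ × Sph, y.1 ∈ Icc u₀ u₁ → f y = g y) →
      ∫ y, f y ∂cylIcc u₀ u₁ = ∫ y, g y ∂cylIcc u₀ u₁ := fun h => by
    refine integral_congr_ae ?_
    filter_upwards [ae_cylIcc_mem u₀ u₁] with y hy using h y hy
  refine (le_of_eq (congr fun y hy => ?_)).trans (key.trans (le_of_eq (congr_arg₂ _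
    (congr fun y hy => ?_) (congr fun y hy => ?_))))
  · rw [clampTo_eq hu hc hy (right_mem_Icc.2 hc)]
  · rw [clampTo_eq hu hc hy (left_mem_Icc.2 hc)]
  · split_ifs with h
    · simp only [clampTo_eq hu hc hy ⟨h.1.le, h.2⟩]
    · rfl

end Slab

/-! ### The causal future of a spacelike hypersurface -/

variable {Λ m : ℝ}

namespace Subextremal

theorem continuousAt_omg (h : Subextremal Λ m) {s : ℝ} (hs : s < 1) :
    ContinuousAt (omg Λ m) s := by
  obtain ⟨w, -, hw⟩ := h.exists_hasDerivAt_omg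
  exact (hw s hs).continuousAt

theorem continuousOn_omg (h : Subextremal Λ m) : ContinuousOn (omg Λ m) (Iio 1) :=
  fun _ hs => (h.continuousAt_omg hs).continuousWithinAt

/-- The straight segment at fixed `x` is causal because `-Ω² du dv ≤ 0` along it, and it stays in
the chart because the product of nonnegative increasing coordinates is largest at the end. -/
theorem causallyPrecedes_of_le (h : Subextremal Λ m) {u v u' v' : ℝ} {x : E3} (hx : ‖x‖ = 1)
    (hu : 0 ≤ u) (hv : 0 ≤ v) (huu : u ≤ u') (hvv : v ≤ v') (huv : u' * v' < 1) :
    CausallyPrecedes Λ m (u, v, x) (u', v', x) := by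
  refine ⟨fun s => (u + s * (u' - u), v + s * (v' - v), x), fun _ => (u' - u, v' - v, 0),
    by simp, by simp, continuousOn_const, fun s hs => ⟨?_, ?_⟩⟩
  · refine HasDerivAt.hasDerivWithinAt ?_
    have h1 : ∀ a b : ℝ, HasDerivAt (fun s : ℝ => a + s * b) b s := fun a b => by
      simpa using ((hasDerivAt_id s).mul_const b).const_add a
    exact (h1 _ _).prodMk ((h1 _ _).prodMk (hasDerivAt_const s x))
  · have h1 : u + s * (u' - u) ≤ u' := by nlinarith [hs.2]
    have h2 : v + s * (v' - v) ≤ v' := by nlinarith [hs.2]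
    have h3 : 0 ≤ v + s * (v' - v) := by nlinarith [hs.1]
    have h4 : (u + s * (u' - u)) * (v + s * (v' - v)) < 1 :=
      (mul_le_mul h1 h2 h3 (hu.trans huu)).trans_lt huv
    refine ⟨⟨h4, hx⟩, by simp [Tangent], ?_, sub_nonneg.2 huu, sub_nonneg.2 hvv⟩
    have h5 := h.omg_pos h4
    have h6 := mul_nonneg h5.le (mul_nonneg (sub_nonneg.2 huu) (sub_nonneg.2 hvv))
    simp only [metric, omegaSq_eq_omg, inner_zero_left, mul_zero, add_zero]
    linarith

end Subextremal

/-! ### The future of a spacelike graph is the set above it -/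

namespace Hypersurface

variable (S : Hypersurface Λ m)

/-- The candidate for the causal future of the hypersurface. -/
def region : Set Pt :=
  {p ∈ spacetime | 0 ≤ p.1 ∧ 0 ≤ p.2.1 ∧ (S.cross p.2.2 ≤ p.1 ∨ S.height (p.1, p.2.2) ≤ p.2.1)}

/-- The determinant that decides whether the differential of the height function at `(u, x)` is
that of a spacelike graph for the metric at `(u, v, x)`. -/
def tilt (p : Pt) : ℝ :=
  -(omegaSq Λ m p * fderiv ℝ S.height (p.1, p.2.2) (1, 0)) -
    omegaSq Λ m p ^ 2 / (4 * radius Λ m p ^ 2) *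
      ∑ i, fderiv ℝ S.height (p.1, p.2.2) (0, rotVec i p.2.2) ^ 2

/-- For `u` beyond the crossing the curve starts where `Σ` meets `C⁺`; otherwise it rises in `v`
from the point of the graph with the same `u` and `x`. -/
theorem region_subset_causalFuture (h : Subextremal Λ m) :
    S.region ⊆ causalFuture Λ m S.carrier := by
  rintro ⟨u, v, x⟩ ⟨⟨huv, hx⟩, hu, hv, hor⟩
  simp only at huv hx hu hv hor
  rcases le_or_gt (S.cross x) u with hc | hc
  · refine ⟨(S.cross x, 0, x), ⟨hx, (S.cross_pos x hx).le, le_rfl, (S.height_cross x hx).symm⟩,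
      h.causallyPrecedes_of_le hx (S.cross_pos x hx).le le_rfl hc hv huv⟩
  · have hh : S.height (u, x) ≤ v := hor.resolve_left (not_le.2 hc)
    exact ⟨(u, S.height (u, x), x), ⟨hx, hu, hc.le, rfl⟩,
      h.causallyPrecedes_of_le hx hu (S.height_pos x hx u hu hc).le le_rfl hh huv⟩

theorem differentiable_height : Differentiable ℝ S.height :=
  S.smooth.differentiable (by simp)

theorem continuous_fderiv_height : Continuous (fderiv ℝ S.height) :=
  S.smooth.continuous_fderiv (by simp)

/-- The derivative of the height function along the sphere, as a linear functional. -/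
def angularDeriv (u : ℝ) (x : E3) : E3 →ₗ[ℝ] ℝ :=
  (fderiv ℝ S.height (u, x)).toLinearMap ∘ₗ LinearMap.inr ℝ ℝ E3

theorem angularDeriv_apply (u : ℝ) (x w : E3) :
    S.angularDeriv u x w = fderiv ℝ S.height (u, x) (0, w) := rfl

theorem fderiv_height_eq (u : ℝ) (x : E3) (a : ℝ) (w : E3) :
    fderiv ℝ S.height (u, x) (a, w) =
      a * fderiv ℝ S.height (u, x) (1, 0) + S.angularDeriv u x w := by
  rw [angularDeriv_apply, ← smul_eq_mul, ← map_smul, ← map_add]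
  simp

/-- Among tangent vectors of `Σ` with `∂_u` component `1`, the induced metric is smallest on the one
whose angular part is `Ω² / (2 r²)` times the angular gradient of the height. The minimum is `tilt`.
-/
theorem tilt_pos (h : Subextremal Λ m) {p : Pt} (hp : p ∈ S.carrier) : 0 < S.tilt p := by
  obtain ⟨u, v, x⟩ := p
  obtain ⟨hx, hu, huc, hv⟩ := hp
  simp only at hx hu huc hv
  subst hv
  have hlt := S.in_chart x hx u hu huc
  have hr := h.rad_pos hlt
  set o := omg Λ m (u * S.height (u, x)) with hω
  set r := rad Λ m (u * S.height (u, x)) with hr'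
  set L := S.angularDeriv u x with hL
  set z := ∑ i, L (rotVec i x) • rotVec i x with hz
  have hz2 : ‖z‖ ^ 2 = ∑ i, L (rotVec i x) ^ 2 := norm_sq_sum_smul_rotVec L hx
  have hLz : L z = ∑ i, L (rotVec i x) ^ 2 := by
    rw [hz, map_sum]; simp [sq]
  have hzx : inner ℝ z x = 0 := inner_sum_smul_rotVec x _
  have := S.spacelike x hx u hu huc 1 ((o / (2 * r ^ 2)) • z)
    (by rw [inner_smul_left, hzx, mul_zero]) (by simp)
  rw [fderiv_height_eq] at this
  simp only [metric, omegaSq_eq_omg, radius_eq_rad, ← hω, ← hr', ← hL, map_smul, smul_eq_mul,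
    hLz, inner_smul_left, inner_smul_right, real_inner_self_eq_norm_sq, hz2, one_mul, mul_one,
    conj_trivial] at this
  simp only [tilt, omegaSq_eq_omg, radius_eq_rad, ← hω, ← hr', ← angularDeriv_apply, ← hL]
  refine this.trans_eq ?_
  field_simp
  ring

/-- The angular term enters `tilt` with a minus sign, so only the `∂_u` term can make it positive.
-/
theorem fderiv_height_neg_of_tilt_pos (h : Subextremal Λ m) {p : Pt} (hs : p.1 * p.2.1 < 1)
    (hp : 0 < S.tilt p) : fderiv ℝ S.height (p.1, p.2.2) (1, 0) < 0 := by
  have hω := h.omg_pos hs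
  have : 0 ≤ omegaSq Λ m p ^ 2 / (4 * radius Λ m p ^ 2) *
      ∑ i, fderiv ℝ S.height (p.1, p.2.2) (0, rotVec i p.2.2) ^ 2 := by positivity
  rw [tilt] at hp
  have h2 : omegaSq Λ m p * fderiv ℝ S.height (p.1, p.2.2) (1, 0) < 0 := by linarith
  by_contra hcon
  exact absurd h2 (not_lt.2 (mul_nonneg hω.le (not_lt.1 hcon)))

/-- Where the graph of the height function is spacelike, causal curves cross it upwards. -/
theorem fderiv_height_le_of_causal (h : Subextremal Λ m) {p X : Pt} (hp : p ∈ spacetime)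
    (ht : 0 < S.tilt p) (hX : FutureCausal Λ m p X) :
    fderiv ℝ S.height (p.1, p.2.2) (X.1, X.2.2) ≤ X.2.1 := by
  obtain ⟨u, v, x⟩ := p
  obtain ⟨a, b, w⟩ := X
  obtain ⟨hs, hx⟩ := hp
  obtain ⟨hT, hm, ha, hb⟩ := hX
  simp only [Tangent] at hs hx hT ha hb ⊢
  have hω := h.omg_pos hs
  have hr := h.rad_pos hs
  simp only [metric, omegaSq_eq_omg, radius_eq_rad, real_inner_self_eq_norm_sq] at hm
  simp only [tilt, omegaSq_eq_omg, radius_eq_rad, ← angularDeriv_apply] at ht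
  rw [fderiv_height_eq]
  have hL := sq_le_norm_sq_mul_sum_rotVec (S.angularDeriv u x) hx hT
  generalize hRe : ∑ i, S.angularDeriv u x (rotVec i x) ^ 2 = R at hL ht
  generalize S.angularDeriv u x w = l at hL ⊢
  generalize omg Λ m (u * v) = o at hω ht hm
  generalize rad Λ m (u * v) = r at hr ht hm
  generalize fderiv ℝ S.height (u, x) (1, 0) = k at ht ⊢
  generalize ‖w‖ = n at hm hL
  -- Write `(a, b, w)` for the causal vector. If `b` were smaller than the derivative of the height,
  -- causality would give `e1`; Cauchy-Schwarz and the weighted arithmetic-geometric mean inequality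
  -- (`e2`) turn this into `a² · 4 r² · tilt ≤ 0`. Hence `a = 0`, then `w = 0`, and finally `b < 0`,
  -- a contradiction.
  by_contra! hcon
  have hR : 0 ≤ R := by
    rw [← hRe]; exact Finset.sum_nonneg fun i _ => sq_nonneg _
  have e1 : r ^ 2 * n ^ 2 ≤ o * a * (a * k + l) := by
    have : o * a * b ≤ o * a * (a * k + l) := by gcongr
    linarith
  have e2 : 4 * r ^ 2 * (o * a * l) ≤ 4 * r ^ 4 * n ^ 2 + o ^ 2 * a ^ 2 * R := by
    rcases hR.eq_or_lt with h0 | h0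
    · rw [← h0, mul_zero] at hL
      have : l = 0 := by nlinarith
      rw [this, mul_zero, mul_zero]; positivity
    · have h1 : (2 * r ^ 2) * (o * a) * l * (2 * R) ≤
          (2 * r ^ 2) ^ 2 * l ^ 2 + (o * a * R) ^ 2 := by
        nlinarith [sq_nonneg (2 * r ^ 2 * l - o * a * R)]
      have h2 : (2 * r ^ 2) ^ 2 * l ^ 2 ≤ (2 * r ^ 2) ^ 2 * (n ^ 2 * R) := by gcongr
      have h3 : R * (4 * r ^ 2 * (o * a * l)) ≤
          R * (4 * r ^ 4 * n ^ 2 + o ^ 2 * a ^ 2 * R) := by linarith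
      exact le_of_mul_le_mul_left h3 h0
  have e3 : a ^ 2 * (4 * r ^ 2 * (-(o * k) - o ^ 2 / (4 * r ^ 2) * R)) ≤ 0 := by
    have : 4 * r ^ 2 * (-(o * k) - o ^ 2 / (4 * r ^ 2) * R) =
        -(4 * r ^ 2 * o * k) - o ^ 2 * R := by field_simp
    rw [this]
    nlinarith [mul_le_mul_of_nonneg_left e1 (by positivity : 0 ≤ 4 * r ^ 2)]
  have ha0 : a = 0 := by
    by_contra hne
    have : 0 < a ^ 2 := by positivity
    have : 0 < a ^ 2 * (4 * r ^ 2 * (-(o * k) - o ^ 2 / (4 * r ^ 2) * R)) := by positivity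
    linarith
  rw [ha0] at e1 hcon
  have hn : n ^ 2 = 0 := by
    have h1 : r ^ 2 * n ^ 2 ≤ 0 := by simpa using e1
    have h2 : 0 < r ^ 2 := by positivity
    nlinarith [sq_nonneg n]
  rw [hn, zero_mul] at hL
  have : l = 0 := by nlinarith
  rw [this] at hcon
  linarith

theorem continuousAt_tilt (h : Subextremal Λ m) {p : Pt} (hp : p.1 * p.2.1 < 1) :
    ContinuousAt S.tilt p := by
  have c0 : ContinuousAt (fun p : Pt => p.1 * p.2.1) p := by fun_prop
  have c1 : ContinuousAt (omegaSq Λ m) p :=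
    ContinuousAt.comp (f := fun p : Pt => p.1 * p.2.1) (h.continuousAt_omg hp) c0
  have c2 : ContinuousAt (radius Λ m) p :=
    ContinuousAt.comp (f := fun p : Pt => p.1 * p.2.1) (h.continuousAt_rad hp) c0
  have c3 : Continuous fun p : Pt => fderiv ℝ S.height (p.1, p.2.2) :=
    S.continuous_fderiv_height.comp (by fun_prop)
  have c4 : Continuous fun p : Pt => fderiv ℝ S.height (p.1, p.2.2) (1, 0) :=
    c3.clm_apply continuous_const
  have c5 : ∀ i, Continuous fun p : Pt =>
      fderiv ℝ S.height (p.1, p.2.2) (0, rotVec i p.2.2) ^ 2 := fun i =>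
    (c3.clm_apply (continuous_const.prodMk ((continuous_rotVec i).comp (by fun_prop)))).pow 2
  have hr := h.rad_pos hp
  unfold tilt
  refine ((c1.mul c4.continuousAt).neg).sub (((c1.pow 2).div
    (continuousAt_const.mul (c2.pow 2)) ?_).mul
    (continuous_finsetSum _ fun i _ => c5 i).continuousAt)
  have : 0 < 4 * rad Λ m (p.1 * p.2.1) ^ 2 := by positivity
  exact this.ne'

theorem height_continuous : Continuous S.height := S.smooth.continuous

open Filter Topology in
-- From below: the height is positive on a compact interval before the crossing, and this persists
-- for nearby `x`. From above: the height is strictly decreasing in `u` at the crossing, hence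
-- negative at some `u` just beyond it. This persists too, and it forces the crossing of nearby
-- fibres to come before that `u`.
theorem continuousOn_cross (h : Subextremal Λ m) :
    ContinuousOn S.cross (Metric.sphere 0 1) := by
  intro x₀ hx₀
  have hn : ‖x₀‖ = 1 := mem_sphere_zero_iff_norm.1 hx₀
  have hpos := S.cross_pos x₀ hn
  refine tendsto_order.2 ⟨fun a ha => ?_, fun b hb => ?_⟩
  · have hK : ∀ u ∈ Icc 0 a, ∀ᶠ z : E3 × ℝ in 𝓝 (x₀, u), 0 < S.height (z.2, z.1) := by
      intro u hu
      have hc : Continuous fun z : E3 × ℝ => S.height (z.2, z.1) :=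
        S.height_continuous.comp (by fun_prop)
      exact hc.continuousAt.eventually (lt_mem_nhds
        (S.height_pos x₀ hn u hu.1 (hu.2.trans_lt ha)))
    have hev := isCompact_Icc.eventually_forall_of_forall_eventually
      (P := fun x u => 0 < S.height (u, x)) hK
    filter_upwards [mem_nhdsWithin_of_mem_nhds hev, self_mem_nhdsWithin] with x hx hxs
    have hxn : ‖x‖ = 1 := mem_sphere_zero_iff_norm.1 hxs
    by_contra! hle
    have := hx (S.cross x) ⟨(S.cross_pos x hxn).le, hle⟩
    simp only [S.height_cross x hxn] at this
    exact lt_irrefl _ this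
  · have hmem : (S.cross x₀, (0 : ℝ), x₀) ∈ S.carrier :=
      ⟨hn, hpos.le, le_rfl, (S.height_cross x₀ hn).symm⟩
    have hk := S.fderiv_height_neg_of_tilt_pos h (p := (S.cross x₀, (0 : ℝ), x₀)) (by simp)
      (S.tilt_pos h hmem)
    simp only at hk
    have hd : HasDerivAt (fun u => S.height (u, x₀))
        (fderiv ℝ S.height (S.cross x₀, x₀) (1, 0)) (S.cross x₀) :=
      (S.differentiable_height _).hasFDerivAt.comp_hasDerivAt (f := fun u => (u, x₀)) _
        ((hasDerivAt_id _).prodMk (hasDerivAt_const _ _))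
    have hs : Tendsto (slope (fun u => S.height (u, x₀)) (S.cross x₀)) (𝓝[>] (S.cross x₀))
        (𝓝 (fderiv ℝ S.height (S.cross x₀, x₀) (1, 0))) :=
      hd.tendsto_slope.mono_left (nhdsWithin_mono _ fun u hu => ne_of_gt hu)
    obtain ⟨u, h1, h2⟩ := ((hs.eventually_lt_const hk).and
      (Ioo_mem_nhdsGT hb : Ioo (S.cross x₀) b ∈ 𝓝[>] (S.cross x₀))).exists
    have h3 : S.height (u, x₀) < 0 := by
      rw [slope_def_field, S.height_cross x₀ hn, sub_zero] at h1
      exact (div_neg_iff.1 h1).resolve_left (fun h => by linarith [h.2, h2.1]) |>.1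
    have hc : Continuous fun x => S.height (u, x) := S.height_continuous.comp (by fun_prop)
    filter_upwards [mem_nhdsWithin_of_mem_nhds (hc.continuousAt.eventually (gt_mem_nhds h3)),
      self_mem_nhdsWithin] with x hx hxs
    have hxn : ‖x‖ = 1 := mem_sphere_zero_iff_norm.1 hxs
    by_contra! hle
    exact lt_asymm hx (S.height_pos x hxn u (hpos.trans h2.1).le (h2.2.trans_le hle))

theorem continuous_cross (h : Subextremal Λ m) : Continuous fun x : Sph => S.cross x :=
  (S.continuousOn_cross h).comp_continuous continuous_subtype_val fun x => x.2

open Filter Topology in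
-- A curve ending outside has a last time `σ` at which it satisfies the condition defining the
-- region. It is then on `Σ`, near which `v - height` is nondecreasing along causal curves, so it
-- cannot drop below the graph afterwards.
theorem causalFuture_subset_region (h : Subextremal Λ m) :
    causalFuture Λ m S.carrier ⊆ S.region := by
  rintro q ⟨p, hp, γ, γ', h0, h1, -, hγ⟩
  have hd : ∀ s ∈ Icc (0 : ℝ) 1, HasDerivWithinAt γ (γ' s) (Icc 0 1) s := fun s hs => (hγ s hs).1
  have hsp : ∀ s ∈ Icc (0 : ℝ) 1, γ s ∈ spacetime := fun s hs => (hγ s hs).2.1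
  have hfc : ∀ s ∈ Icc (0 : ℝ) 1, FutureCausal Λ m (γ s) (γ' s) := fun s hs => (hγ s hs).2.2
  have hcont : ContinuousOn γ (Icc 0 1) := fun s hs => (hd s hs).continuousWithinAt
  have hin : ∀ s ∈ Ioo (0 : ℝ) 1, HasDerivAt γ (γ' s) s := fun s hs =>
    (hd s (Ioo_subset_Icc_self hs)).hasDerivAt (Icc_mem_nhds hs.1 hs.2)
  have d1 : ∀ s ∈ Ioo (0 : ℝ) 1, HasDerivAt (fun s => (γ s).1) (γ' s).1 s := fun s hs =>
    (hin s hs).fst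
  have d2 : ∀ s ∈ Ioo (0 : ℝ) 1, HasDerivAt (fun s => (γ s).2.1) (γ' s).2.1 s := fun s hs =>
    (hin s hs).snd.fst
  have d3 : ∀ s ∈ Ioo (0 : ℝ) 1, HasDerivAt (fun s => (γ s).2.2) (γ' s).2.2 s := fun s hs =>
    (hin s hs).snd.snd
  have c1 : ContinuousOn (fun s => (γ s).1) (Icc 0 1) := continuous_fst.comp_continuousOn hcont
  have c2 : ContinuousOn (fun s => (γ s).2.1) (Icc 0 1) :=
    (continuous_fst.comp continuous_snd).comp_continuousOn hcont
  have c3 : ContinuousOn (fun s => (γ s).2.2) (Icc 0 1) :=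
    (continuous_snd.comp continuous_snd).comp_continuousOn hcont
  have m1 : MonotoneOn (fun s => (γ s).1) (Icc 0 1) := by
    refine monotoneOn_of_deriv_nonneg (convex_Icc 0 1) c1 ?_ ?_ <;> rw [interior_Icc] <;>
      intro s hs
    · exact (d1 s hs).differentiableAt.differentiableWithinAt
    · rw [(d1 s hs).deriv]; exact (hfc s (Ioo_subset_Icc_self hs)).2.2.1
  have m2 : MonotoneOn (fun s => (γ s).2.1) (Icc 0 1) := by
    refine monotoneOn_of_deriv_nonneg (convex_Icc 0 1) c2 ?_ ?_ <;> rw [interior_Icc] <;>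
      intro s hs
    · exact (d2 s hs).differentiableAt.differentiableWithinAt
    · rw [(d2 s hs).deriv]; exact (hfc s (Ioo_subset_Icc_self hs)).2.2.2
  obtain ⟨hx, hu0, huc, hv⟩ := hp
  have hv0 : 0 ≤ p.2.1 := by
    rw [hv]
    rcases huc.eq_or_lt with he | hlt
    · rw [he, S.height_cross _ hx]
    · exact (S.height_pos _ hx _ hu0 hlt).le
  have z0 : (0 : ℝ) ∈ Icc (0 : ℝ) 1 := by simp
  have z1 : (1 : ℝ) ∈ Icc (0 : ℝ) 1 := by simp
  have hu : ∀ s ∈ Icc (0 : ℝ) 1, 0 ≤ (γ s).1 := fun s hs => by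
    refine le_trans ?_ (m1 z0 hs hs.1)
    simp only [h0]; exact hu0
  have hvn : ∀ s ∈ Icc (0 : ℝ) 1, 0 ≤ (γ s).2.1 := fun s hs => by
    refine le_trans ?_ (m2 z0 hs hs.1)
    simp only [h0]; exact hv0
  set f : ℝ → ℝ := fun s => min (S.cross (γ s).2.2 - (γ s).1)
    (S.height ((γ s).1, (γ s).2.2) - (γ s).2.1) with hf
  have cf1 : ContinuousOn (fun s => S.cross (γ s).2.2 - (γ s).1) (Icc 0 1) :=
    ((S.continuousOn_cross h).comp c3 fun s hs => mem_sphere_zero_iff_norm.2 (hsp s hs).2).sub c1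
  have cf2 : ContinuousOn (fun s => S.height ((γ s).1, (γ s).2.2) - (γ s).2.1) (Icc 0 1) :=
    (S.height_continuous.comp_continuousOn (c1.prodMk c3)).sub c2
  have cf : ContinuousOn f (Icc 0 1) := cf1.inf cf2
  have hq : q = γ 1 := h1.symm
  rw [hq]
  refine ⟨hsp 1 z1, hu 1 z1, hvn 1 z1, ?_⟩
  by_contra hcon
  push Not at hcon
  have hf1 : 0 < f 1 := lt_min (sub_pos.2 hcon.1) (sub_pos.2 hcon.2)
  set T : Set ℝ := {s ∈ Icc (0 : ℝ) 1 | f s ≤ 0} with hT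
  have hTc : IsCompact T := isCompact_Icc.of_isClosed_subset
    (isClosed_Icc.isClosed_le cf continuousOn_const) fun s hs => hs.1
  have hT0 : (0 : ℝ) ∈ T := by
    refine ⟨z0, min_le_of_right_le ?_⟩
    simp only [h0, hv, sub_self, le_refl]
  set σ := sSup T with hσ
  have hσT : σ ∈ T := hTc.sSup_mem ⟨0, hT0⟩
  have hσ1 : σ < 1 := lt_of_le_of_ne hσT.1.2 fun he => by
    have := hσT.2; rw [he] at this; linarith
  have hafter : ∀ s ∈ Ioc σ 1, 0 < f s := by
    intro s hs
    by_contra! hle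
    exact absurd (le_csSup hTc.bddAbove (show s ∈ T from ⟨⟨hσT.1.1.trans hs.1.le, hs.2⟩, hle⟩))
      (not_le.2 hs.1)
  have hfσ : 0 ≤ f σ := by
    have hne : (𝓝[>] σ).NeBot := inferInstance
    have ht : Tendsto f (𝓝[>] σ) (𝓝 (f σ)) := by
      refine (cf σ hσT.1).mono_left ?_
      refine nhdsWithin_le_iff.2 ?_
      filter_upwards [Ioo_mem_nhdsGT hσ1] with s hs using
        ⟨hσT.1.1.trans hs.1.le, hs.2.le⟩
    refine ge_of_tendsto ht ?_
    filter_upwards [Ioo_mem_nhdsGT hσ1] with s hs using (hafter s ⟨hs.1, hs.2.le⟩).le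
  obtain ⟨g1, g2⟩ := le_min_iff.1 hfσ
  have hxσ := (hsp σ hσT.1).2
  -- Leaving through `u = cross` is no exception: the height is `0` there, so `0 ≤ v ≤ height`
  -- forces `v = 0` and the point is again on `Σ`.
  have hhv : S.height ((γ σ).1, (γ σ).2.2) = (γ σ).2.1 := by
    rcases min_le_iff.1 hσT.2 with hle | hle
    · have he : (γ σ).1 = S.cross (γ σ).2.2 := by linarith
      have := hvn σ hσT.1
      rw [he, S.height_cross _ hxσ] at g2 ⊢
      linarith
    · linarith
  have hcar : γ σ ∈ S.carrier := ⟨hxσ, hu σ hσT.1, by linarith, hhv.symm⟩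
  -- Spacelikeness is known on `Σ` only. By continuity `tilt` remains positive along the curve for a
  -- short time after `σ`, which is long enough for the contradiction.
  have htc : ContinuousOn (fun s => S.tilt (γ s)) (Icc 0 1) := fun s hs =>
    (S.continuousAt_tilt h (hsp s hs).1).comp_continuousWithinAt (hcont s hs)
  have hev : ∀ᶠ s in 𝓝[Icc 0 1] σ, 0 < S.tilt (γ s) :=
    (htc σ hσT.1).eventually (lt_mem_nhds (S.tilt_pos h hcar))
  obtain ⟨ε, hε, hball⟩ := Metric.mem_nhdsWithin_iff.1 hev
  set b := min 1 (σ + ε / 2) with hb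
  have hσb : σ < b := lt_min hσ1 (by linarith)
  have hb1 : b ≤ 1 := min_le_left _ _
  have hsub : Icc σ b ⊆ Icc 0 1 := Icc_subset_Icc hσT.1.1 hb1
  have hk : MonotoneOn (fun s => (γ s).2.1 - S.height ((γ s).1, (γ s).2.2)) (Icc σ b) := by
    have hder : ∀ s ∈ Ioo σ b, HasDerivAt (fun s => (γ s).2.1 - S.height ((γ s).1, (γ s).2.2))
        ((γ' s).2.1 - fderiv ℝ S.height ((γ s).1, (γ s).2.2) ((γ' s).1, (γ' s).2.2)) s := by
      intro s hs
      have hs' : s ∈ Ioo (0 : ℝ) 1 := ⟨hσT.1.1.trans_lt hs.1, hs.2.trans_le hb1⟩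
      exact (d2 s hs').sub ((S.differentiable_height _).hasFDerivAt.comp_hasDerivAt s
        ((d1 s hs').prodMk (d3 s hs')))
    refine monotoneOn_of_deriv_nonneg (convex_Icc σ b)
      (c2.sub (S.height_continuous.comp_continuousOn (c1.prodMk c3)) |>.mono hsub) ?_ ?_ <;>
      rw [interior_Icc] <;> intro s hs
    · exact (hder s hs).differentiableAt.differentiableWithinAt
    · rw [(hder s hs).deriv]
      have hs' := hsub (Ioo_subset_Icc_self hs)
      refine sub_nonneg.2 (S.fderiv_height_le_of_causal h (hsp s hs') (hball ⟨?_, hs'⟩)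
        (hfc s hs'))
      have : s < σ + ε / 2 := hs.2.trans_le (min_le_right _ _)
      rw [Metric.mem_ball, Real.dist_eq, abs_of_pos (sub_pos.2 hs.1)]
      linarith
  have h5 := hk (left_mem_Icc.2 hσb.le) (right_mem_Icc.2 hσb.le) hσb.le
  have h6 := (lt_min_iff.1 (hafter b ⟨hσb, hb1⟩)).2
  simp only [hhv] at h5
  linarith

theorem causalFuture_eq_region (h : Subextremal Λ m) :
    causalFuture Λ m S.carrier = S.region :=
  (S.causalFuture_subset_region h).antisymm (S.region_subset_causalFuture h)

end Hypersurface

/-! ### The energy current in the coordinates `(u, s, x)`, `s = u v` -/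

/-- The point with coordinates `u`, `s = u v` and `x`. -/
def cylPt (u s : ℝ) (x : Sph) : Pt := (u, s / u, (x : E3))

/-- The second derivative. -/
def sec (ψ : Pt → ℝ) (p X Y : Pt) : ℝ := fderiv ℝ (fderiv ℝ ψ) p X Y

section Derivatives

variable {ψ : Pt → ℝ}

theorem hasDerivAt_fderiv_comp (hψ : ContDiff ℝ 2 ψ) {c X : ℝ → Pt} {c' X' : Pt} {t : ℝ}
    (hc : HasDerivAt c c' t) (hX : HasDerivAt X X' t) :
    HasDerivAt (fun t => fderiv ℝ ψ (c t) (X t))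
      (sec ψ (c t) c' (X t) + fderiv ℝ ψ (c t) X') t := by
  have h1 : DifferentiableAt ℝ (fderiv ℝ ψ) (c t) :=
    (hψ.fderiv_right (m := 1) (by norm_num)).differentiable (by norm_num) _
  exact (h1.hasFDerivAt.comp_hasDerivAt t hc).clm_apply hX

theorem sec_comm (hψ : ContDiff ℝ 2 ψ) (p X Y : Pt) : sec ψ p X Y = sec ψ p Y X :=
  (hψ.contDiffAt.isSymmSndFDerivAt (by simp)).eq X Y

theorem continuous_sec (hψ : ContDiff ℝ 2 ψ) : Continuous fun p => fderiv ℝ (fderiv ℝ ψ) p :=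
  (hψ.fderiv_right (m := 1) (by norm_num)).continuous_fderiv (by norm_num)

theorem continuous_fderiv_of_contDiff (hψ : ContDiff ℝ 2 ψ) : Continuous fun p => fderiv ℝ ψ p :=
  hψ.continuous_fderiv (by norm_num)

theorem sec_smul_left (p X Y : Pt) (k : ℝ) : sec ψ p (k • X) Y = k * sec ψ p X Y := by
  simp [sec]

theorem sec_add_left (p X X' Y : Pt) : sec ψ p (X + X') Y = sec ψ p X Y + sec ψ p X' Y := by
  simp [sec]

end Derivatives

/-- First and second derivatives of `ψ` along the coordinate fields and the rotation fields. -/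
def pU (ψ : Pt → ℝ) (u s : ℝ) (x : Sph) : ℝ := fderiv ℝ ψ (cylPt u s x) (1, 0, 0)

def pV (ψ : Pt → ℝ) (u s : ℝ) (x : Sph) : ℝ := fderiv ℝ ψ (cylPt u s x) (0, 1, 0)

def pR (ψ : Pt → ℝ) (i : Fin 3) (u s : ℝ) (x : Sph) : ℝ :=
  fderiv ℝ ψ (cylPt u s x) (0, 0, rotVec i x)

def sUV (ψ : Pt → ℝ) (u s : ℝ) (x : Sph) : ℝ := sec ψ (cylPt u s x) (0, 1, 0) (1, 0, 0)

def sVV (ψ : Pt → ℝ) (u s : ℝ) (x : Sph) : ℝ := sec ψ (cylPt u s x) (0, 1, 0) (0, 1, 0)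

def sRU (ψ : Pt → ℝ) (i : Fin 3) (u s : ℝ) (x : Sph) : ℝ :=
  sec ψ (cylPt u s x) (0, 0, rotVec i x) (1, 0, 0)

def sRV (ψ : Pt → ℝ) (i : Fin 3) (u s : ℝ) (x : Sph) : ℝ :=
  sec ψ (cylPt u s x) (0, 0, rotVec i x) (0, 1, 0)

def sRR (ψ : Pt → ℝ) (i : Fin 3) (u s : ℝ) (x : Sph) : ℝ :=
  sec ψ (cylPt u s x) (0, 0, rotVec i x) (0, 0, rotVec i x) +
    fderiv ℝ ψ (cylPt u s x) (0, 0, rotVec i (rotVec i x))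

section Curves

theorem hasDerivAt_cylPt_fst {u : ℝ} (hu : u ≠ 0) (s : ℝ) (x : Sph) :
    HasDerivAt (fun u => cylPt u s x)
      ((1 : ℝ) • ((1, 0, 0) : Pt) + (-(s / u ^ 2)) • ((0, 1, 0) : Pt)) u := by
  have h : HasDerivAt (fun u : ℝ => s / u) (-(s / u ^ 2)) u := by
    have := (hasDerivAt_inv hu).const_mul s
    simpa only [div_eq_mul_inv, mul_neg] using this
  refine ((hasDerivAt_id u).prodMk (h.prodMk (hasDerivAt_const u (x : E3)))).congr_deriv ?_
  simp

theorem hasDerivAt_cylPt_snd (u s : ℝ) (x : Sph) :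
    HasDerivAt (fun s => cylPt u s x) ((1 / u) • ((0, 1, 0) : Pt)) s := by
  refine ((hasDerivAt_const s u).prodMk (((hasDerivAt_id s).div_const u).prodMk
    (hasDerivAt_const s (x : E3)))).congr_deriv ?_
  simp

theorem hasDerivAt_cylPt_rot (i : Fin 3) (u s : ℝ) (x : Sph) (t : ℝ) :
    HasDerivAt (fun t => cylPt u s (sphRot i t x)) ((0, 0, rotVec i (sphRot i t x)) : Pt) t :=
  (hasDerivAt_const t u).prodMk ((hasDerivAt_const t (s / u)).prodMk (hasDerivAt_rotMap i t x))

theorem hasDerivAt_rotVec_rot (i : Fin 3) (x : Sph) (t : ℝ) :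
    HasDerivAt (fun t => ((0, 0, rotVec i (sphRot i t x)) : Pt))
      ((0, 0, rotVec i (rotVec i (sphRot i t x))) : Pt) t :=
  (hasDerivAt_const t 0).prodMk ((hasDerivAt_const t 0).prodMk
    ((rotLin i).hasFDerivAt.comp_hasDerivAt t (hasDerivAt_rotMap i t x)))

variable {ψ : Pt → ℝ} (hψ : ContDiff ℝ 2 ψ) {u : ℝ} (s : ℝ) (x : Sph) (i : Fin 3)

include hψ

theorem hasDerivAt_pV_fst (hu : u ≠ 0) : HasDerivAt (fun u => pV ψ u s x)
    (sUV ψ u s x - s / u ^ 2 * sVV ψ u s x) u :=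
  (hasDerivAt_fderiv_comp hψ (hasDerivAt_cylPt_fst hu s x) (hasDerivAt_const u _)).congr_deriv (by
    rw [sec_add_left, sec_smul_left, sec_smul_left, map_zero, sVV, sUV,
      sec_comm hψ _ (1, 0, 0) (0, 1, 0)]
    ring)

theorem hasDerivAt_pR_fst (hu : u ≠ 0) : HasDerivAt (fun u => pR ψ i u s x)
    (sRU ψ i u s x - s / u ^ 2 * sRV ψ i u s x) u :=
  (hasDerivAt_fderiv_comp hψ (hasDerivAt_cylPt_fst hu s x) (hasDerivAt_const u _)).congr_deriv (by
    rw [sec_add_left, sec_smul_left, sec_smul_left, map_zero, sRU, sRV,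
      sec_comm hψ _ (0, 0, rotVec i x) (1, 0, 0), sec_comm hψ _ (0, 0, rotVec i x) (0, 1, 0)]
    ring)

theorem hasDerivAt_pU_snd : HasDerivAt (fun s => pU ψ u s x) (sUV ψ u s x / u) s :=
  (hasDerivAt_fderiv_comp hψ (hasDerivAt_cylPt_snd u s x) (hasDerivAt_const s _)).congr_deriv (by
    rw [sec_smul_left, map_zero, sUV]; ring)

theorem hasDerivAt_pV_snd : HasDerivAt (fun s => pV ψ u s x) (sVV ψ u s x / u) s :=
  (hasDerivAt_fderiv_comp hψ (hasDerivAt_cylPt_snd u s x) (hasDerivAt_const s _)).congr_deriv (by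
    rw [sec_smul_left, map_zero, sVV]; ring)

theorem hasDerivAt_pR_snd : HasDerivAt (fun s => pR ψ i u s x) (sRV ψ i u s x / u) s :=
  (hasDerivAt_fderiv_comp hψ (hasDerivAt_cylPt_snd u s x) (hasDerivAt_const s _)).congr_deriv (by
    rw [sec_smul_left, map_zero, sRV, sec_comm hψ _ (0, 0, rotVec i x) (0, 1, 0)]; ring)

theorem hasDerivAt_pU_rot (t : ℝ) : HasDerivAt (fun t => pU ψ u s (sphRot i t x))
    (sRU ψ i u s (sphRot i t x)) t :=
  (hasDerivAt_fderiv_comp hψ (hasDerivAt_cylPt_rot i u s x t)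
    (hasDerivAt_const t _)).congr_deriv (by rw [map_zero, add_zero, sRU])

theorem hasDerivAt_pV_rot (t : ℝ) : HasDerivAt (fun t => pV ψ u s (sphRot i t x))
    (sRV ψ i u s (sphRot i t x)) t :=
  (hasDerivAt_fderiv_comp hψ (hasDerivAt_cylPt_rot i u s x t)
    (hasDerivAt_const t _)).congr_deriv (by rw [map_zero, add_zero, sRV])

theorem hasDerivAt_pR_rot (t : ℝ) : HasDerivAt (fun t => pR ψ i u s (sphRot i t x))
    (sRR ψ i u s (sphRot i t x)) t :=
  hasDerivAt_fderiv_comp hψ (hasDerivAt_cylPt_rot i u s x t) (hasDerivAt_rotVec_rot i x t)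

end Curves

section Continuity

variable {ψ : Pt → ℝ} (hψ : ContDiff ℝ 2 ψ) (i : Fin 3) {u₀ u₁ c : ℝ} (hu₀ : 0 < u₀)

include hu₀ in
theorem ne_zero_of_mem_box3 {p : ℝ × ℝ × Sph} (hp : p ∈ box3 u₀ u₁ c) : p.1 ≠ 0 :=
  (hu₀.trans_le hp.1.1).ne'

include hu₀ in
theorem continuousOn_cylPt :
    ContinuousOn (fun p : ℝ × ℝ × Sph => cylPt p.1 p.2.1 p.2.2) (box3 u₀ u₁ c) := by
  refine continuousOn_fst.prodMk (ContinuousOn.prodMk ?_ ?_)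
  · exact (continuous_fst.comp continuous_snd).continuousOn.div continuousOn_fst
      fun p hp => ne_zero_of_mem_box3 hu₀ hp
  · exact (continuous_subtype_val.comp (continuous_snd.comp continuous_snd)).continuousOn

include hψ hu₀

theorem continuousOn_fderiv_cyl {X : ℝ × ℝ × Sph → Pt} (hX : Continuous X) :
    ContinuousOn (fun p : ℝ × ℝ × Sph => fderiv ℝ ψ (cylPt p.1 p.2.1 p.2.2) (X p))
      (box3 u₀ u₁ c) :=
  ((continuous_fderiv_of_contDiff hψ).comp_continuousOn (continuousOn_cylPt hu₀)).clm_apply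
    hX.continuousOn

theorem continuousOn_sec_cyl {X Y : ℝ × ℝ × Sph → Pt} (hX : Continuous X) (hY : Continuous Y) :
    ContinuousOn (fun p : ℝ × ℝ × Sph => sec ψ (cylPt p.1 p.2.1 p.2.2) (X p) (Y p))
      (box3 u₀ u₁ c) :=
  (((continuous_sec hψ).comp_continuousOn (continuousOn_cylPt hu₀)).clm_apply
    hX.continuousOn).clm_apply hY.continuousOn

omit hψ hu₀ in
theorem continuous_rotField : Continuous fun p : ℝ × ℝ × Sph => ((0, 0, rotVec i p.2.2) : Pt) :=
  continuous_const.prodMk (continuous_const.prodMk ((continuous_rotVec i).comp (by fun_prop)))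

theorem continuousOn_pU :
    ContinuousOn (fun p : ℝ × ℝ × Sph => pU ψ p.1 p.2.1 p.2.2) (box3 u₀ u₁ c) :=
  continuousOn_fderiv_cyl hψ hu₀ continuous_const

theorem continuousOn_pV :
    ContinuousOn (fun p : ℝ × ℝ × Sph => pV ψ p.1 p.2.1 p.2.2) (box3 u₀ u₁ c) :=
  continuousOn_fderiv_cyl hψ hu₀ continuous_const

theorem continuousOn_pR :
    ContinuousOn (fun p : ℝ × ℝ × Sph => pR ψ i p.1 p.2.1 p.2.2) (box3 u₀ u₁ c) :=
  continuousOn_fderiv_cyl hψ hu₀ (continuous_rotField i)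

theorem continuousOn_sUV :
    ContinuousOn (fun p : ℝ × ℝ × Sph => sUV ψ p.1 p.2.1 p.2.2) (box3 u₀ u₁ c) :=
  continuousOn_sec_cyl hψ hu₀ continuous_const continuous_const

theorem continuousOn_sVV :
    ContinuousOn (fun p : ℝ × ℝ × Sph => sVV ψ p.1 p.2.1 p.2.2) (box3 u₀ u₁ c) :=
  continuousOn_sec_cyl hψ hu₀ continuous_const continuous_const

theorem continuousOn_sRU :
    ContinuousOn (fun p : ℝ × ℝ × Sph => sRU ψ i p.1 p.2.1 p.2.2) (box3 u₀ u₁ c) :=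
  continuousOn_sec_cyl hψ hu₀ (continuous_rotField i) continuous_const

theorem continuousOn_sRV :
    ContinuousOn (fun p : ℝ × ℝ × Sph => sRV ψ i p.1 p.2.1 p.2.2) (box3 u₀ u₁ c) :=
  continuousOn_sec_cyl hψ hu₀ (continuous_rotField i) continuous_const

theorem continuousOn_sRR :
    ContinuousOn (fun p : ℝ × ℝ × Sph => sRR ψ i p.1 p.2.1 p.2.2) (box3 u₀ u₁ c) :=
  (continuousOn_sec_cyl hψ hu₀ (continuous_rotField i) (continuous_rotField i)).add
    (continuousOn_fderiv_cyl hψ hu₀ (continuous_const.prodMk (continuous_const.prodMk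
      ((continuous_rotVec i).comp ((continuous_rotVec i).comp (by fun_prop))))))

end Continuity

theorem hasDerivAt_sum_sq {f f' : Fin 3 → ℝ → ℝ} {t : ℝ}
    (h : ∀ i, HasDerivAt (f i) (f' i t) t) :
    HasDerivAt (fun t => ∑ i, f i t ^ 2) (∑ i, 2 * f i t * f' i t) t :=
  HasDerivAt.fun_sum fun i _ => ((h i).pow 2).congr_deriv (by simp)

/-! ### The components of the energy current and its divergence -/

section Current

variable (a b a' b' : ℝ → ℝ) (ψ : Pt → ℝ)

/-- The components of the energy current of a multiplier `E(s) (u ∂_u + u⁻¹ ∂_v)`, where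
`a = E r²`, `b = E Ω² / 4`, and their derivatives. -/
def fluxU (u s : ℝ) (x : Sph) : ℝ :=
  b s * ∑ i, pR ψ i u s x ^ 2 + a s * (pV ψ u s x ^ 2 / u ^ 2)

def fluxU_u (u s : ℝ) (x : Sph) : ℝ :=
  b s * ∑ i, 2 * pR ψ i u s x * (sRU ψ i u s x - s / u ^ 2 * sRV ψ i u s x) +
    a s * (2 * pV ψ u s x * (sUV ψ u s x - s / u ^ 2 * sVV ψ u s x) / u ^ 2 -
      2 * pV ψ u s x ^ 2 / u ^ 3)

def fluxU_s (u s : ℝ) (x : Sph) : ℝ :=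
  b' s * ∑ i, pR ψ i u s x ^ 2 + b s * ∑ i, 2 * pR ψ i u s x * (sRV ψ i u s x / u) +
    (a' s * (pV ψ u s x ^ 2 / u ^ 2) + a s * (2 * pV ψ u s x * (sVV ψ u s x / u) / u ^ 2))

/-- The `s`-component of `-J`, that is `v` times its `u`-component plus `u` times its `v`-component,
with the volume density `(Ω² / 2) r²` divided by the Jacobian `u` of `(u, v) ↦ (u, s)`. -/
def fluxS (u s : ℝ) (x : Sph) : ℝ :=
  a s * (u * pU ψ u s x ^ 2 + s * pV ψ u s x ^ 2 / u ^ 3) +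
    (1 + s) * b s * (∑ i, pR ψ i u s x ^ 2) / u

def fluxS_s (u s : ℝ) (x : Sph) : ℝ :=
  a' s * (u * pU ψ u s x ^ 2 + s * pV ψ u s x ^ 2 / u ^ 3) +
    a s * (2 * u * pU ψ u s x * (sUV ψ u s x / u) + (pV ψ u s x ^ 2 +
      2 * s * pV ψ u s x * (sVV ψ u s x / u)) / u ^ 3) +
    ((b s + (1 + s) * b' s) * ∑ i, pR ψ i u s x ^ 2 +
      (1 + s) * b s * ∑ i, 2 * pR ψ i u s x * (sRV ψ i u s x / u)) / u

/-- The angular components belong to `J`, whereas `fluxU` and `fluxS` belong to `-J`; hence the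
minus sign before the rotation derivatives in the divergence. -/
def fluxR (i : Fin 3) (u s : ℝ) (x : Sph) : ℝ :=
  2 * b s * ((pU ψ u s x + pV ψ u s x / u ^ 2) * pR ψ i u s x)

def fluxR_r (i : Fin 3) (u s : ℝ) (x : Sph) : ℝ :=
  2 * b s * ((sRU ψ i u s x + sRV ψ i u s x / u ^ 2) * pR ψ i u s x +
    (pU ψ u s x + pV ψ u s x / u ^ 2) * sRR ψ i u s x)

def fluxR_s (i : Fin 3) (u s : ℝ) (x : Sph) : ℝ :=
  2 * b' s * ((pU ψ u s x + pV ψ u s x / u ^ 2) * pR ψ i u s x) +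
    2 * b s * ((sUV ψ u s x / u + sVV ψ u s x / u / u ^ 2) * pR ψ i u s x +
      (pU ψ u s x + pV ψ u s x / u ^ 2) * (sRV ψ i u s x / u))

/-- The second derivatives `sVV`, `sRU` and `sRV` cancel, leaving just the combination of `sUV` and
`sRR` that the wave equation evaluates. The term `-a (∂_v ψ / u)²` comes from the explicit powers of
`u`, not from derivatives of the coefficients: it is the redshift term. -/
theorem divergence_eq {u : ℝ} (hu : u ≠ 0) (s : ℝ) (x : Sph) :
    u * (fluxU_u a b ψ u s x + fluxS_s a b a' b' ψ u s x - ∑ i, fluxR_r b ψ i u s x) =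
      u * (pU ψ u s x + pV ψ u s x / u ^ 2) *
        (2 * a s * sUV ψ u s x - 2 * b s * ∑ i, sRR ψ i u s x) +
      a' s * ((u * pU ψ u s x) ^ 2 + s * (pV ψ u s x / u) ^ 2) -
      a s * (pV ψ u s x / u) ^ 2 + (b s + (1 + s) * b' s) * ∑ i, pR ψ i u s x ^ 2 := by
  simp only [fluxU_u, fluxS_s, fluxR_r, Fin.sum_univ_three]
  field_simp
  ring

variable {a b a' b' ψ} (hψ : ContDiff ℝ 2 ψ)

include hψ

theorem hasDerivAt_fluxU_fst {u : ℝ} (hu : u ≠ 0) (s : ℝ) (x : Sph) :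
    HasDerivAt (fun u => fluxU a b ψ u s x) (fluxU_u a b ψ u s x) u := by
  have h1 := hasDerivAt_sum_sq (f := fun i u => pR ψ i u s x)
    (f' := fun i u => sRU ψ i u s x - s / u ^ 2 * sRV ψ i u s x) (t := u)
    fun i => hasDerivAt_pR_fst hψ s x i hu
  have h2 := ((hasDerivAt_pV_fst hψ s x hu).pow 2).div (hasDerivAt_pow 2 u) (pow_ne_zero 2 hu)
  refine ((h1.const_mul (b s)).add (h2.const_mul (a s))).congr_deriv ?_
  simp only [fluxU_u, Pi.pow_apply]
  congr 2
  push_cast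
  field_simp

theorem hasDerivAt_fluxU_snd {u : ℝ} {s : ℝ} (x : Sph) (ha : HasDerivAt a (a' s) s)
    (hb : HasDerivAt b (b' s) s) :
    HasDerivAt (fun s => fluxU a b ψ u s x) (fluxU_s a b a' b' ψ u s x) s := by
  have h1 := hasDerivAt_sum_sq (f := fun i s => pR ψ i u s x)
    (f' := fun i s => sRV ψ i u s x / u) (t := s) fun i => hasDerivAt_pR_snd hψ s x i
  have h2 := ((hasDerivAt_pV_snd hψ (u := u) s x).pow 2).div_const (u ^ 2)
  refine ((hb.mul h1).add (ha.mul h2)).congr_deriv ?_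
  simp [fluxU_s]

theorem hasDerivAt_fluxS_snd {u : ℝ} {s : ℝ} (x : Sph) (ha : HasDerivAt a (a' s) s)
    (hb : HasDerivAt b (b' s) s) :
    HasDerivAt (fun s => fluxS a b ψ u s x) (fluxS_s a b a' b' ψ u s x) s := by
  have h1 := hasDerivAt_sum_sq (f := fun i s => pR ψ i u s x)
    (f' := fun i s => sRV ψ i u s x / u) (t := s) fun i => hasDerivAt_pR_snd hψ s x i
  have h2 := ((hasDerivAt_id s).mul ((hasDerivAt_pV_snd hψ (u := u) s x).pow 2)).div_const (u ^ 3)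
  have h3 := ((hasDerivAt_pU_snd hψ (u := u) s x).pow 2).const_mul u
  refine ((ha.mul (h3.add h2)).add (((((hasDerivAt_id s).const_add 1).mul hb).mul
    h1).div_const u)).congr_deriv ?_
  simp only [fluxS_s, Pi.mul_apply, Pi.pow_apply, Pi.add_apply, id]
  push_cast
  ring

theorem hasDerivAt_fluxR_snd (i : Fin 3) {u : ℝ} {s : ℝ} (x : Sph) (hb : HasDerivAt b (b' s) s) :
    HasDerivAt (fun s => fluxR b ψ i u s x) (fluxR_s b b' ψ i u s x) s := by
  have h1 := (hasDerivAt_pU_snd hψ (u := u) s x).add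
    ((hasDerivAt_pV_snd hψ (u := u) s x).div_const (u ^ 2))
  refine ((hb.const_mul 2).mul (h1.mul (hasDerivAt_pR_snd hψ s x i))).congr_deriv ?_
  simp [fluxR_s]

theorem hasDerivAt_fluxR_rot (i : Fin 3) (u s : ℝ) (x : Sph) (t : ℝ) :
    HasDerivAt (fun t => fluxR b ψ i u s (sphRot i t x)) (fluxR_r b ψ i u s (sphRot i t x)) t := by
  have h1 := (hasDerivAt_pU_rot hψ (u := u) s x i t).add
    ((hasDerivAt_pV_rot hψ (u := u) s x i t).div_const (u ^ 2))
  refine ((h1.mul (hasDerivAt_pR_rot hψ s x i t)).const_mul (2 * b s)).congr_deriv ?_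
  simp [fluxR_r]

section ContinuityOfFluxes

variable {u₀ u₁ c : ℝ} (hu₀ : 0 < u₀)

omit hψ in
theorem continuousOn_coeff (ha : ContinuousOn a (Icc 0 c)) :
    ContinuousOn (fun p : ℝ × ℝ × Sph => a p.2.1) (box3 u₀ u₁ c) :=
  ha.comp (f := fun p : ℝ × ℝ × Sph => p.2.1) (by fun_prop) fun _ hp => hp.2.1

include hu₀

theorem continuousOn_sum_pR_sq :
    ContinuousOn (fun p : ℝ × ℝ × Sph => ∑ i, pR ψ i p.1 p.2.1 p.2.2 ^ 2) (box3 u₀ u₁ c) :=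
  continuousOn_finsetSum _ fun i _ => (continuousOn_pR hψ i hu₀).pow 2

theorem continuousOn_sum_pR_sRV :
    ContinuousOn (fun p : ℝ × ℝ × Sph => ∑ i, 2 * pR ψ i p.1 p.2.1 p.2.2 *
      (sRV ψ i p.1 p.2.1 p.2.2 / p.1)) (box3 u₀ u₁ c) :=
  continuousOn_finsetSum _ fun i _ => (continuousOn_const.mul (continuousOn_pR hψ i hu₀)).mul
    ((continuousOn_sRV hψ i hu₀).div continuousOn_fst fun _ hp => ne_zero_of_mem_box3 hu₀ hp)

theorem continuousOn_fluxU (ha : ContinuousOn a (Icc 0 c)) (hb : ContinuousOn b (Icc 0 c)) :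
    ContinuousOn (fun p : ℝ × ℝ × Sph => fluxU a b ψ p.1 p.2.1 p.2.2) (box3 u₀ u₁ c) :=
  ((continuousOn_coeff hb).mul (continuousOn_sum_pR_sq hψ hu₀)).add ((continuousOn_coeff ha).mul
    (((continuousOn_pV hψ hu₀).pow 2).div (continuousOn_fst.pow 2)
      fun _ hp => pow_ne_zero 2 (ne_zero_of_mem_box3 hu₀ hp)))

theorem continuousOn_fluxU_u (ha : ContinuousOn a (Icc 0 c)) (hb : ContinuousOn b (Icc 0 c)) :
    ContinuousOn (fun p : ℝ × ℝ × Sph => fluxU_u a b ψ p.1 p.2.1 p.2.2) (box3 u₀ u₁ c) := by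
  have hne : ∀ n : ℕ, ∀ p ∈ box3 u₀ u₁ c, p.1 ^ n ≠ 0 := fun n _ hp =>
    pow_ne_zero n (ne_zero_of_mem_box3 hu₀ hp)
  have hs : ContinuousOn (fun p : ℝ × ℝ × Sph => p.2.1 / p.1 ^ 2) (box3 u₀ u₁ c) :=
    ContinuousOn.div (by fun_prop) (continuousOn_fst.pow 2) (hne 2)
  have hV := continuousOn_pV (u₁ := u₁) (c := c) hψ hu₀
  have h2 : ContinuousOn (fun _ : ℝ × ℝ × Sph => (2 : ℝ)) (box3 u₀ u₁ c) := continuousOn_const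
  exact ((continuousOn_coeff hb).mul (continuousOn_finsetSum _ fun i _ =>
    (h2.mul (continuousOn_pR hψ i hu₀)).mul ((continuousOn_sRU hψ i hu₀).sub
      (hs.mul (continuousOn_sRV hψ i hu₀))))).add ((continuousOn_coeff ha).mul
    ((((h2.mul hV).mul ((continuousOn_sUV hψ hu₀).sub (hs.mul (continuousOn_sVV hψ hu₀)))).div
      (continuousOn_fst.pow 2) (hne 2)).sub ((h2.mul (hV.pow 2)).div (continuousOn_fst.pow 3)
      (hne 3))))

theorem continuousOn_fluxU_s (ha : ContinuousOn a (Icc 0 c)) (hb : ContinuousOn b (Icc 0 c))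
    (ha' : ContinuousOn a' (Icc 0 c)) (hb' : ContinuousOn b' (Icc 0 c)) :
    ContinuousOn (fun p : ℝ × ℝ × Sph => fluxU_s a b a' b' ψ p.1 p.2.1 p.2.2)
      (box3 u₀ u₁ c) := by
  have hne : ∀ n : ℕ, ∀ p ∈ box3 u₀ u₁ c, p.1 ^ n ≠ 0 := fun n _ hp =>
    pow_ne_zero n (ne_zero_of_mem_box3 hu₀ hp)
  have hV := continuousOn_pV (u₁ := u₁) (c := c) hψ hu₀
  have h2 : ContinuousOn (fun _ : ℝ × ℝ × Sph => (2 : ℝ)) (box3 u₀ u₁ c) := continuousOn_const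
  exact (((continuousOn_coeff hb').mul (continuousOn_sum_pR_sq hψ hu₀)).add
    ((continuousOn_coeff hb).mul (continuousOn_sum_pR_sRV hψ hu₀))).add
    (((continuousOn_coeff ha').mul ((hV.pow 2).div (continuousOn_fst.pow 2) (hne 2))).add
      ((continuousOn_coeff ha).mul (((h2.mul hV).mul ((continuousOn_sVV hψ hu₀).div continuousOn_fst
        fun _ hp => ne_zero_of_mem_box3 hu₀ hp)).div (continuousOn_fst.pow 2) (hne 2))))

theorem continuousOn_fluxS (ha : ContinuousOn a (Icc 0 c)) (hb : ContinuousOn b (Icc 0 c)) :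
    ContinuousOn (fun p : ℝ × ℝ × Sph => fluxS a b ψ p.1 p.2.1 p.2.2) (box3 u₀ u₁ c) := by
  have hs : ContinuousOn (fun p : ℝ × ℝ × Sph => p.2.1) (box3 u₀ u₁ c) := by fun_prop
  exact ((continuousOn_coeff ha).mul ((continuousOn_fst.mul ((continuousOn_pU hψ hu₀).pow 2)).add
    ((hs.mul ((continuousOn_pV hψ hu₀).pow 2)).div (continuousOn_fst.pow 3)
      fun _ hp => pow_ne_zero 3 (ne_zero_of_mem_box3 hu₀ hp)))).add
    ((((continuousOn_const.add hs).mul (continuousOn_coeff hb)).mul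
      (continuousOn_sum_pR_sq hψ hu₀)).div continuousOn_fst
        fun _ hp => ne_zero_of_mem_box3 hu₀ hp)

theorem continuousOn_fluxS_s (ha : ContinuousOn a (Icc 0 c)) (hb : ContinuousOn b (Icc 0 c))
    (ha' : ContinuousOn a' (Icc 0 c)) (hb' : ContinuousOn b' (Icc 0 c)) :
    ContinuousOn (fun p : ℝ × ℝ × Sph => fluxS_s a b a' b' ψ p.1 p.2.1 p.2.2)
      (box3 u₀ u₁ c) := by
  have hs : ContinuousOn (fun p : ℝ × ℝ × Sph => p.2.1) (box3 u₀ u₁ c) := by fun_prop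
  have hne1 : ∀ p ∈ box3 u₀ u₁ c, p.1 ≠ 0 := fun _ hp => ne_zero_of_mem_box3 hu₀ hp
  have hne : ∀ p ∈ box3 u₀ u₁ c, p.1 ^ 3 ≠ 0 := fun _ hp =>
    pow_ne_zero 3 (ne_zero_of_mem_box3 hu₀ hp)
  have hU := continuousOn_pU (u₁ := u₁) (c := c) hψ hu₀
  have hV := continuousOn_pV (u₁ := u₁) (c := c) hψ hu₀
  have h2 : ContinuousOn (fun _ : ℝ × ℝ × Sph => (2 : ℝ)) (box3 u₀ u₁ c) := continuousOn_const
  have h1 : ContinuousOn (fun _ : ℝ × ℝ × Sph => (1 : ℝ)) (box3 u₀ u₁ c) := continuousOn_const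
  exact (((continuousOn_coeff ha').mul ((continuousOn_fst.mul (hU.pow 2)).add
    ((hs.mul (hV.pow 2)).div (continuousOn_fst.pow 3) hne))).add ((continuousOn_coeff ha).mul
      ((((h2.mul continuousOn_fst).mul hU).mul ((continuousOn_sUV hψ hu₀).div continuousOn_fst
        hne1)).add (((hV.pow 2).add (((h2.mul hs).mul hV).mul ((continuousOn_sVV hψ hu₀).div
        continuousOn_fst hne1))).div (continuousOn_fst.pow 3) hne)))).add
    (((((continuousOn_coeff hb).add ((h1.add hs).mul (continuousOn_coeff hb'))).mul
      (continuousOn_sum_pR_sq hψ hu₀)).add (((h1.add hs).mul (continuousOn_coeff hb)).mul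
      (continuousOn_sum_pR_sRV hψ hu₀))).div continuousOn_fst hne1)

theorem continuousOn_fluxR (i : Fin 3) (hb : ContinuousOn b (Icc 0 c)) :
    ContinuousOn (fun p : ℝ × ℝ × Sph => fluxR b ψ i p.1 p.2.1 p.2.2) (box3 u₀ u₁ c) :=
  (continuousOn_const.mul (continuousOn_coeff hb)).mul
    (((continuousOn_pU hψ hu₀).add ((continuousOn_pV hψ hu₀).div (continuousOn_fst.pow 2)
      fun _ hp => pow_ne_zero 2 (ne_zero_of_mem_box3 hu₀ hp))).mul (continuousOn_pR hψ i hu₀))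

theorem continuousOn_fluxR_r (i : Fin 3) (hb : ContinuousOn b (Icc 0 c)) :
    ContinuousOn (fun p : ℝ × ℝ × Sph => fluxR_r b ψ i p.1 p.2.1 p.2.2) (box3 u₀ u₁ c) := by
  have hne : ∀ p ∈ box3 u₀ u₁ c, p.1 ^ 2 ≠ 0 := fun _ hp =>
    pow_ne_zero 2 (ne_zero_of_mem_box3 hu₀ hp)
  exact (continuousOn_const.mul (continuousOn_coeff hb)).mul
    ((((continuousOn_sRU hψ i hu₀).add ((continuousOn_sRV hψ i hu₀).div (continuousOn_fst.pow 2)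
      hne)).mul (continuousOn_pR hψ i hu₀)).add
    (((continuousOn_pU hψ hu₀).add ((continuousOn_pV hψ hu₀).div (continuousOn_fst.pow 2)
      hne)).mul (continuousOn_sRR hψ i hu₀)))

theorem continuousOn_fluxR_s (i : Fin 3) (hb : ContinuousOn b (Icc 0 c))
    (hb' : ContinuousOn b' (Icc 0 c)) :
    ContinuousOn (fun p : ℝ × ℝ × Sph => fluxR_s b b' ψ i p.1 p.2.1 p.2.2) (box3 u₀ u₁ c) := by
  have hne1 : ∀ p ∈ box3 u₀ u₁ c, p.1 ≠ 0 := fun _ hp => ne_zero_of_mem_box3 hu₀ hp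
  have hne : ∀ p ∈ box3 u₀ u₁ c, p.1 ^ 2 ≠ 0 := fun _ hp =>
    pow_ne_zero 2 (ne_zero_of_mem_box3 hu₀ hp)
  have hw := (continuousOn_pU (u₁ := u₁) (c := c) hψ hu₀).add ((continuousOn_pV hψ hu₀).div
    (continuousOn_fst.pow 2) hne)
  exact ((continuousOn_const.mul (continuousOn_coeff hb')).mul
    (hw.mul (continuousOn_pR hψ i hu₀))).add ((continuousOn_const.mul (continuousOn_coeff hb)).mul
    (((((continuousOn_sUV hψ hu₀).div continuousOn_fst hne1).add (((continuousOn_sVV hψ hu₀).div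
      continuousOn_fst hne1).div (continuousOn_fst.pow 2) hne)).mul
      (continuousOn_pR hψ i hu₀)).add
      (hw.mul ((continuousOn_sRV hψ i hu₀).div continuousOn_fst hne1))))

end ContinuityOfFluxes

end Current

variable {Λ m : ℝ}

/-! ### The wave equation in the coordinates `(u, s, x)` -/

theorem fderiv_eq_of_hasDerivAt_line {f : Pt → ℝ} {p X : Pt} {d : ℝ}
    (hf : DifferentiableAt ℝ f p) (hd : HasDerivAt (fun t : ℝ => f (p + t • X)) d 0) :
    fderiv ℝ f p X = d := by
  have hl : HasDerivAt (fun t : ℝ => p + t • X) ((1 : ℝ) • X) 0 :=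
    ((hasDerivAt_id (0 : ℝ)).smul_const X).const_add p
  rw [one_smul] at hl
  have hf' : HasFDerivAt f (fderiv ℝ f p) (p + (0 : ℝ) • X) := by
    rw [zero_smul, add_zero]; exact hf.hasFDerivAt
  exact (hf'.comp_hasDerivAt 0 hl).unique hd

section Wave

variable {ψ : Pt → ℝ} (hψ : ContDiff ℝ 2 ψ)

include hψ

theorem differentiableAt_fderiv_apply {X : Pt → Pt} {p : Pt} (hX : DifferentiableAt ℝ X p) :
    DifferentiableAt ℝ (fun q => fderiv ℝ ψ q (X q)) p :=
  ((hψ.fderiv_right (m := 1) (by norm_num)).differentiable (by norm_num) p).clm_apply hX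

theorem hasDerivAt_fderiv_line {p X Y Y' : Pt} {Z : Pt → Pt}
    (hZ : HasDerivAt (fun t : ℝ => Z (p + t • X)) Y' 0) (hY : Z p = Y) :
    HasDerivAt (fun t : ℝ => fderiv ℝ ψ (p + t • X) (Z (p + t • X)))
      (sec ψ p X Y + fderiv ℝ ψ p Y') 0 := by
  have hl : HasDerivAt (fun t : ℝ => p + t • X) ((1 : ℝ) • X) 0 :=
    ((hasDerivAt_id (0 : ℝ)).smul_const X).const_add p
  rw [one_smul] at hl
  have := hasDerivAt_fderiv_comp hψ hl hZ
  simpa only [zero_smul, add_zero, hY] using this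

/-- In the ambient space the rotation field is linear, so the outer derivative may be taken along a
straight line off the sphere; the variation of the field itself gives the first-order term of `sRR`.
-/
theorem rot_rot_eq (i : Fin 3) (u s : ℝ) (x : Sph) :
    rot i (rot i ψ) (cylPt u s x) = sRR ψ i u s x := by
  have hX : DifferentiableAt ℝ (fun q : Pt => ((0, 0, rotLin i q.2.2) : Pt)) (cylPt u s x) := by
    fun_prop
  refine fderiv_eq_of_hasDerivAt_line (differentiableAt_fderiv_apply hψ hX) ?_
  refine hasDerivAt_fderiv_line hψ (p := cylPt u s x)
    (Z := fun q => ((0, 0, rotLin i q.2.2) : Pt)) ?_ rfl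
  refine (hasDerivAt_const (0 : ℝ) (0 : ℝ)).prodMk ((hasDerivAt_const (0 : ℝ) (0 : ℝ)).prodMk ?_)
  have hl : HasDerivAt (fun t : ℝ => (x : E3) + t • rotVec i x) ((1 : ℝ) • rotVec i x) 0 :=
    ((hasDerivAt_id (0 : ℝ)).smul_const (rotVec i x)).const_add (x : E3)
  rw [one_smul] at hl
  exact (rotLin i).hasFDerivAt.comp_hasDerivAt 0 hl

theorem fderiv_radius_sq_mul (h : Subextremal Λ m) {p X Y : Pt} (hp : p.1 * p.2.1 < 1) :
    fderiv ℝ (fun q => -(radius Λ m q ^ 2 * fderiv ℝ ψ q Y)) p X =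
      -(2 * radius Λ m p * (Subextremal.radDeriv Λ m (p.1 * p.2.1) *
        (X.1 * p.2.1 + p.1 * X.2.1)) * fderiv ℝ ψ p Y + radius Λ m p ^ 2 * sec ψ p X Y) := by
  have hr : HasDerivAt (rad Λ m) (Subextremal.radDeriv Λ m (p.1 * p.2.1)) (p.1 * p.2.1) :=
    h.hasDerivAt_rad hp
  have hdiff : DifferentiableAt ℝ (fun q => -(radius Λ m q ^ 2 * fderiv ℝ ψ q Y)) p := by
    have h1 : DifferentiableAt ℝ (radius Λ m) p :=
      DifferentiableAt.comp (f := fun q : Pt => q.1 * q.2.1) p hr.differentiableAt (by fun_prop)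
    exact ((h1.pow 2).mul (differentiableAt_fderiv_apply hψ (differentiableAt_const Y))).neg
  refine fderiv_eq_of_hasDerivAt_line hdiff ?_
  have h1 : HasDerivAt (fun t : ℝ => (p + t • X).1 * (p + t • X).2.1)
      (X.1 * p.2.1 + p.1 * X.2.1) 0 := by
    have e : ∀ a b : ℝ, HasDerivAt (fun t : ℝ => a + t * b) b 0 := fun a b => by
      simpa using ((hasDerivAt_id (0 : ℝ)).mul_const b).const_add a
    refine ((e p.1 X.1).mul (e p.2.1 X.2.1)).congr_deriv ?_
    simp
  have hr' : HasDerivAt (rad Λ m) (Subextremal.radDeriv Λ m (p.1 * p.2.1))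
      ((p + (0 : ℝ) • X).1 * (p + (0 : ℝ) • X).2.1) := by
    rw [zero_smul, add_zero]; exact hr
  have h2 := HasDerivAt.comp (0 : ℝ) (h := fun t : ℝ => (p + t • X).1 * (p + t • X).2.1) hr' h1
  have h3 := hasDerivAt_fderiv_line hψ (p := p) (X := X) (Z := fun _ => Y)
    (hasDerivAt_const (0 : ℝ) Y) rfl
  refine ((h2.pow 2).mul h3).neg.congr_deriv ?_
  simp only [Function.comp_apply, Pi.pow_apply, zero_smul, add_zero, map_zero, radius_eq_rad]
  push_cast
  ring

/-- The wave equation at the point with coordinates `u`, `s = u v` and `x`. -/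
theorem wave_eq_of_box_eq_zero (h : Subextremal Λ m) {u s : ℝ} (hu : u ≠ 0) (hs : s < 1) (x : Sph)
    (hbox : box Λ m ψ (cylPt u s x) = 0) :
    2 * rad Λ m s ^ 2 * sUV ψ u s x + 2 * rad Λ m s * Subextremal.radDeriv Λ m s *
        (s / u * pV ψ u s x + u * pU ψ u s x) = omg Λ m s / 2 * ∑ i, sRR ψ i u s x := by
  have hus : u * (s / u) = s := by field_simp
  have hp : (cylPt u s x).1 * (cylPt u s x).2.1 = s := hus
  have e1 := fderiv_radius_sq_mul hψ h (p := cylPt u s x) (X := (1, 0, 0)) (Y := (0, 1, 0))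
    (hp.trans_lt hs)
  have e2 := fderiv_radius_sq_mul hψ h (p := cylPt u s x) (X := (0, 1, 0)) (Y := (1, 0, 0))
    (hp.trans_lt hs)
  rw [sec_comm hψ _ (1, 0, 0) (0, 1, 0)] at e1
  rw [radius_eq_rad, hp] at e1 e2
  simp only [box, rot_rot_eq hψ, du, dv] at hbox
  rw [e1, e2, omegaSq_eq_omg, radius_eq_rad, hp] at hbox
  have hω := h.omg_pos hs
  have hr := h.rad_pos hs
  have hx : (cylPt u s x).1 = u := rfl
  have hy : (cylPt u s x).2.1 = s / u := rfl
  change 2 / (omg Λ m s * rad Λ m s ^ 2) *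
    (-((2 * rad Λ m s * (Subextremal.radDeriv Λ m s * (1 * (cylPt u s x).2.1 +
          (cylPt u s x).1 * 0))) * pV ψ u s x + rad Λ m s ^ 2 * sUV ψ u s x) +
      -((2 * rad Λ m s * (Subextremal.radDeriv Λ m s * (0 * (cylPt u s x).2.1 +
          (cylPt u s x).1 * 1))) * pU ψ u s x + rad Λ m s ^ 2 * sUV ψ u s x)) +
    1 / rad Λ m s ^ 2 * ∑ i, sRR ψ i u s x = 0 at hbox
  rw [hx, hy] at hbox
  generalize (∑ i, sRR ψ i u s x) = R at hbox ⊢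
  generalize s / u = w at hbox ⊢
  field_simp at hbox
  linarith

end Wave

/-! ### The redshift multiplier -/

/-- The coefficients of the energy current of `(1 - K u v) (u ∂_u + u⁻¹ ∂_v)`. -/
def coefA (Λ m K s : ℝ) : ℝ := (1 - K * s) * rad Λ m s ^ 2

def coefA' (Λ m K s : ℝ) : ℝ :=
  -K * rad Λ m s ^ 2 + (1 - K * s) * (2 * rad Λ m s * Subextremal.radDeriv Λ m s)

def coefB (Λ m K s : ℝ) : ℝ := (1 - K * s) * omg Λ m s / 4

def coefB' (Λ m K s : ℝ) : ℝ :=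
  (-K * omg Λ m s + (1 - K * s) * deriv (omg Λ m) s) / 4

namespace Subextremal

theorem hasDerivAt_omg (h : Subextremal Λ m) {s : ℝ} (hs : s < 1) :
    HasDerivAt (omg Λ m) (deriv (omg Λ m) s) s := by
  obtain ⟨w, -, hw⟩ := h.exists_hasDerivAt_omg
  exact (hw s hs).differentiableAt.hasDerivAt

theorem continuousOn_deriv_omg (h : Subextremal Λ m) :
    ContinuousOn (deriv (omg Λ m)) (Iio 1) := by
  obtain ⟨w, hc, hw⟩ := h.exists_hasDerivAt_omg
  exact hc.congr fun s hs => (hw s hs).deriv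

theorem hasDerivAt_coefA (h : Subextremal Λ m) (K : ℝ) {s : ℝ} (hs : s < 1) :
    HasDerivAt (coefA Λ m K) (coefA' Λ m K s) s := by
  refine ((((hasDerivAt_id s).const_mul K).const_sub 1).mul
    ((h.hasDerivAt_rad hs).pow 2)).congr_deriv ?_
  simp [coefA', radDeriv]

theorem hasDerivAt_coefB (h : Subextremal Λ m) (K : ℝ) {s : ℝ} (hs : s < 1) :
    HasDerivAt (coefB Λ m K) (coefB' Λ m K s) s := by
  refine (((((hasDerivAt_id s).const_mul K).const_sub 1).mul
    (h.hasDerivAt_omg hs)).div_const 4).congr_deriv ?_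
  simp [coefB']

theorem continuousOn_coefA (h : Subextremal Λ m) (K : ℝ) : ContinuousOn (coefA Λ m K) (Iio 1) :=
  fun _ hs => (h.hasDerivAt_coefA K hs).continuousAt.continuousWithinAt

theorem continuousOn_coefB (h : Subextremal Λ m) (K : ℝ) : ContinuousOn (coefB Λ m K) (Iio 1) :=
  fun _ hs => (h.hasDerivAt_coefB K hs).continuousAt.continuousWithinAt

theorem continuousOn_coefA' (h : Subextremal Λ m) (K : ℝ) :
    ContinuousOn (coefA' Λ m K) (Iio 1) := by
  have h1 := h.continuousOn_rad
  have h2 := h.continuousOn_radDeriv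
  unfold coefA'
  fun_prop

theorem continuousOn_coefB' (h : Subextremal Λ m) (K : ℝ) :
    ContinuousOn (coefB' Λ m K) (Iio 1) := by
  have h1 := h.continuousOn_omg
  have h2 := h.continuousOn_deriv_omg
  unfold coefB'
  fun_prop

/-- The constants of the redshift multiplier. -/
theorem exists_redshift_constants (h : Subextremal Λ m) :
    ∃ K ε : ℝ, 0 < K ∧ 0 < ε ∧ ε < 1 ∧ K * ε ≤ 1 / 2 ∧ ∀ s ∈ Icc 0 ε,
      (2 * rad Λ m s * radDeriv Λ m s) ^ 2 ≤ K * (rad Λ m s ^ 2) ^ 2 ∧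
      omg Λ m s + 2 * |deriv (omg Λ m) s| ≤ K * omg Λ m s := by
  have hsub : Icc (0 : ℝ) (1 / 2) ⊆ Iio 1 := fun s hs => by
    have := hs.2
    simp only [mem_Iio]; linarith
  have c1 : ContinuousOn (fun s => (2 * rad Λ m s * radDeriv Λ m s) ^ 2 / (rad Λ m s ^ 2) ^ 2)
      (Icc 0 (1 / 2)) := by
    have h1 := h.continuousOn_rad.mono hsub
    have h2 := h.continuousOn_radDeriv.mono hsub
    refine ContinuousOn.div (by fun_prop) (by fun_prop) fun s hs => ?_
    have := h.rad_pos (hsub hs)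
    positivity
  have c2 : ContinuousOn (fun s => (omg Λ m s + 2 * |deriv (omg Λ m) s|) / omg Λ m s)
      (Icc 0 (1 / 2)) := by
    have h1 := h.continuousOn_omg.mono hsub
    have h2 := h.continuousOn_deriv_omg.mono hsub
    refine ContinuousOn.div (by fun_prop) h1 fun s hs => (h.omg_pos (hsub hs)).ne'
  obtain ⟨K₁, hK₁⟩ := isCompact_Icc.bddAbove_image c1
  obtain ⟨K₂, hK₂⟩ := isCompact_Icc.bddAbove_image c2
  -- `K` dominates both continuous ratios on `[0, 1/2]`. The choice `ε = 1 / (2 K)` then keeps `1 -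
  -- K s ≥ 1/2`, and `K ≥ 1` keeps `ε` inside the interval.
  set K := max 1 (max K₁ K₂) with hK
  have hK1 : 1 ≤ K := le_max_left _ _
  have hK0 : 0 < K := one_pos.trans_le hK1
  have hε : 1 / (2 * K) ≤ 1 / 2 := by
    rw [div_le_div_iff₀ (by positivity) (by positivity)]; linarith
  refine ⟨K, 1 / (2 * K), hK0, by positivity, by linarith, ?_, fun s hs => ⟨?_, ?_⟩⟩
  · field_simp; rfl
  · have hs' : s ∈ Icc (0 : ℝ) (1 / 2) := ⟨hs.1, hs.2.trans hε⟩
    have h1 : _ ≤ K₁ := hK₁ (mem_image_of_mem _ hs')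
    have := h.rad_pos (hsub hs')
    rw [div_le_iff₀ (by positivity)] at h1
    refine h1.trans ?_
    gcongr
    exact (le_max_left _ _).trans (le_max_right _ _)
  · have hs' : s ∈ Icc (0 : ℝ) (1 / 2) := ⟨hs.1, hs.2.trans hε⟩
    have h1 : _ ≤ K₂ := hK₂ (mem_image_of_mem _ hs')
    have := h.omg_pos (hsub hs')
    rw [div_le_iff₀ this] at h1
    refine h1.trans ?_
    gcongr
    exact (le_max_right _ _).trans (le_max_right _ _)

end Subextremal

/-- The quadratic form of the bulk term is nonpositive. -/
theorem bulk_quadratic_nonpos {K E s r2 q U W : ℝ} (hs0 : 0 ≤ s) (hs1 : s ≤ 1)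
    (hE0 : 0 ≤ E) (hE1 : E ≤ 1) (hr : 0 < r2) (hK : 0 ≤ K) (hq : q ^ 2 ≤ K * r2 ^ 2) :
    -(E * q * ((U + W) * (U + s * W))) + (-K * r2 + E * q) * (U ^ 2 + s * W ^ 2) -
      E * r2 * W ^ 2 ≤ 0 := by
  -- The terms `q U²` and `q s W²` cancel and leave the cross term `(1 + s) q U W`. By `|q U| ≤ √K
  -- r2 |U|` it is at most `K r2 U² + r2 W²`, exactly what the two good terms can pay for.
  have e : -(E * q * ((U + W) * (U + s * W))) + (-K * r2 + E * q) * (U ^ 2 + s * W ^ 2) -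
      E * r2 * W ^ 2 = -(K * r2 * U ^ 2) - K * r2 * s * W ^ 2 - E * r2 * W ^ 2 -
      E * (1 + s) * (q * U * W) := by ring
  have h1 : -((1 + s) * (q * U * W)) ≤ K * r2 * U ^ 2 + r2 * W ^ 2 := by
    have h2 : 2 * |q * U * W| ≤ K * r2 * U ^ 2 + r2 * W ^ 2 := by
      have h3 : 2 * (|q * U| * |r2 * W|) ≤ (q * U) ^ 2 + (r2 * W) ^ 2 := by
        have := two_mul_le_add_sq |q * U| |r2 * W|
        rw [sq_abs, sq_abs] at this
        linarith
      have h4 : (q * U) ^ 2 ≤ K * r2 ^ 2 * U ^ 2 := by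
        rw [mul_pow]; gcongr
      have h5 : |r2 * W| = r2 * |W| := by rw [abs_mul, abs_of_pos hr]
      have h6 : |q * U * W| = |q * U| * |W| := abs_mul _ _
      rw [h5] at h3
      rw [h6]
      have h7 : r2 * (2 * (|q * U| * |W|)) ≤ r2 * (K * r2 * U ^ 2 + r2 * W ^ 2) := by nlinarith
      exact le_of_mul_le_mul_left h7 hr
    have h8 : -((1 + s) * (q * U * W)) ≤ (1 + s) * |q * U * W| := by
      rw [← mul_neg]; gcongr; exact neg_le_abs _
    have h9 : (1 + s) * |q * U * W| ≤ 2 * |q * U * W| := by gcongr; linarith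
    linarith
  have h2 : E * -((1 + s) * (q * U * W)) ≤ E * (K * r2 * U ^ 2 + r2 * W ^ 2) := by gcongr
  have h3 : E * (K * r2 * U ^ 2) ≤ 1 * (K * r2 * U ^ 2) := by gcongr
  have h4 : 0 ≤ K * r2 * s * W ^ 2 := by positivity
  rw [e]
  nlinarith

/-- The wave equation trades the second derivatives for a first-order term with coefficient `q =
(r²)'`. What results splits into the form of `bulk_quadratic_nonpos` in `u ∂_u ψ` and `u⁻¹ ∂_v ψ`,
and an angular part with coefficient `b + (1 + s) b'`, which is nonpositive because `K Ω²` dominates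
`Ω² + 2 |(Ω²)'|`. -/
theorem bulk_nonpos (h : Subextremal Λ m) {ψ : Pt → ℝ} (hψ : ContDiff ℝ 2 ψ) {K ε : ℝ}
    (hK : 0 < K) (hε1 : ε < 1) (hKε : K * ε ≤ 1 / 2)
    (hc : ∀ s ∈ Icc 0 ε, (2 * rad Λ m s * Subextremal.radDeriv Λ m s) ^ 2 ≤
        K * (rad Λ m s ^ 2) ^ 2 ∧ omg Λ m s + 2 * |deriv (omg Λ m) s| ≤ K * omg Λ m s)
    {u s : ℝ} (hu : 0 < u) (hs : s ∈ Icc 0 ε) (x : Sph)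
    (hbox : box Λ m ψ (cylPt u s x) = 0) :
    fluxU_u (coefA Λ m K) (coefB Λ m K) ψ u s x +
      fluxS_s (coefA Λ m K) (coefB Λ m K) (coefA' Λ m K) (coefB' Λ m K) ψ u s x -
      ∑ i, fluxR_r (coefB Λ m K) ψ i u s x ≤ 0 := by
  have hs1 : s < 1 := hs.2.trans_lt hε1
  obtain ⟨hc1, hc2⟩ := hc s hs
  have hw := wave_eq_of_box_eq_zero hψ h hu.ne' hs1 x hbox
  have hr := h.rad_pos hs1
  have hω := h.omg_pos hs1
  have hKs : K * s ≤ 1 / 2 := (mul_le_mul_of_nonneg_left hs.2 hK.le).trans hKε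
  have hKs0 : 0 ≤ K * s := mul_nonneg hK.le hs.1
  refine nonpos_of_mul_nonpos_right ?_ hu
  rw [divergence_eq _ _ _ _ _ hu.ne']
  have hq := bulk_quadratic_nonpos (K := K) (E := 1 - K * s) (s := s) (r2 := rad Λ m s ^ 2)
    (q := 2 * rad Λ m s * Subextremal.radDeriv Λ m s) (U := u * pU ψ u s x) (W := pV ψ u s x / u)
    hs.1 hs1.le (by linarith) (by linarith) (by positivity) hK.le hc1
  have hR : 0 ≤ ∑ i, pR ψ i u s x ^ 2 := Finset.sum_nonneg fun i _ => sq_nonneg _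
  have hb : coefB Λ m K s + (1 + s) * coefB' Λ m K s ≤ 0 := by
    have h1 : (1 - K * s) * omg Λ m s ≤ 1 * omg Λ m s := by gcongr; linarith
    have h2 : (1 + s) * ((1 - K * s) * deriv (omg Λ m) s) ≤ 2 * (1 * |deriv (omg Λ m) s|) := by
      calc _ ≤ (1 + s) * ((1 - K * s) * |deriv (omg Λ m) s|) := by
            have := hs.1
            have : 0 ≤ 1 - K * s := by linarith
            gcongr; exact le_abs_self _
        _ ≤ _ := by
            have := hs.1
            have : 0 ≤ 1 - K * s := by linarith
            gcongr <;> linarith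
    have h3 : 0 ≤ s * (K * omg Λ m s) := mul_nonneg hs.1 (by positivity)
    unfold coefB coefB'
    linarith
  have hbR := mul_nonpos_of_nonpos_of_nonneg hb hR
  have e1 : u * (pU ψ u s x + pV ψ u s x / u ^ 2) *
      (2 * coefA Λ m K s * sUV ψ u s x - 2 * coefB Λ m K s * ∑ i, sRR ψ i u s x) =
      -((1 - K * s) * (2 * rad Λ m s * Subextremal.radDeriv Λ m s) *
        ((u * pU ψ u s x + pV ψ u s x / u) * (u * pU ψ u s x + s * (pV ψ u s x / u)))) := by
    have e2 : 2 * coefA Λ m K s * sUV ψ u s x - 2 * coefB Λ m K s * ∑ i, sRR ψ i u s x =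
        -((1 - K * s) * (2 * rad Λ m s * Subextremal.radDeriv Λ m s) *
          (s / u * pV ψ u s x + u * pU ψ u s x)) := by
      unfold coefA coefB
      linear_combination (1 - K * s) * hw
    rw [e2]
    have := hu.ne'
    field_simp
    ring
  rw [e1]
  unfold coefA' coefA
  linarith

/-! ### The hypersurface as a threshold in the coordinates `(u, s, x)` -/

namespace Hypersurface

variable {Λ m : ℝ} (S : Hypersurface Λ m)

/-- The value of `s = u v` above which the point with coordinates `u`, `s` and `x` lies in the
future of the hypersurface. -/
def thresh (u : ℝ) (x : Sph) : ℝ := if u ≤ S.cross x then u * S.height (u, (x : E3)) else 0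

theorem norm_coe_sph (x : Sph) : ‖(x : E3)‖ = 1 := mem_sphere_zero_iff_norm.1 x.2

theorem thresh_of_le {u : ℝ} {x : Sph} (h : u ≤ S.cross x) :
    S.thresh u x = u * S.height (u, (x : E3)) := if_pos h

theorem thresh_of_ge {u : ℝ} {x : Sph} (h : S.cross x ≤ u) : S.thresh u x = 0 := by
  rcases h.eq_or_lt with he | hlt
  · rw [thresh, if_pos he.ge, ← he, S.height_cross _ (norm_coe_sph x), mul_zero]
  · exact if_neg (not_le.2 hlt)

theorem continuous_height_pt : Continuous fun y : ℝ × Sph => S.height (y.1, (y.2 : E3)) :=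
  S.height_continuous.comp (by fun_prop)

theorem continuous_thresh (h : Subextremal Λ m) :
    Continuous fun y : ℝ × Sph => S.thresh y.1 y.2 := by
  refine Continuous.if_le (continuous_fst.mul S.continuous_height_pt) continuous_const
    continuous_fst ((S.continuous_cross h).comp continuous_snd) fun y hy => ?_
  rw [hy, S.height_cross _ (norm_coe_sph y.2), mul_zero]

theorem thresh_nonneg {u : ℝ} (hu : 0 ≤ u) (x : Sph) : 0 ≤ S.thresh u x := by
  rcases lt_or_ge u (S.cross x) with hlt | hge
  · rw [S.thresh_of_le hlt.le]
    exact mul_nonneg hu (S.height_pos _ (norm_coe_sph x) u hu hlt).le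
  · rw [S.thresh_of_ge hge]

theorem lt_cross_of_thresh_pos {u : ℝ} {x : Sph} (h : 0 < S.thresh u x) : u < S.cross x := by
  by_contra! hge
  rw [S.thresh_of_ge hge] at h
  exact lt_irrefl _ h

/-- The derivatives of the threshold. -/
def threshU (u : ℝ) (x : Sph) : ℝ := S.height (u, (x : E3)) + u * S.heightU (u, x)

def threshR (i : Fin 3) (u : ℝ) (x : Sph) : ℝ := u * S.heightRot i (u, x)

theorem continuous_heightU : Continuous S.heightU :=
  (S.continuous_fderiv_height.comp (by fun_prop : Continuous fun y : ℝ × Sph =>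
    (y.1, (y.2 : E3)))).clm_apply continuous_const

theorem continuous_heightRot (i : Fin 3) : Continuous (S.heightRot i) :=
  (S.continuous_fderiv_height.comp (by fun_prop : Continuous fun y : ℝ × Sph =>
    (y.1, (y.2 : E3)))).clm_apply
    (continuous_const.prodMk ((continuous_rotVec i).comp (by fun_prop)))

theorem continuous_threshU : Continuous fun y : ℝ × Sph => S.threshU y.1 y.2 :=
  S.continuous_height_pt.add (continuous_fst.mul S.continuous_heightU)

theorem continuous_threshR (i : Fin 3) : Continuous fun y : ℝ × Sph => S.threshR i y.1 y.2 :=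
  continuous_fst.mul (S.continuous_heightRot i)

open Filter Topology in
theorem hasDerivAt_thresh {u : ℝ} {x : Sph} (hpos : 0 < S.thresh u x) :
    HasDerivAt (fun u => S.thresh u x) (S.threshU u x) u := by
  have h1 : HasDerivAt (fun u => u * S.height (u, (x : E3))) (S.threshU u x) u := by
    have := (hasDerivAt_id u).mul
      ((S.differentiable_height (u, (x : E3))).hasFDerivAt.comp_hasDerivAt (f := fun u => (u, (x : E3))) u ((hasDerivAt_id u).prodMk (hasDerivAt_const u _)))
    refine this.congr_deriv ?_
    simp [threshU, heightU]
  refine h1.congr_of_eventuallyEq ?_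
  filter_upwards [gt_mem_nhds (S.lt_cross_of_thresh_pos hpos)] with u' hu'
  exact S.thresh_of_le (le_of_lt hu')

theorem hasDerivAt_height_rot (i : Fin 3) (u : ℝ) (x : Sph) (t : ℝ) :
    HasDerivAt (fun t => S.height (u, (sphRot i t x : E3))) (S.heightRot i (u, sphRot i t x)) t :=
  HasFDerivAt.comp_hasDerivAt (l := S.height) (f := fun t => ((u, (sphRot i t x : E3)) : ℝ × E3)) t
    (S.differentiable_height (u, (sphRot i t x : E3))).hasFDerivAt
    ((hasDerivAt_const t u).prodMk (hasDerivAt_rotMap i t x))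

theorem continuous_cross_rot (h : Subextremal Λ m) (i : Fin 3) (x : Sph) :
    Continuous fun t => S.cross (sphRot i t x : E3) := by
  have h1 : Continuous fun t : ℝ => (t, x) := by fun_prop
  have h2 := (continuous_sphRot i).comp h1
  exact Continuous.comp (g := fun x : Sph => S.cross x) (S.continuous_cross h) h2

open Filter Topology in
theorem hasDerivAt_thresh_rot (h : Subextremal Λ m) (i : Fin 3) {u : ℝ} {x : Sph} {t : ℝ}
    (hpos : 0 < S.thresh u (sphRot i t x)) :
    HasDerivAt (fun t => S.thresh u (sphRot i t x)) (S.threshR i u (sphRot i t x)) t := by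
  refine ((S.hasDerivAt_height_rot i u x t).const_mul u).congr_of_eventuallyEq ?_
  have hlt := S.lt_cross_of_thresh_pos hpos
  filter_upwards [(S.continuous_cross_rot h i x).continuousAt.eventually
    (lt_mem_nhds hlt)] with t' ht'
  exact S.thresh_of_le (le_of_lt ht')

theorem cylPt_mem_region {u s : ℝ} {x : Sph} (hu : 0 < u) (hs : 0 ≤ s) (hs1 : s < 1)
    (hle : S.thresh u x ≤ s) : cylPt u s x ∈ S.region := by
  refine ⟨⟨?_, norm_coe_sph x⟩, hu.le, div_nonneg hs hu.le, ?_⟩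
  · change u * (s / u) < 1
    rwa [mul_div_cancel₀ _ hu.ne']
  · rcases le_or_gt (S.cross x) u with hc | hc
    · exact Or.inl hc
    · right
      rw [S.thresh_of_le hc.le, mul_comm] at hle
      exact (le_div_iff₀ hu).2 hle

theorem thresh_le_of_mem_region {u v : ℝ} {x : Sph} (h : ((u, v, (x : E3)) : Pt) ∈ S.region) :
    S.thresh u x ≤ u * v := by
  obtain ⟨-, hu, hv, hc | hc⟩ := h
  · rw [S.thresh_of_ge hc]; exact mul_nonneg hu hv
  · rcases le_or_gt (S.cross x) u with hc' | hc'
    · rw [S.thresh_of_ge hc']; exact mul_nonneg hu hv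
    · rw [S.thresh_of_le hc'.le]; exact mul_le_mul_of_nonneg_left hc hu

open Filter Topology in
/-- Near the other horizon the hypersurface stays away from the bifurcation sphere. -/
theorem exists_lt_height : ∃ u₀ : ℝ, 0 < u₀ ∧ ∀ x : E3, ‖x‖ = 1 →
    u₀ < S.cross x ∧ ∀ u ∈ Icc 0 u₀, u₀ < S.height (u, x) := by
  -- At `u = 0` the height is positive on the whole sphere. By compactness of the sphere, `z.1 <
  -- height (z.2, x)` holds for all `x` once both entries of `z` are small, so a single number can
  -- bound `u` from above and the height from below.
  have hev := (isCompact_sphere (0 : E3) 1).eventually_forall_of_forall_eventually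
    (x₀ := ((0 : ℝ), (0 : ℝ))) (P := fun z x => z.1 < S.height (z.2, x)) (fun x hx => by
      have hc : Continuous fun z : (ℝ × ℝ) × E3 => S.height (z.1.2, z.2) - z.1.1 :=
        (S.height_continuous.comp (by fun_prop)).sub (by fun_prop)
      have hn : ‖x‖ = 1 := mem_sphere_zero_iff_norm.1 hx
      have h0 : 0 < S.height ((0 : ℝ), x) - (0 : ℝ) := by
        rw [sub_zero]; exact S.height_pos x hn 0 le_rfl (S.cross_pos x hn)
      have hcx := hc.continuousAt (x := ((0, 0), x))
      filter_upwards [hcx.eventually (lt_mem_nhds h0)] with z hz using sub_pos.1 hz)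
  obtain ⟨δ, hδ, hball⟩ := Metric.eventually_nhds_iff.1 hev
  have hh : ∀ x : E3, ‖x‖ = 1 → ∀ u ∈ Icc 0 (δ / 2), δ / 2 < S.height (u, x) := by
    intro x hx u hu
    refine hball (y := (δ / 2, u)) ?_ x (mem_sphere_zero_iff_norm.2 hx)
    rw [Prod.dist_eq, max_lt_iff, Real.dist_eq, Real.dist_eq, sub_zero, sub_zero,
      abs_of_pos (by positivity), abs_of_nonneg hu.1]
    exact ⟨by linarith, by linarith [hu.2]⟩
  refine ⟨δ / 2, by positivity, fun x hx => ⟨?_, hh x hx⟩⟩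
  by_contra! hle
  have := hh x hx _ ⟨(S.cross_pos x hx).le, hle⟩
  rw [S.height_cross x hx] at this
  linarith

end Hypersurface

/-! ### Extension of solutions -/

open Filter Topology Manifold in
-- The solution is multiplied by a bump function equal to `1` near `K`. The calculus of the current
-- is carried out for functions of class `C²` on the whole ambient space, and equality of germs
-- preserves both the derivatives and the wave equation on `K`.
theorem exists_contDiff_eventuallyEq {W K : Set Pt} (hW : IsOpen W) (hK : IsCompact K)
    (hKW : K ⊆ W) {ψ : Pt → ℝ} (hψ : ContDiffOn ℝ 2 ψ W) :
    ∃ f : Pt → ℝ, ContDiff ℝ 2 f ∧ ∀ p ∈ K, f =ᶠ[𝓝 p] ψ := by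
  obtain ⟨V, hKV, hVW, hVW'⟩ := exists_compact_between hK hW hKW
  obtain ⟨g, h1, h0, -⟩ := exists_contMDiffMap_one_nhds_of_subset_interior (n := 2)
    𝓘(ℝ, Pt) hK.isClosed hVW
  have hg : ContDiff ℝ 2 g := g.contMDiff.contDiff
  refine ⟨fun p => g p * ψ p, contDiff_iff_contDiffAt.2 fun p => ?_, fun p hp => ?_⟩
  · by_cases hp : p ∈ W
    · exact hg.contDiffAt.mul (hψ.contDiffAt (hW.mem_nhds hp))
    · refine (contDiffAt_const (c := (0 : ℝ))).congr_of_eventuallyEq ?_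
      filter_upwards [hKV.isClosed.isOpen_compl.mem_nhds fun hV => hp (hVW' hV)] with q hq
      rw [h0 q hq, zero_mul]
  · filter_upwards [h1.filter_mono (nhds_le_nhdsSet hp)] with q hq
    rw [hq, one_mul]

open Filter Topology in
theorem box_congr {Λ m : ℝ} {f ψ : Pt → ℝ} {p : Pt} (h : f =ᶠ[𝓝 p] ψ) :
    box Λ m f p = box Λ m ψ p := by
  have h1 : fderiv ℝ f =ᶠ[𝓝 p] fderiv ℝ ψ := h.fderiv
  have hd : ∀ X : Pt, (fun q => -(radius Λ m q ^ 2 * fderiv ℝ f q X)) =ᶠ[𝓝 p]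
      fun q => -(radius Λ m q ^ 2 * fderiv ℝ ψ q X) := fun X => by
    filter_upwards [h1] with q hq
    rw [hq]
  have hr : ∀ i, rot i f =ᶠ[𝓝 p] rot i ψ := fun i => by
    filter_upwards [h1] with q hq
    simp only [rot, hq]
  have hrr : ∀ i, rot i (rot i f) p = rot i (rot i ψ) p := fun i => by
    rw [rot, (hr i).fderiv_eq, rot]
  simp only [box, hrr]
  simp only [du, dv, (hd _).fderiv_eq]

/-! ### The energy inequality above the hypersurface -/

variable {Λ m : ℝ}

/-- The pairs of constants for which `(1 - K s) (u ∂_u + u⁻¹ ∂_v)` is a redshift multiplier in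
`0 ≤ s ≤ ε`. -/
structure IsRedshiftPair (Λ m K ε : ℝ) : Prop where
  pos : 0 < K
  eps_pos : 0 < ε
  eps_lt : ε < 1
  mul_le : K * ε ≤ 1 / 2
  bounds : ∀ s ∈ Icc 0 ε, (2 * rad Λ m s * Subextremal.radDeriv Λ m s) ^ 2 ≤
    K * (rad Λ m s ^ 2) ^ 2 ∧ omg Λ m s + 2 * |deriv (omg Λ m) s| ≤ K * omg Λ m s

/-- The density of the flux of the energy current through the hypersurface. -/
def graphFlux (S : Hypersurface Λ m) (K : ℝ) (ψ : Pt → ℝ) (y : ℝ × Sph) : ℝ :=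
  fluxS (coefA Λ m K) (coefB Λ m K) ψ y.1 (S.thresh y.1 y.2) y.2 -
    S.threshU y.1 y.2 * fluxU (coefA Λ m K) (coefB Λ m K) ψ y.1 (S.thresh y.1 y.2) y.2 +
    ∑ i, S.threshR i y.1 y.2 * fluxR (coefB Λ m K) ψ i y.1 (S.thresh y.1 y.2) y.2

theorem coef_nonneg (h : Subextremal Λ m) {K ε : ℝ} (hK : IsRedshiftPair Λ m K ε) {s : ℝ}
    (hs : s ∈ Icc 0 ε) : 1 / 2 ≤ 1 - K * s ∧ 0 ≤ coefA Λ m K s ∧ 0 ≤ coefB Λ m K s := by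
  have h1 : K * s ≤ 1 / 2 := (mul_le_mul_of_nonneg_left hs.2 hK.pos.le).trans hK.mul_le
  have h2 : 0 ≤ 1 - K * s := by linarith
  have h3 := h.omg_pos (hs.2.trans_lt hK.eps_lt)
  exact ⟨by linarith, mul_nonneg h2 (sq_nonneg _), by unfold coefB; positivity⟩

/-- The divergence theorem for the redshift current on `thresh ≤ s ≤ c`. The three integrals are the
fluxes through the level set, through the horizon and through `Σ`. -/
theorem energy_inequality (S : Hypersurface Λ m) (h : Subextremal Λ m) {K ε : ℝ}
    (hK : IsRedshiftPair Λ m K ε) {ψ : Pt → ℝ} (hψ : ContDiff ℝ 2 ψ) {u₀ u₁ c : ℝ} (hu₀ : 0 < u₀)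
    (hu : u₀ ≤ u₁) (hc : 0 ≤ c) (hcε : c ≤ ε) (hHc : ∀ x, c < S.thresh u₀ x)
    (hbox : ∀ u ∈ Icc u₀ u₁, ∀ s ∈ Icc 0 c, ∀ x, S.thresh u x ≤ s →
      box Λ m ψ (cylPt u s x) = 0) :
    ∫ y, (if S.thresh y.1 y.2 ≤ c then fluxS (coefA Λ m K) (coefB Λ m K) ψ y.1 c y.2 else 0)
        ∂cylIcc u₀ u₁ ≤
      ∫ y, (if S.thresh y.1 y.2 ≤ 0 then fluxS (coefA Λ m K) (coefB Λ m K) ψ y.1 0 y.2 else 0)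
        ∂cylIcc u₀ u₁ +
      ∫ y, (if 0 < S.thresh y.1 y.2 ∧ S.thresh y.1 y.2 ≤ c then graphFlux S K ψ y else 0)
        ∂cylIcc u₀ u₁ := by
  have hsub : Icc 0 c ⊆ Iio 1 := fun s hs => (hs.2.trans hcε).trans_lt hK.eps_lt
  have ca := (h.continuousOn_coefA K).mono hsub
  have cb := (h.continuousOn_coefB K).mono hsub
  have ca' := (h.continuousOn_coefA' K).mono hsub
  have cb' := (h.continuousOn_coefB' K).mono hsub
  have da : ∀ s ∈ Ioo 0 c, HasDerivAt (coefA Λ m K) (coefA' Λ m K s) s := fun s hs =>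
    h.hasDerivAt_coefA K (hsub (Ioo_subset_Icc_self hs))
  have db : ∀ s ∈ Ioo 0 c, HasDerivAt (coefB Λ m K) (coefB' Λ m K s) s := fun s hs =>
    h.hasDerivAt_coefB K (hsub (Ioo_subset_Icc_self hs))
  exact flux_inequality (H := S.thresh) (d := S.threshU) (e := S.threshR)
    (A := fluxU (coefA Λ m K) (coefB Λ m K) ψ) (Au := fluxU_u (coefA Λ m K) (coefB Λ m K) ψ)
    (As := fluxU_s (coefA Λ m K) (coefB Λ m K) (coefA' Λ m K) (coefB' Λ m K) ψ)
    (B := fluxS (coefA Λ m K) (coefB Λ m K) ψ)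
    (Bs := fluxS_s (coefA Λ m K) (coefB Λ m K) (coefA' Λ m K) (coefB' Λ m K) ψ)
    (Q := fluxR (coefB Λ m K) ψ) (Qr := fluxR_r (coefB Λ m K) ψ)
    (Qs := fluxR_s (coefB Λ m K) (coefB' Λ m K) ψ)
    hu hc (S.continuous_thresh h) (continuousOn_fluxU hψ hu₀ ca cb)
    (continuousOn_fluxU_u hψ hu₀ ca cb) (continuousOn_fluxU_s hψ hu₀ ca cb ca' cb')
    (continuousOn_fluxS hψ hu₀ ca cb) (continuousOn_fluxS_s hψ hu₀ ca cb ca' cb')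
    (fun i => continuousOn_fluxR hψ hu₀ i cb) (fun i => continuousOn_fluxR_r hψ hu₀ i cb)
    (fun i => continuousOn_fluxR_s hψ hu₀ i cb cb') S.continuous_threshU S.continuous_threshR
    (fun u h x => S.thresh_nonneg (hu₀.le.trans h.1) x) hHc
    (fun u _ x hp => S.hasDerivAt_thresh hp)
    (fun i u _ x t hp => S.hasDerivAt_thresh_rot h i hp)
    (fun u h s _ x => hasDerivAt_fluxU_fst hψ (hu₀.trans h.1).ne' s x)
    (fun u _ s hs x => hasDerivAt_fluxU_snd hψ x (da s hs) (db s hs))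
    (fun u _ s hs x => hasDerivAt_fluxS_snd hψ x (da s hs) (db s hs))
    (fun i u _ s _ x t => hasDerivAt_fluxR_rot hψ i u s x t)
    (fun i u _ s hs x => hasDerivAt_fluxR_snd hψ i x (db s hs))
    (fun s hs x => by
      obtain ⟨-, h1, h2⟩ := coef_nonneg h hK ⟨hs.1, hs.2.trans hcε⟩
      unfold fluxU
      positivity)
    (fun u h' s hs x hle => bulk_nonpos h hψ hK.pos hK.eps_lt hK.mul_le hK.bounds
      (hu₀.trans_le h'.1) ⟨hs.1, hs.2.trans hcε⟩ x (hbox u h' s hs x hle))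

/-! ### Identification of the fluxes -/

/-- The redshift multiplier. -/
def redshiftField (K : ℝ) (p : Pt) : Pt :=
  ((1 - K * (p.1 * p.2.1)) * p.1, (1 - K * (p.1 * p.2.1)) * p.1⁻¹, 0)

theorem fderiv_apply_eq (ψ : Pt → ℝ) (p : Pt) (a b : ℝ) (w : E3) :
    fderiv ℝ ψ p (a, b, w) =
      a * fderiv ℝ ψ p (1, 0, 0) + b * fderiv ℝ ψ p (0, 1, 0) + fderiv ℝ ψ p (0, 0, w) := by
  rw [← smul_eq_mul, ← smul_eq_mul, ← map_smul, ← map_smul, ← map_add, ← map_add]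
  simp

/-- The products `∂_u ψ ∂_v ψ` from the two halves of the energy-momentum tensor cancel, leaving the
squares of the tangential derivatives. -/
theorem emTensor_horizon (h : Subextremal Λ m) (K : ℝ) (ψ : Pt → ℝ) {u : ℝ} (hu : u ≠ 0) (x : Sph) :
    radius Λ m (u, 0, (x : E3)) ^ 2 * emTensor Λ m ψ (u, 0, (x : E3))
      (redshiftField K (u, 0, (x : E3))) (1, 0, 0) =
      fluxS (coefA Λ m K) (coefB Λ m K) ψ u 0 x := by
  have hp : ((u, 0, (x : E3)) : Pt) = cylPt u 0 x := by simp [cylPt]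
  have hω := h.omg_pos zero_lt_one
  have hr := h.rad_pos zero_lt_one
  simp only [emTensor, redshiftField, metric, gradSq, angularSq, du, dv, rot,
    omegaSq_eq_omg, radius_eq_rad, mul_zero]
  rw [fderiv_apply_eq]
  simp only [hp]
  change _ * ((_ * pU ψ u 0 x + _ * pV ψ u 0 x + _) * pU ψ u 0 x - _ *
    (_ * (pU ψ u 0 x * pV ψ u 0 x) + _ * ∑ i, pR ψ i u 0 x ^ 2)) = _
  have h0 : fderiv ℝ ψ (cylPt u 0 x) (0, 0, 0) = 0 := map_zero _
  rw [h0]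
  simp only [fluxS, coefA, coefB, inner_zero_right]
  field_simp
  ring

theorem emTensor_smul_right (ψ : Pt → ℝ) (p X Y : Pt) (k : ℝ) :
    emTensor Λ m ψ p X (k • Y) = k * emTensor Λ m ψ p X Y := by
  simp only [emTensor, metric, map_smul, smul_eq_mul, Prod.smul_fst, Prod.smul_snd,
    inner_smul_right]
  ring

theorem metric_conormal (S : Hypersurface Λ m) {y : ℝ × Sph} (ho : 0 < omegaSq Λ m (S.pt y))
    (hr : 0 < radius Λ m (S.pt y)) :
    -metric Λ m (S.pt y) (S.conormal y) (S.conormal y) =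
      (2 / omegaSq Λ m (S.pt y)) ^ 2 * S.tilt (S.pt y) := by
  have hz : ‖∑ i, S.heightRot i y • rotVec i y.2‖ ^ 2 = ∑ i, S.heightRot i y ^ 2 :=
    norm_sq_sum_smul_rotVec (S.angularDeriv y.1 y.2) (Hypersurface.norm_coe_sph y.2)
  have ht : S.tilt (S.pt y) = -(omegaSq Λ m (S.pt y) * S.heightU y) -
      omegaSq Λ m (S.pt y) ^ 2 / (4 * radius Λ m (S.pt y) ^ 2) *
        ∑ i, S.heightRot i y ^ 2 := rfl
  rw [ht, metric, Hypersurface.conormal]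
  simp only [inner_smul_left, inner_smul_right, real_inner_self_eq_norm_sq, hz, conj_trivial]
  field_simp
  ring

/-- The volume density carries the factor `√tilt` and the normalisation of `n` its inverse; after
cancellation the density is polynomial in the first derivatives of `ψ`. -/
theorem emTensor_normal (S : Hypersurface Λ m) (ψ : Pt → ℝ) {y : ℝ × Sph} (X : Pt)
    (ho : 0 < omegaSq Λ m (S.pt y)) (hr : 0 < radius Λ m (S.pt y)) (ht : 0 < S.tilt (S.pt y)) :
    emTensor Λ m ψ (S.pt y) X (S.normal y) * S.volDensity y =
      omegaSq Λ m (S.pt y) / 2 * radius Λ m (S.pt y) ^ 2 *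
        emTensor Λ m ψ (S.pt y) X (S.conormal y) := by
  have hv : S.volDensity y = radius Λ m (S.pt y) ^ 2 * √(S.tilt (S.pt y)) := rfl
  have hq : 0 < √(S.tilt (S.pt y)) := Real.sqrt_pos.2 ht
  rw [Hypersurface.normal, emTensor_smul_right, metric_conormal S ho hr, hv,
    Real.sqrt_mul (sq_nonneg _), Real.sqrt_sq (by positivity)]
  field_simp

/-- The conormal of `v = height` at fixed `u > 0` is proportional to that of `s = thresh`, so the
geometric flux density on `Σ` is the boundary term that the divergence theorem produces above the
threshold. -/
theorem graphFlux_eq (S : Hypersurface Λ m) (h : Subextremal Λ m) (K : ℝ) (ψ : Pt → ℝ)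
    {y : ℝ × Sph} (hu : 0 < y.1) (hy : y.1 ≤ S.cross y.2) :
    emTensor Λ m ψ (S.pt y) (redshiftField K (S.pt y)) (S.normal y) * S.volDensity y =
      graphFlux S K ψ y := by
  obtain ⟨u, x⟩ := y
  simp only at hu hy
  have hx := Hypersurface.norm_coe_sph x
  have hlt := S.in_chart x hx u hu.le hy
  have hcar : S.pt (u, x) ∈ S.carrier := ⟨hx, hu.le, hy, rfl⟩
  have ht := S.tilt_pos h hcar
  have hp : S.pt (u, x) = cylPt u (S.thresh u x) x := by
    rw [S.thresh_of_le hy, cylPt, mul_div_cancel_left₀ _ hu.ne']; rfl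
  have hs : (S.pt (u, x)).1 * (S.pt (u, x)).2.1 < 1 := hlt
  have hs' : (S.pt (u, x)).1 * (S.pt (u, x)).2.1 = S.thresh u x := (S.thresh_of_le hy).symm
  have ho := h.omg_pos hs
  have hr := h.rad_pos hs
  rw [emTensor_normal S ψ _ ho hr ht]
  rw [hs'] at ho hr
  have hd : fderiv ℝ ψ (S.pt (u, x)) (S.conormal (u, x)) =
      2 / omg Λ m (S.thresh u x) * pU ψ u (S.thresh u x) x +
        -(2 / omg Λ m (S.thresh u x)) * S.heightU (u, x) * pV ψ u (S.thresh u x) x +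
        1 / rad Λ m (S.thresh u x) ^ 2 * ∑ i, S.heightRot i (u, x) * pR ψ i u (S.thresh u x) x := by
    rw [Hypersurface.conormal, fderiv_apply_eq, omegaSq_eq_omg, radius_eq_rad, hs', hp]
    congr 1
    have e : ((0, 0, (1 / rad Λ m (S.thresh u x) ^ 2) •
        ∑ i, S.heightRot i (u, x) • rotVec i x) : Pt) =
        (1 / rad Λ m (S.thresh u x) ^ 2) •
          ∑ i, S.heightRot i (u, x) • ((0, 0, rotVec i x) : Pt) := by
      simp [Fin.sum_univ_three]
    rw [e, map_smul, map_sum, smul_eq_mul]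
    simp only [map_smul, smul_eq_mul, pR]
  have hN : fderiv ℝ ψ (S.pt (u, x)) (redshiftField K (S.pt (u, x))) =
      (1 - K * S.thresh u x) * (u * pU ψ u (S.thresh u x) x + pV ψ u (S.thresh u x) x / u) := by
    rw [redshiftField, fderiv_apply_eq, hs', hp]
    have h0 : fderiv ℝ ψ (cylPt u (S.thresh u x) x) (0, 0, 0) = 0 := map_zero _
    rw [h0]
    change (1 - K * S.thresh u x) * u * pU ψ u (S.thresh u x) x +
      (1 - K * S.thresh u x) * u⁻¹ * pV ψ u (S.thresh u x) x + 0 = _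
    ring
  have hg : gradSq Λ m ψ (S.pt (u, x)) =
      -(4 / omg Λ m (S.thresh u x)) * (pU ψ u (S.thresh u x) x * pV ψ u (S.thresh u x) x) +
        1 / rad Λ m (S.thresh u x) ^ 2 * ∑ i, pR ψ i u (S.thresh u x) x ^ 2 := by
    rw [gradSq, angularSq, omegaSq_eq_omg, radius_eq_rad, hs', hp]
    rfl
  have hm : metric Λ m (S.pt (u, x)) (redshiftField K (S.pt (u, x))) (S.conormal (u, x)) =
      (1 - K * S.thresh u x) * (u * S.heightU (u, x) - 1 / u) := by
    rw [metric, redshiftField, Hypersurface.conormal, omegaSq_eq_omg, radius_eq_rad, hs']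
    simp only [inner_zero_left]
    change -(omg Λ m (S.thresh u x) / 2) * ((1 - K * S.thresh u x) * u *
      (-(2 / omg Λ m (S.thresh u x)) * S.heightU (u, x)) +
      (1 - K * S.thresh u x) * u⁻¹ * (2 / omg Λ m (S.thresh u x))) + _ = _
    field_simp
    ring
  rw [emTensor, hd, hN, hg, hm, omegaSq_eq_omg, radius_eq_rad, hs']
  simp only [graphFlux, fluxS, fluxU, fluxR, coefA, coefB, Hypersurface.threshU,
    Hypersurface.threshR, Fin.sum_univ_three]
  have hh : S.height (u, (x : E3)) = S.thresh u x / u := by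
    rw [S.thresh_of_le hy, mul_div_cancel_left₀ _ hu.ne']
  rw [hh]
  generalize S.thresh u x = s at *
  generalize pU ψ u s x = a at *
  generalize pV ψ u s x = b at *
  generalize pR ψ 0 u s x = r0 at *
  generalize pR ψ 1 u s x = r1 at *
  generalize pR ψ 2 u s x = r2 at *
  generalize rad Λ m s = r at *
  generalize omg Λ m s = o at *
  field_simp
  ring

variable {Λ m : ℝ}

/-! ### The energy on the level sets of the radius -/

theorem fluxS_nonneg (h : Subextremal Λ m) {K ε : ℝ} (hK : IsRedshiftPair Λ m K ε) (ψ : Pt → ℝ)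
    {u s : ℝ} (hu : 0 < u) (hs : s ∈ Icc 0 ε) (x : Sph) :
    0 ≤ fluxS (coefA Λ m K) (coefB Λ m K) ψ u s x := by
  obtain ⟨-, h1, h2⟩ := coef_nonneg h hK hs
  have := hs.1
  unfold fluxS
  positivity

/-- The constant of the energy estimate. -/
def levelConst (Λ m r : ℝ) : ℝ :=
  4 * lapse Λ m r ^ 2 * kappa Λ m + 8 / (kappa Λ m * omegaSqOfRadius Λ m r)

/-- The density of the energy on a level set of the radius. -/
def levelDensity (Λ m : ℝ) (ψ : Pt → ℝ) (r : ℝ) (p : Pt) : ℝ :=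
  (1 / lapse Λ m r ^ 2 * fderiv ℝ ψ p (radialField Λ m p) ^ 2 +
    lapse Λ m r ^ 2 * fderiv ℝ ψ p (killing Λ m p) ^ 2 + angularSq Λ m ψ p) *
    lapse Λ m r * ((lapse Λ m r)⁻¹ * r ^ 2)

/-- With `a = u ∂_u ψ` and `b = u⁻¹ ∂_v ψ` one has `∂_r ψ = φ² κ (a + s b)` and `∂_t ψ = κ (a - s
b)`, so their weighted squares add up to `2 φ² κ² (a² + s² b²)`. The flux controls `b²` with weight
`s` only, and `s² ≤ s` makes this sufficient. The factor `κ u` is the Jacobian `du / dt` on the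
level set. -/
theorem levelDensity_le (h : Subextremal Λ m) {K ε : ℝ} (hK : IsRedshiftPair Λ m K ε)
    (ψ : Pt → ℝ) {u s : ℝ} (hu : 0 < u) (hs : s ∈ Icc 0 ε) (x : Sph) :
    levelDensity Λ m ψ (rad Λ m s) (cylPt u s x) ≤ levelConst Λ m (rad Λ m s) *
      (kappa Λ m * u * fluxS (coefA Λ m K) (coefB Λ m K) ψ u s x) := by
  have hs1 : s < 1 := hs.2.trans_lt hK.eps_lt
  have hr := h.rad_pos hs1
  have hω : 0 < omg Λ m s := h.omg_pos hs1
  have hκ := h.kappa_pos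
  obtain ⟨hE, -, -⟩ := coef_nonneg h hK hs
  have hp : (cylPt u s x).1 * (cylPt u s x).2.1 = s := mul_div_cancel₀ _ hu.ne'
  have h0 : fderiv ℝ ψ (cylPt u s x) (0, 0, 0) = 0 := map_zero _
  set φ := lapse Λ m (rad Λ m s) with hφ
  have hφ0 : 0 ≤ φ := by rw [hφ, lapse]; positivity
  have e1 : fderiv ℝ ψ (cylPt u s x) (radialField Λ m (cylPt u s x)) =
      φ ^ 2 * kappa Λ m * (u * pU ψ u s x + s * (pV ψ u s x / u)) := by
    rw [radialField, fderiv_apply_eq, h0, radius_eq_rad, hp]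
    change φ ^ 2 * (kappa Λ m * u) * pU ψ u s x + φ ^ 2 * (kappa Λ m * (s / u)) * pV ψ u s x + 0 = _
    ring
  have e2 : fderiv ℝ ψ (cylPt u s x) (killing Λ m (cylPt u s x)) =
      kappa Λ m * (u * pU ψ u s x - s * (pV ψ u s x / u)) := by
    rw [killing, fderiv_apply_eq, h0]
    change (kappa Λ m * u) * pU ψ u s x + -(kappa Λ m * (s / u)) * pV ψ u s x + 0 = _
    ring
  have e3 : angularSq Λ m ψ (cylPt u s x) = 1 / rad Λ m s ^ 2 * ∑ i, pR ψ i u s x ^ 2 := by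
    rw [angularSq, radius_eq_rad, hp]; rfl
  have e4 : omegaSqOfRadius Λ m (rad Λ m s) = omg Λ m s := rfl
  have e5 : kappa Λ m * u * fluxS (coefA Λ m K) (coefB Λ m K) ψ u s x =
      (1 - K * s) * (kappa Λ m * (rad Λ m s ^ 2 *
        ((u * pU ψ u s x) ^ 2 + s * (pV ψ u s x / u) ^ 2) +
        (1 + s) * omg Λ m s / 4 * ∑ i, pR ψ i u s x ^ 2)) := by
    simp only [fluxS, coefA, coefB]
    field_simp
  have hR : 0 ≤ ∑ i, pR ψ i u s x ^ 2 := Finset.sum_nonneg fun i _ => sq_nonneg _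
  rw [levelDensity, levelConst, e1, e2, e3, e4, e5, ← hφ]
  generalize (∑ i, pR ψ i u s x ^ 2) = R at hR ⊢
  generalize u * pU ψ u s x = a
  generalize pV ψ u s x / u = b
  generalize omg Λ m s = o at *
  generalize kappa Λ m = k at *
  have hs0 := hs.1
  have l1 : (1 / φ ^ 2 * (φ ^ 2 * k * (a + s * b)) ^ 2 + φ ^ 2 * (k * (a - s * b)) ^ 2 +
      1 / rad Λ m s ^ 2 * R) * φ * (φ⁻¹ * rad Λ m s ^ 2) ≤
      2 * φ ^ 2 * k ^ 2 * rad Λ m s ^ 2 * (a ^ 2 + s ^ 2 * b ^ 2) + R := by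
    -- If the square root in `lapse` vanishes, then `lapse` is `0` and the density is `0`, so
    -- positivity of the lapse need not be known. Otherwise the factors `φ` and `φ⁻¹` cancel.
    rcases hφ0.eq_or_lt with hz | hz
    · rw [← hz]; simpa using hR
    · refine le_of_eq ?_
      field_simp
      ring
  have l2 : s ^ 2 * b ^ 2 ≤ s * b ^ 2 := by
    rw [sq s]; gcongr; nlinarith
  have l3 : rad Λ m s ^ 2 * (a ^ 2 + s * b ^ 2) + o / 4 * R ≤
      rad Λ m s ^ 2 * (a ^ 2 + s * b ^ 2) + (1 + s) * o / 4 * R := by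
    gcongr; nlinarith
  -- The first summand of `levelConst` pays for the derivatives `a`, `b` and the second for the
  -- angular ones; their numerical factors `4` and `8` compensate the loss `1 - K s ≥ 1/2` and the
  -- `Ω² / 4` in the flux.
  calc _ ≤ 2 * φ ^ 2 * k ^ 2 * rad Λ m s ^ 2 * (a ^ 2 + s * b ^ 2) + R :=
        l1.trans (by gcongr)
    _ ≤ (4 * φ ^ 2 * k + 8 / (k * o)) * (1 / 2 * (k *
        (rad Λ m s ^ 2 * (a ^ 2 + s * b ^ 2) + o / 4 * R))) := by
      have : (4 * φ ^ 2 * k + 8 / (k * o)) * (1 / 2 * (k *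
        (rad Λ m s ^ 2 * (a ^ 2 + s * b ^ 2) + o / 4 * R))) =
        2 * φ ^ 2 * k ^ 2 * rad Λ m s ^ 2 * (a ^ 2 + s * b ^ 2) + R +
        (φ ^ 2 * k ^ 2 * o / 2 * R + 4 / o * (rad Λ m s ^ 2 * (a ^ 2 + s * b ^ 2))) := by
        field_simp
        ring
      rw [this]
      exact le_add_of_nonneg_right (by positivity)
    _ ≤ _ := by gcongr

/-- The coordinate `u` on the level set as a function of `t`. -/
def levelU (Λ m c t : ℝ) : ℝ := √c * Real.exp (kappa Λ m * t)

theorem hasDerivAt_levelU (c t : ℝ) :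
    HasDerivAt (levelU Λ m c) (kappa Λ m * levelU Λ m c t) t := by
  refine ((((hasDerivAt_id t).const_mul (kappa Λ m)).exp).const_mul √c).congr_deriv ?_
  simp only [levelU, id]; ring

theorem levelU_pos {c : ℝ} (hc : 0 < c) (t : ℝ) : 0 < levelU Λ m c t :=
  mul_pos (Real.sqrt_pos.2 hc) (Real.exp_pos _)

theorem continuous_levelU (c : ℝ) : Continuous (levelU Λ m c) := by
  unfold levelU; fun_prop

theorem levelU_injective (h : Subextremal Λ m) {c : ℝ} (hc : 0 < c) :
    Function.Injective (levelU Λ m c) := fun s t hst => by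
  have := Real.exp_injective (mul_left_cancel₀ (Real.sqrt_pos.2 hc).ne' hst)
  exact mul_left_cancel₀ h.kappa_pos.ne' this

theorem levelPt_eq {r c : ℝ} (hr : uvOfRadius Λ m r = c) (hc : 0 < c) (y : ℝ × Sph) :
    levelPt Λ m r y = cylPt (levelU Λ m c y.1) c y.2 := by
  have hq := Real.sqrt_pos.2 hc
  rw [levelPt, cylPt, hr, levelU, Real.exp_neg]
  congr 2
  rw [eq_div_iff (by positivity)]
  calc _ = (√c * √c) * ((Real.exp (kappa Λ m * y.1))⁻¹ * Real.exp (kappa Λ m * y.1)) := by ring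
    _ = c := by rw [Real.mul_self_sqrt hc.le, inv_mul_cancel₀ (Real.exp_ne_zero _), mul_one]

/-- The substitution `u = √c exp (κ t)`; there is only an inequality because its image is the half
line `u > 0`. -/
theorem lintegral_levelU_le (h : Subextremal Λ m) {c : ℝ} (hc : 0 < c)
    {F : ℝ × Sph → ℝ≥0∞} (hF : Measurable F) :
    ∫⁻ y, ENNReal.ofReal (kappa Λ m * levelU Λ m c y.1) * F (levelU Λ m c y.1, y.2) ∂cylMeasure ≤
      ∫⁻ y, F y ∂cylMeasure := by
  have m0 := (continuous_levelU (Λ := Λ) (m := m) c).measurable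
  have m1 : Measurable fun y : ℝ × Sph =>
      ENNReal.ofReal (kappa Λ m * levelU Λ m c y.1) * F (levelU Λ m c y.1, y.2) :=
    (ENNReal.measurable_ofReal.comp ((m0.comp measurable_fst).const_mul _)).mul
      (hF.comp ((m0.comp measurable_fst).prodMk measurable_snd))
  rw [cylMeasure, lintegral_prod_symm _ m1.aemeasurable, lintegral_prod_symm _ hF.aemeasurable]
  refine lintegral_mono fun x => ?_
  have key := lintegral_image_eq_lintegral_abs_deriv_mul MeasurableSet.univ
    (fun t _ => (hasDerivAt_levelU (Λ := Λ) (m := m) c t).hasDerivWithinAt)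
    (levelU_injective h hc).injOn fun u => F (u, x)
  rw [Measure.restrict_univ] at key
  calc _ = ∫⁻ u in levelU Λ m c '' univ, F (u, x) := by
        rw [key]
        refine lintegral_congr fun t => ?_
        rw [abs_of_pos (mul_pos h.kappa_pos (levelU_pos hc t))]
    _ ≤ _ := setLIntegral_le_lintegral _ _

/-- No integrability is needed, as the integral of a non-integrable function is `0` by convention.
This turns the signed energy inequality into one between possibly infinite integrals. -/
theorem ofReal_integral_le_lintegral {α : Type*} [MeasurableSpace α] (μ : Measure α) (f : α → ℝ) :
    ENNReal.ofReal (∫ x, f x ∂μ) ≤ ∫⁻ x, ENNReal.ofReal (f x) ∂μ := by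
  by_cases hf : Integrable f μ
  · have hm : ∫ x, f x ∂μ ≤ ∫ x, max (f x) 0 ∂μ :=
      integral_mono hf hf.pos_part fun x => le_max_left _ _
    refine (ENNReal.ofReal_le_ofReal hm).trans ?_
    rw [ofReal_integral_eq_lintegral_ofReal hf.pos_part (.of_forall fun x => le_max_right _ _)]
    refine lintegral_mono fun x => ?_
    rcases le_total (f x) 0 with hx | hx
    · rw [max_eq_right hx, ENNReal.ofReal_zero]; exact zero_le
    · rw [max_eq_left hx]
  · rw [integral_undef hf, ENNReal.ofReal_zero]; exact zero_le

variable {Λ m : ℝ}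

theorem emTensor_congr {f ψ : Pt → ℝ} {p : Pt} (h : fderiv ℝ f p = fderiv ℝ ψ p) (X Y : Pt) :
    emTensor Λ m f p X Y = emTensor Λ m ψ p X Y := by
  simp only [emTensor, gradSq, angularSq, du, dv, rot, h]

theorem levelDensity_congr {f ψ : Pt → ℝ} {p : Pt} (h : fderiv ℝ f p = fderiv ℝ ψ p) (r : ℝ) :
    levelDensity Λ m f r p = levelDensity Λ m ψ r p := by
  simp only [levelDensity, angularSq, rot, h]

/-- Passes from the indicator integrals of the divergence theorem to the set integrals that define
the fluxes; enlarging the set of integration only helps. -/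
theorem lintegral_ofReal_ite_le {α : Type*} [MeasurableSpace α] {μ : Measure α} {A B : Set α}
    {P : α → Prop} [DecidablePred P] (hA : MeasurableSet A) (hP : MeasurableSet {y | P y})
    {g : α → ℝ} {f : α → ℝ≥0∞} (h : ∀ y ∈ A, P y → y ∈ B ∧ ENNReal.ofReal (g y) = f y) :
    ∫⁻ y, ENNReal.ofReal (if P y then g y else 0) ∂μ.restrict A ≤ ∫⁻ y in B, f y ∂μ := by
  have e : ∀ y, ENNReal.ofReal (if P y then g y else 0) =
      {y | P y}.indicator (fun y => ENNReal.ofReal (g y)) y := fun y => by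
    by_cases hy : P y <;> simp [hy]
  simp only [e]
  rw [lintegral_indicator hP, Measure.restrict_restrict hP]
  calc _ = ∫⁻ y in {y | P y} ∩ A, f y ∂μ :=
        setLIntegral_congr_fun (hP.inter hA) fun y hy => (h y hy.2 hy.1).2
    _ ≤ _ := lintegral_mono_set fun y hy => (h y hy.2 hy.1).1

/-- The part of the region above the hypersurface on the level `s = c`. -/
def levelSlab (S : Hypersurface Λ m) (u₀ u₁ c : ℝ) : Set (ℝ × Sph) :=
  {y | y.1 ∈ Icc u₀ u₁ ∧ S.thresh y.1 y.2 ≤ c}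

theorem isClosed_levelSlab (S : Hypersurface Λ m) (h : Subextremal Λ m) (u₀ u₁ c : ℝ) :
    IsClosed (levelSlab S u₀ u₁ c) :=
  (isClosed_Icc.preimage continuous_fst).inter
    (isClosed_le (S.continuous_thresh h) continuous_const)

theorem isCompact_levelSlab (S : Hypersurface Λ m) (h : Subextremal Λ m) (u₀ u₁ c : ℝ) :
    IsCompact (levelSlab S u₀ u₁ c) :=
  (isCompact_Icc.prod isCompact_univ).of_isClosed_subset (isClosed_levelSlab S h u₀ u₁ c)
    fun _ hy => ⟨hy.1, mem_univ _⟩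

theorem lintegral_levelSlab_eq (S : Hypersurface Λ m) (h : Subextremal Λ m) {u₀ u₁ c : ℝ}
    {G : ℝ × Sph → ℝ} (hG : ContinuousOn G (levelSlab S u₀ u₁ c))
    (hG0 : ∀ y ∈ levelSlab S u₀ u₁ c, 0 ≤ G y) :
    ∫⁻ y, ENNReal.ofReal ((levelSlab S u₀ u₁ c).indicator G y) ∂cylMeasure =
      ENNReal.ofReal (∫ y, (if S.thresh y.1 y.2 ≤ c then G y else 0) ∂cylIcc u₀ u₁) := by
  have hZ := (isClosed_levelSlab S h u₀ u₁ c).measurableSet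
  have hI : MeasurableSet (Icc u₀ u₁ ×ˢ (univ : Set Sph)) := measurableSet_Icc.prod .univ
  have e1 : (fun y => ENNReal.ofReal ((levelSlab S u₀ u₁ c).indicator G y)) =
      (Icc u₀ u₁ ×ˢ univ).indicator
        fun y => ENNReal.ofReal ((levelSlab S u₀ u₁ c).indicator G y) := by
    symm
    rw [indicator_eq_self]
    intro y hy
    by_contra hcon
    refine hy ?_
    change ENNReal.ofReal ((levelSlab S u₀ u₁ c).indicator G y) = 0
    rw [indicator_of_notMem fun hZy => hcon ⟨hZy.1, mem_univ _⟩, ENNReal.ofReal_zero]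
  have hint : Integrable ((levelSlab S u₀ u₁ c).indicator G) (cylIcc u₀ u₁) :=
    (integrable_indicator_iff hZ).2
      (hG.integrableOn_compact (isCompact_levelSlab S h u₀ u₁ c))
  rw [e1, lintegral_indicator hI, ← ofReal_integral_eq_lintegral_ofReal hint
    (.of_forall fun y => indicator_nonneg hG0 y)]
  congr 1
  refine integral_congr_ae ?_
  filter_upwards [ae_cylIcc_mem u₀ u₁] with y hy
  by_cases hc : S.thresh y.1 y.2 ≤ c
  · rw [if_pos hc, indicator_of_mem (show y ∈ levelSlab S u₀ u₁ c from ⟨hy, hc⟩)]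
  · rw [if_neg hc, indicator_of_notMem fun hZy => hc hZy.2]

theorem measurable_indicator_levelSlab (S : Hypersurface Λ m) (h : Subextremal Λ m) {u₀ u₁ c : ℝ}
    {G : ℝ × Sph → ℝ} (hG : ContinuousOn G (levelSlab S u₀ u₁ c)) :
    Measurable ((levelSlab S u₀ u₁ c).indicator G) := by
  classical
  rw [← piecewise_eq_indicator]
  exact hG.measurable_piecewise continuousOn_const (isClosed_levelSlab S h u₀ u₁ c).measurableSet

/-- The points of a bounded part of the region above the hypersurface. -/
def slab (S : Hypersurface Λ m) (u₀ u₁ c : ℝ) : Set Pt :=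
  (fun p : ℝ × ℝ × Sph => cylPt p.1 p.2.1 p.2.2) ''
    (box3 u₀ u₁ c ∩ {p | S.thresh p.1 p.2.2 ≤ p.2.1})

theorem cylPt_mem_slab {S : Hypersurface Λ m} {u₀ u₁ c u s : ℝ} {x : Sph} (hu : u ∈ Icc u₀ u₁)
    (hs : s ∈ Icc 0 c) (hle : S.thresh u x ≤ s) : cylPt u s x ∈ slab S u₀ u₁ c :=
  ⟨(u, s, x), ⟨⟨hu, hs, mem_univ _⟩, hle⟩, rfl⟩

theorem isCompact_slab (S : Hypersurface Λ m) (h : Subextremal Λ m) {u₀ : ℝ} (hu₀ : 0 < u₀)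
    (u₁ c : ℝ) : IsCompact (slab S u₀ u₁ c) := by
  refine IsCompact.image_of_continuousOn ?_ ((continuousOn_cylPt hu₀).mono inter_subset_left)
  have hc : Continuous fun p : ℝ × ℝ × Sph => S.thresh p.1 p.2.2 :=
    Continuous.comp (g := fun y : ℝ × Sph => S.thresh y.1 y.2)
      (f := fun p : ℝ × ℝ × Sph => (p.1, p.2.2)) (S.continuous_thresh h) (by fun_prop)
  exact (isCompact_Icc.prod (isCompact_Icc.prod isCompact_univ)).inter_right
    (isClosed_le hc (by fun_prop))

theorem slab_subset_region (S : Hypersurface Λ m) {u₀ u₁ c : ℝ} (hu₀ : 0 < u₀) (hc : c < 1) :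
    slab S u₀ u₁ c ⊆ S.region := by
  rintro _ ⟨p, ⟨⟨hu, hs, -⟩, hle⟩, rfl⟩
  exact S.cylPt_mem_region (hu₀.trans_le hu.1) hs.1 (hs.2.trans_lt hc) hle

/-! ### The estimate on a level set of the radius -/

section Estimate

variable (S : Hypersurface Λ m) (h : Subextremal Λ m) {K ε : ℝ} (hK : IsRedshiftPair Λ m K ε)
  {u₀ c r : ℝ} (hu₀ : 0 < u₀)
  (hS : ∀ x : E3, ‖x‖ = 1 → u₀ < S.cross x ∧ ∀ u ∈ Icc 0 u₀, u₀ < S.height (u, x))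
  (hr : rH Λ m < r) (hc : uvOfRadius Λ m r = c) (hc0 : 0 < c) (hcε : c ≤ ε) (hcu : c < u₀ ^ 2)

include h hu₀ hr hc hc0 hcu in
-- Raising `v` to `c / u` at fixed `u` and `x` reaches `Σ_r`, so the point is in its past. It lies
-- in `{u > v}` because `u v ≤ c < u₀² ≤ u²`.
theorem pt_mem_of_thresh {y : ℝ × Sph} (hc1 : c < 1) (hu : u₀ ≤ y.1) (h0 : 0 < S.thresh y.1 y.2)
    (hle : S.thresh y.1 y.2 ≤ c) :
    S.pt y ∈ S.carrier ∩ (causalPast Λ m (levelSet Λ m r) ∩ horizonSide) := by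
  obtain ⟨u, x⟩ := y
  simp only at hu h0 hle
  have hup : 0 < u := hu₀.trans_le hu
  have hx := Hypersurface.norm_coe_sph x
  have hlt := S.lt_cross_of_thresh_pos h0
  have hh := S.height_pos x hx u hup.le hlt
  rw [S.thresh_of_le hlt.le] at hle
  have hcu' : u * (c / u) = c := mul_div_cancel₀ _ hup.ne'
  refine ⟨⟨hx, hup.le, hlt.le, rfl⟩, ⟨(u, c / u, (x : E3)), ⟨⟨?_, hx⟩, hup, div_pos hc0 hup, ?_⟩,
    h.causallyPrecedes_of_le hx hup.le hh.le le_rfl ?_ ?_⟩, ?_⟩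
  · exact hcu'.trans_lt hc1
  · rw [radius_eq_rad]
    change rad Λ m (u * (c / u)) = r
    rw [hcu', ← hc, h.rad_uvOfRadius hr]
  · rw [le_div_iff₀ hup, mul_comm]; exact hle
  · exact hcu'.trans_lt hc1
  · change S.height (u, (x : E3)) < u
    have h1 : u₀ ^ 2 ≤ u * u := by rw [sq]; gcongr
    exact lt_of_mul_lt_mul_left (hle.trans_lt (hcu.trans_le h1)) hup.le

include hS hc hc0 in
-- A point of the region with `u < u₀` satisfies `v ≥ height > u₀ > u`, so it lies on the other side
-- of `{u = v}`. The restriction to `{u > v}` thus confines the estimate to `u ≥ u₀`.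
theorem mem_levelSlab_of_levelPt_mem {y : ℝ × Sph} (hy : levelPt Λ m r y ∈ S.region ∩ horizonSide) :
    u₀ ≤ levelU Λ m c y.1 ∧ S.thresh (levelU Λ m c y.1) y.2 ≤ c := by
  rw [levelPt_eq hc hc0] at hy
  have hup := levelU_pos (Λ := Λ) (m := m) hc0 y.1
  obtain ⟨hreg, hside⟩ := hy
  have hside : c / levelU Λ m c y.1 < levelU Λ m c y.1 := hside
  refine ⟨?_, (S.thresh_le_of_mem_region hreg).trans_eq (mul_div_cancel₀ _ hup.ne')⟩
  by_contra! hlt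
  obtain ⟨h1, h2⟩ := hS y.2 (Hypersurface.norm_coe_sph y.2)
  obtain ⟨-, -, -, h3 | h3⟩ := hreg
  · exact absurd (h1.trans_le h3) (not_lt.2 hlt.le)
  · have h4 := h2 (levelU Λ m c y.1) ⟨hup.le, hlt.le⟩
    have h3 : S.height (levelU Λ m c y.1, (y.2 : E3)) ≤ c / levelU Λ m c y.1 := h3
    linarith

include h hK hu₀ hS hr hc hc0 hcε hcu in
-- The estimate truncated at `u ≤ u₁`. The truncated region is compact, so the solution may be
-- replaced there by a globally defined `C²` function with the same germs.
theorem lintegral_levelDensity_le {W : Set Pt} {ψ : Pt → ℝ} (hW : IsOpen W)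
    (hJ : causalFuture Λ m S.carrier ⊆ W) (hψ : IsWaveSolution Λ m W ψ) {u₁ : ℝ} (hu : u₀ ≤ u₁) :
    ∫⁻ y in (fun y : ℝ × Sph => (levelU Λ m c y.1, y.2)) ⁻¹' levelSlab S u₀ u₁ c,
        ENNReal.ofReal (levelDensity Λ m ψ r (levelPt Λ m r y)) ∂cylMeasure ≤
      ENNReal.ofReal (levelConst Λ m r) *
          horizonFlux Λ m ψ (redshiftField K) (causalFuture Λ m S.carrier) +
        ENNReal.ofReal (levelConst Λ m r) * S.flux ψ (redshiftField K)
          (causalPast Λ m (levelSet Λ m r) ∩ horizonSide) := by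
  have hc1 : c < 1 := hcε.trans_lt hK.eps_lt
  have hrad : rad Λ m c = r := by rw [← hc, h.rad_uvOfRadius hr]
  have hslab := slab_subset_region S (u₁ := u₁) hu₀ hc1
  rw [S.causalFuture_eq_region h] at hJ ⊢
  obtain ⟨f, hf, hfψ⟩ := exists_contDiff_eventuallyEq hW (isCompact_slab S h hu₀ u₁ c)
    (hslab.trans hJ) hψ.1
  have hd : ∀ p ∈ slab S u₀ u₁ c, fderiv ℝ f p = fderiv ℝ ψ p := fun p hp => (hfψ p hp).fderiv_eq
  have hsub : Icc 0 c ⊆ Iio 1 := fun s hs => hs.2.trans_lt hc1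
  have hcm : c ∈ Icc 0 c := ⟨hc0.le, le_rfl⟩
  have hcε' : c ∈ Icc 0 ε := ⟨hc0.le, hcε⟩
  have hκ := h.kappa_pos
  have hC : 0 ≤ levelConst Λ m r := by
    have : 0 < omegaSqOfRadius Λ m r := by
      have := h.omg_pos hc1
      rwa [omg, hrad] at this
    unfold levelConst
    positivity
  set G : ℝ × Sph → ℝ := fun y => fluxS (coefA Λ m K) (coefB Λ m K) f y.1 c y.2 with hGdef
  have hG : ContinuousOn G (levelSlab S u₀ u₁ c) :=
    (continuousOn_fluxS hf hu₀ ((h.continuousOn_coefA K).mono hsub)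
      ((h.continuousOn_coefB K).mono hsub)).comp
      (f := fun y : ℝ × Sph => (y.1, c, y.2)) (by fun_prop) fun y hy => ⟨hy.1, hcm, mem_univ _⟩
  have hG0 : ∀ y ∈ levelSlab S u₀ u₁ c, 0 ≤ G y := fun y hy =>
    fluxS_nonneg h hK f (hu₀.trans_le hy.1.1) hcε' y.2
  have mG := measurable_indicator_levelSlab S h hG
  have hZ := (isClosed_levelSlab S h u₀ u₁ c).measurableSet
  have mU : Measurable fun y : ℝ × Sph => (levelU Λ m c y.1, y.2) :=
    ((continuous_levelU c).measurable.comp measurable_fst).prodMk measurable_snd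
  have hHc : ∀ x, c < S.thresh u₀ x := fun x => by
    obtain ⟨h1, h2⟩ := hS x (Hypersurface.norm_coe_sph x)
    rw [S.thresh_of_le h1.le]
    have := mul_lt_mul_of_pos_left (h2 u₀ ⟨hu₀.le, le_rfl⟩) hu₀
    linarith [sq u₀]
  have hener := energy_inequality S h hK hf hu₀ hu hc0.le hcε hHc fun u hu' s hs x hle => by
    have hm := cylPt_mem_slab hu' hs hle
    rw [box_congr (hfψ _ hm)]
    exact hψ.2 _ ⟨hJ (hslab hm), (hslab hm).1⟩
  have hI : MeasurableSet (Icc u₀ u₁ ×ˢ (univ : Set Sph)) := measurableSet_Icc.prod .univ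
  have mH := (S.continuous_thresh h).measurable
  -- The energy inequality for the extension `f`, with both fluxes on the right rewritten for `ψ`
  -- and enlarged to their full domains, independent of `u₁`.
  have step : ∫⁻ y, ENNReal.ofReal ((levelSlab S u₀ u₁ c).indicator G y) ∂cylMeasure ≤
      horizonFlux Λ m ψ (redshiftField K) S.region +
        S.flux ψ (redshiftField K) (causalPast Λ m (levelSet Λ m r) ∩ horizonSide) := by
    rw [lintegral_levelSlab_eq S h hG hG0]
    refine (ENNReal.ofReal_le_ofReal hener).trans (ENNReal.ofReal_add_le.trans
      (add_le_add ?_ ?_))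
    · refine (ofReal_integral_le_lintegral _ _).trans (lintegral_ofReal_ite_le hI
        (measurableSet_le mH measurable_const) fun y hy hle => ?_)
      have hup : 0 < y.1 := hu₀.trans_le hy.1.1
      have hm : cylPt y.1 0 y.2 ∈ slab S u₀ u₁ c := cylPt_mem_slab hy.1 ⟨le_rfl, hc0.le⟩ hle
      have hp : ((y.1, 0, (y.2 : E3)) : Pt) = cylPt y.1 0 y.2 := by simp [cylPt]
      refine ⟨⟨⟨?_, hup.le, rfl⟩, ?_⟩, ?_⟩
      · rw [hp]; exact (hslab hm).1
      · rw [hp]; exact hslab hm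
      · have hd' : fderiv ℝ f (y.1, 0, (y.2 : E3)) = fderiv ℝ ψ (y.1, 0, (y.2 : E3)) := by
          rw [hp]; exact hd _ hm
        rw [← emTensor_horizon h K f hup.ne', emTensor_congr hd']
    · refine (ofReal_integral_le_lintegral _ _).trans (lintegral_ofReal_ite_le
        (P := fun y : ℝ × Sph => 0 < S.thresh y.1 y.2 ∧ S.thresh y.1 y.2 ≤ c) hI
        ((measurableSet_lt measurable_const mH).inter (measurableSet_le mH measurable_const))
        fun y hy hle => ?_)
      have hup : 0 < y.1 := hu₀.trans_le hy.1.1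
      have hlt := S.lt_cross_of_thresh_pos hle.1
      have hm : S.pt y ∈ slab S u₀ u₁ c := by
        have hp : S.pt y = cylPt y.1 (S.thresh y.1 y.2) y.2 := by
          rw [S.thresh_of_le hlt.le, cylPt, mul_div_cancel_left₀ _ hup.ne']; rfl
        rw [hp]
        exact cylPt_mem_slab hy.1 ⟨hle.1.le, hle.2⟩ le_rfl
      refine ⟨pt_mem_of_thresh S h hu₀ hr hc hc0 hcu hc1 hy.1.1 hle.1 hle.2, ?_⟩
      rw [← graphFlux_eq S h K f hup hlt.le, emTensor_congr (hd _ hm)]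
  rw [← mul_add]
  calc _ ≤ ∫⁻ y in (fun y : ℝ × Sph => (levelU Λ m c y.1, y.2)) ⁻¹' levelSlab S u₀ u₁ c,
        ENNReal.ofReal (levelConst Λ m r) * (ENNReal.ofReal (kappa Λ m * levelU Λ m c y.1) *
          ENNReal.ofReal ((levelSlab S u₀ u₁ c).indicator G (levelU Λ m c y.1, y.2)))
        ∂cylMeasure := by
        refine setLIntegral_mono' (mU hZ) fun y hy => ?_
        have hup := levelU_pos (Λ := Λ) (m := m) hc0 y.1
        have hm : cylPt (levelU Λ m c y.1) c y.2 ∈ slab S u₀ u₁ c := cylPt_mem_slab hy.1 hcm hy.2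
        rw [← ENNReal.ofReal_mul (by positivity), ← ENNReal.ofReal_mul hC, indicator_of_mem
          (show (levelU Λ m c y.1, y.2) ∈ levelSlab S u₀ u₁ c from hy),
          levelPt_eq hc hc0, ← levelDensity_congr (hd _ hm)]
        refine ENNReal.ofReal_le_ofReal ?_
        have := levelDensity_le h hK f hup hcε' y.2
        rwa [hrad] at this
    _ ≤ ∫⁻ y, ENNReal.ofReal (levelConst Λ m r) *
        (ENNReal.ofReal (kappa Λ m * levelU Λ m c y.1) *
          ENNReal.ofReal ((levelSlab S u₀ u₁ c).indicator G (levelU Λ m c y.1, y.2)))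
        ∂cylMeasure := setLIntegral_le_lintegral _ _
    _ = ENNReal.ofReal (levelConst Λ m r) *
        ∫⁻ y, ENNReal.ofReal (kappa Λ m * levelU Λ m c y.1) *
          ENNReal.ofReal ((levelSlab S u₀ u₁ c).indicator G (levelU Λ m c y.1, y.2))
        ∂cylMeasure := lintegral_const_mul' _ _ ENNReal.ofReal_ne_top
    _ ≤ _ := by
        gcongr
        exact (lintegral_levelU_le h hc0 (F := fun y => ENNReal.ofReal
          ((levelSlab S u₀ u₁ c).indicator G y)) mG.ennreal_ofReal).trans step

include h hK hu₀ hS hr hc hc0 hcε hcu in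
-- The truncations `u ≤ u₀ + n` exhaust the end of the level set, and the bound does not depend on
-- `n`; so monotone convergence suffices, with no decay assumption on `ψ`.
theorem levelEnergy_le {W : Set Pt} {ψ : Pt → ℝ} (hW : IsOpen W)
    (hJ : causalFuture Λ m S.carrier ⊆ W) (hψ : IsWaveSolution Λ m W ψ) :
    levelEnergy Λ m ψ r (causalFuture Λ m S.carrier ∩ horizonSide) ≤
      ENNReal.ofReal (levelConst Λ m r) *
          horizonFlux Λ m ψ (redshiftField K) (causalFuture Λ m S.carrier) +
        ENNReal.ofReal (levelConst Λ m r) * S.flux ψ (redshiftField K)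
          (causalPast Λ m (levelSet Λ m r) ∩ horizonSide) := by
  set T : ℕ → Set (ℝ × Sph) := fun n =>
    (fun y : ℝ × Sph => (levelU Λ m c y.1, y.2)) ⁻¹' levelSlab S u₀ (u₀ + n) c with hT
  have hmono : Monotone T := fun n k hnk y hy => by
    have : (n : ℝ) ≤ k := Nat.cast_le.2 hnk
    exact ⟨⟨hy.1.1, hy.1.2.trans (by linarith)⟩, hy.2⟩
  have hsub : {y | levelPt Λ m r y ∈ levelSet Λ m r ∩ (causalFuture Λ m S.carrier ∩ horizonSide)} ⊆
      ⋃ n, T n := by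
    rintro y ⟨-, hy⟩
    rw [S.causalFuture_eq_region h] at hy
    obtain ⟨h1, h2⟩ := mem_levelSlab_of_levelPt_mem S hS hc hc0 hy
    obtain ⟨n, hn⟩ := exists_nat_ge (levelU Λ m c y.1)
    exact mem_iUnion.2 ⟨n, ⟨⟨h1, by linarith⟩, h2⟩⟩
  refine (lintegral_mono_set hsub).trans ?_
  rw [setLIntegral_iUnion_of_directed _ hmono.directed_le]
  exact iSup_le fun n => lintegral_levelDensity_le S h hK hu₀ hS hr hc hc0 hcε hcu hW hJ hψ
    (le_add_of_nonneg_right n.cast_nonneg)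

end Estimate

/-! ### The multiplier field -/

theorem contDiffOn_redshiftField (K : ℝ) : ContDiffOn ℝ ∞ (redshiftField K) {p | p.1 ≠ 0} := by
  have h1 : ContDiffOn ℝ ∞ (fun p : Pt => p.1⁻¹) {p | p.1 ≠ 0} :=
    contDiff_fst.contDiffOn.inv fun _ hp => hp
  have h2 : ContDiffOn ℝ ∞ (fun p : Pt => 1 - K * (p.1 * p.2.1)) {p | p.1 ≠ 0} := by fun_prop
  exact (h2.mul contDiff_fst.contDiffOn).prodMk ((h2.mul h1).prodMk contDiffOn_const)

theorem redshiftField_flow (K t : ℝ) (p : Pt) :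
    redshiftField K (flow Λ m t p) = flow Λ m t (redshiftField K p) := by
  have he : Real.exp (kappa Λ m * t) * p.1 * (Real.exp (-(kappa Λ m * t)) * p.2.1) =
      p.1 * p.2.1 := by
    rw [Real.exp_neg]
    field_simp
  simp only [redshiftField, flow, he]
  rw [mul_inv, ← Real.exp_neg]
  refine Prod.ext ?_ (Prod.ext ?_ rfl) <;> simp only <;> ring

theorem futureTimelike_redshiftField (h : Subextremal Λ m) {K : ℝ} {p : Pt} (hp : p ∈ spacetime)
    (hu : 0 < p.1) (hK : 0 < 1 - K * (p.1 * p.2.1)) :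
    FutureTimelike Λ m p (redshiftField K p) := by
  have ho : 0 < omegaSq Λ m p := h.omg_pos hp.1
  refine ⟨by simp [Tangent, redshiftField], ?_, mul_pos hK hu, mul_pos hK (inv_pos.2 hu)⟩
  simp only [metric, redshiftField, inner_zero_right]
  have : -(omegaSq Λ m p / 2) * ((1 - K * (p.1 * p.2.1)) * p.1 * ((1 - K * (p.1 * p.2.1)) * p.1⁻¹) +
      (1 - K * (p.1 * p.2.1)) * p.1⁻¹ * ((1 - K * (p.1 * p.2.1)) * p.1)) + radius Λ m p ^ 2 * 0 =
      -(omegaSq Λ m p * (1 - K * (p.1 * p.2.1)) ^ 2) := by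
    field_simp
    ring
  rw [this]
  exact neg_neg_of_pos (by positivity)

end SdS

end

/-! ### The choice of the constants -/

theorem mainTheorem8 (Λ m : ℝ) (hΛ : 0 < Λ) (hm : 0 < m) (hsub : 3 * m * √Λ < 1) :
    ∃ C : ℝ → ℝ≥0, ∀ S : SdS.Hypersurface Λ m, ∃ (rminus rplus : ℝ) (N : SdS.Pt → SdS.Pt),
      SdS.rH Λ m < rminus ∧ rminus < SdS.rC Λ m ∧ SdS.rC Λ m < rplus ∧
      (∀ p ∈ SdS.causalFuture Λ m S.carrier, SdS.radius Λ m p ≤ rplus → p.1 ≠ p.2.1) ∧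
      (∃ O : Set SdS.Pt, IsOpen O ∧ SdS.nearHorizon Λ m rminus rplus ⊆ O ∧ ContDiffOn ℝ ∞ N O) ∧
      (∀ p ∈ SdS.nearHorizon Λ m rminus rplus, SdS.FutureTimelike Λ m p (N p)) ∧
      (∀ p ∈ SdS.nearHorizon Λ m rminus rplus, ∀ t : ℝ,
        N (SdS.flow Λ m t p) = SdS.flow Λ m t (N p)) ∧
      ∀ (W : Set SdS.Pt) (ψ : SdS.Pt → ℝ), IsOpen W → SdS.causalFuture Λ m S.carrier ⊆ W →
        SdS.IsWaveSolution Λ m W ψ →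
        ∀ r₁ : ℝ, SdS.rC Λ m < r₁ → r₁ < rplus →
          SdS.levelEnergy Λ m ψ r₁ (SdS.causalFuture Λ m S.carrier ∩ SdS.horizonSide) ≤
            (C r₁ : ℝ≥0∞) * SdS.horizonFlux Λ m ψ N (SdS.causalFuture Λ m S.carrier) +
            (C r₁ : ℝ≥0∞) * S.flux ψ N
              (SdS.causalPast Λ m (SdS.levelSet Λ m r₁) ∩ SdS.horizonSide) := by
  obtain ⟨hH, hHC⟩ := SdS.rH_pos_and_lt hΛ hm hsub
  have h : SdS.Subextremal Λ m := ⟨hΛ, hH, hHC⟩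
  obtain ⟨K, ε, h1, h2, h3, h4, h5⟩ := h.exists_redshift_constants
  have hK : SdS.IsRedshiftPair Λ m K ε := ⟨h1, h2, h3, h4, h5⟩
  -- The redshift constants and `levelConst` are fixed before `Σ`; only the size of the
  -- neighbourhood depends on `Σ`.
  refine ⟨fun r => (SdS.levelConst Λ m r).toNNReal, fun S => ?_⟩
  obtain ⟨u₀, hu₀, hS⟩ := S.exists_lt_height
  -- `δ ≤ ε` keeps the redshift estimates and the timelike character of the multiplier. `δ < u₀²`
  -- excludes `{u = v}` and makes the threshold at `u = u₀` exceed every level that is used.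
  set δ := min ε (u₀ ^ 2 / 2) with hδ
  have hδ0 : 0 < δ := lt_min h2 (by positivity)
  have hδε : δ ≤ ε := min_le_left _ _
  have hδ1 : δ < 1 := hδε.trans_lt h3
  have hδu : δ < u₀ ^ 2 := (min_le_right _ _).trans_lt (half_lt_self (by positivity))
  have hlt : ∀ p ∈ SdS.spacetime, SdS.radius Λ m p ≤ SdS.rad Λ m δ → p.1 * p.2.1 ≤ δ := by
    intro p hp hle
    exact (h.rad_strictMonoOn.le_iff_le hp.1 hδ1).1 hle
  have hC : SdS.rC Λ m < SdS.rad Λ m δ := by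
    rw [← h.rad_uvOfRadius hHC, SdS.Subextremal.uvOfRadius_rC]
    exact h.rad_strictMonoOn (show (0 : ℝ) < 1 from one_pos) hδ1 hδ0
  -- Any radius strictly between `rH` and `rC` would serve as the inner one: the multiplier is
  -- timelike wherever `u > 0` and `K u v < 1`, in particular for `u v ≤ 0`.
  refine ⟨(SdS.rH Λ m + SdS.rC Λ m) / 2, SdS.rad Λ m δ, SdS.redshiftField K, by linarith,
    by linarith, hC, ?_, ⟨{p | p.1 ≠ 0}, isOpen_ne_fun continuous_fst continuous_const,
      fun p hp => hp.2.1.ne', SdS.contDiffOn_redshiftField K⟩, ?_,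
    fun p _ t => SdS.redshiftField_flow K t p, ?_⟩
  -- On `u = v`, either `u ≥ u₀` and `u v ≥ u₀² > δ`, or `u < u₀` and the point lies below `Σ`,
  -- whose height exceeds `u₀` there.
  · intro p hp hle heq
    rw [S.causalFuture_eq_region h] at hp
    obtain ⟨hsp, hu, -, hor⟩ := hp
    have h6 := hlt p hsp hle
    rw [← heq] at h6 hor
    obtain ⟨h7, h8⟩ := hS p.2.2 hsp.2
    have h9 : u₀ ≤ p.1 := by
      by_contra! hcon
      rcases hor with hor | hor
      · linarith
      · linarith [h8 p.1 ⟨hu, hcon.le⟩]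
    have : u₀ ^ 2 ≤ p.1 * p.1 := by rw [sq]; gcongr
    linarith
  · intro p hp
    refine SdS.futureTimelike_redshiftField h hp.1 hp.2.1 ?_
    have h6 := mul_le_mul_of_nonneg_left ((hlt p hp.1 hp.2.2.2).trans hδε) h1.le
    linarith
  · intro W ψ hW hJ hψ r₁ hr₁ hr₁'
    have hr : SdS.rH Λ m < r₁ := hHC.trans hr₁
    have hc0 : 0 < SdS.uvOfRadius Λ m r₁ := by
      rw [← SdS.Subextremal.uvOfRadius_rC (Λ := Λ) (m := m)]
      exact h.strictMonoOn_uvOfRadius hHC hr hr₁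
    have hcδ : SdS.uvOfRadius Λ m r₁ < δ := by
      rw [← h.uvOfRadius_rad hδ1]
      exact h.strictMonoOn_uvOfRadius hr (hr.trans hr₁') hr₁'
    exact SdS.levelEnergy_le S h hK hu₀ hS hr rfl hc0 (hcδ.le.trans hδε) (hcδ.trans hδu) hW hJ hψ
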